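/- **Theorem (Density of smooth functions).** Let $n\ge 1$ and let $\Omega\subset\mathbb R^n$ be a bounded Lipschitz domain. *Definitions.* A *weak $N$-function* on $\Omega\times V$, where $V=\mathbb R^n$ or $V=\mathbb R$, is a function $M:\Omega\times V\to[0,\infty)$ such that: $M(\cdot,\xi)$ is measurable for every $\xi$; for a.e. $x\in\Omega$ the function $M(x,\cdot)$ is continuous, convex and even with $M(x,0)=0$; and there are convex functions $m_1,m_2:[0,\infty)\to[0,\infty)$ with $m_1(0)=0$ and $m_1(s)>0$ for $s>0$ such that $m_1(|\xi|)\le M(x,\xi)\le m_2(|\xi|)$ for a.e. $x\in\Omega$ and all $\xi\in V$. A function $m:\Omega\times[0,\infty)\to[0,\infty)$ is a weak $N$-function if $(x,s)\mapsto m(x,|s|)$ is one on $\Omega\times\mathbb R$. For such $m$, a ball $B\subset\mathbb R^n$ and $t\ge0$ put $m_B^-(t)=\operatorname{ess\,inf}_{y\in B\cap\Omega}m(y,t)$ and $m_B^+(t)=\operatorname{ess\,sup}_{y\in B\cap\Omega}m(y,t)$. Let $\gamma\in[0,1]$. A function $M:\Omega\times\mathbb R^n\to[0,\infty)$ satisfies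 * $(B^{iso}_\gamma)$ if $M(x,\xi)=m(x,|\xi|)$ for a weak $N$-function $m:\Omega\times[0,\infty)\to[0,\infty)$, and there are constants $c^\Diamond,C^\Diamond\ge1$ such that $m_B^+(|\xi|)\le m_B^-(C^\Diamond|\xi|)+1$ for every ball $B$ of radius $r\le1$ and every $\xi\in\mathbb R^n$ with $|\xi|\le c^\Diamond r^{\gamma-1}$; * $(B^{ort}_\gamma)$ if $M(x,\xi)=\sum_{i=1}^n M_i(x,|\xi_i|)$ for weak $N$-functions $M_i:\Omega\times[0,\infty)\to[0,\infty)$, and there are constants $c^\Diamond,C^\Diamond\ge1$ such that $(M_i)_B^+(|s|)\le (M_i)_B^-(C^\Diamond|s|)+1$ for every ball $B$ of radius $r\le1$, every $i$ and every $s\in\mathbb R$ with $|s|\le c^\Diamond r^{\gamma-1}$. $L_M(\Omega;\mathbb R^n)$ is the smallest linear space containing all measurable $\xi:\Omega\to\mathbb R^n$ with $\int_\Omega M(x,\xi(x))\,dx<\infty$. $W^{1,1}_0(\Omega)$ is the closure of $C_c^\infty(\Omega)$ in $W^{1,1}(\Omega)$, and $V^1_0L_M(\Omega)=\{f\in W^{1,1}_0(\Omega):\nabla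 f\in L_M(\Omega;\mathbb R^n)\}$ with $\nabla$ the distributional gradient. For $\gamma\in(0,1]$, $C^{0,\gamma}(\Omega)$ is the set of functions $h$ on $\Omega$ with $\sup_{x\ne y\in\Omega}|h(x)-h(y)|/|x-y|^\gamma<\infty$. A family $\xi_\delta$ converges *modularly* to $\xi$ in $L_M$ as $\delta\to0^+$ if there is $\lambda>0$ with $\int_\Omega M\bigl(x,(\xi_\delta(x)-\xi(x))/\lambda\bigr)\,dx\to0$. *Claim.* There is a constant $c=c(\Omega)>0$ such that the following holds for every weak $N$-function $M:\Omega\times\mathbb R^n\to[0,\infty)$ that is continuous on $\Omega\times\mathbb R^n$. 1. If $M$ satisfies $(B^{iso}_0)$ or $(B^{ort}_0)$, then for every $\varphi\in V^1_0L_M(\Omega)$ there is a family $\{\varphi_\delta\}_{\delta>0}\subset C_c^\infty(\Omega)$ such that, as $\delta\to0^+$, $\varphi_\delta\to\varphi$ strongly in $L^1(\Omega)$ and in measure, and $\nabla\varphi_\delta\to\nabla\varphi$ modularly in $L_M(\Omega;\mathbb R^n)$. 2. If $\gamma\in(0,1]$ and $M$ satisfies $(B^{iso}_\gamma)$ or $(B^{ort}_\gamma)$,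 then for every $\varphi\in V^1_0L_M(\Omega)\cap C^{0,\gamma}(\Omega)$ there is a family $\{\varphi_\delta\}_{\delta>0}\subset C_c^\infty(\Omega)$ with the same convergence properties. Moreover, in both cases, if $\varphi\in L^\infty(\Omega)$, then the family can be chosen so that in addition $\|\varphi_\delta\|_{L^\infty(\Omega)}\le c\,\|\varphi\|_{L^\infty(\Omega)}$ for every $\delta>0$. -/

import Mathlib

open MeasureTheory Filter Topology Set
open scoped NNReal ENNReal ContDiff Gradient

noncomputable section

namespace MusielakOrlicz

/-- The Euclidean space `ℝⁿ`. -/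
abbrev Rn (n : ℕ) : Type := EuclideanSpace ℝ (Fin n)

/-- Bounded Lipschitz domains: bounded, open, connected (in particular nonempty) sets that near
every boundary point are, in suitable orthonormal coordinates, the strict epigraph of a Lipschitz
function. Here the unit vector `e` is the vertical direction at the boundary point `a`, the vertical
coordinate of `y` is `⟪e, y⟫`, its horizontal part is `y - ⟪e, y⟫ e`, and only the values of `g` on
the hyperplane orthogonal to `e` are used. -/
structure IsBoundedLipschitzDomain {n : ℕ} (Ω : Set (Rn n)) : Prop where
  isOpen : IsOpen Ω
  isConnected : IsConnected Ω
  isBounded : Bornology.IsBounded Ω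
  lipschitz_boundary : ∀ a ∈ frontier Ω, ∃ r : ℝ, 0 < r ∧ ∃ e : Rn n, ‖e‖ = 1 ∧
    ∃ (K : ℝ≥0) (g : Rn n → ℝ), LipschitzWith K g ∧
      Ω ∩ Metric.ball a r =
        {y ∈ Metric.ball a r | g (y - inner ℝ e y • e) < inner ℝ e y}

/-- Weak N-functions `M : Ω × V → [0, ∞)`, where `V` is `ℝⁿ` or `ℝ`. Only the values `M x ξ` with
`x ∈ Ω` matter. -/
structure IsWeakNFunction {n : ℕ} {V : Type*} [NormedAddCommGroup V] [NormedSpace ℝ V]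
    (Ω : Set (Rn n)) (M : Rn n → V → ℝ) : Prop where
  nonneg : ∀ x ∈ Ω, ∀ ξ, 0 ≤ M x ξ
  measurable_left : ∀ ξ, AEMeasurable (fun x => M x ξ) (volume.restrict Ω)
  continuous_right : ∀ᵐ x ∂(volume.restrict Ω), Continuous (M x)
  map_zero : ∀ᵐ x ∂(volume.restrict Ω), M x 0 = 0
  convex : ∀ᵐ x ∂(volume.restrict Ω), ConvexOn ℝ univ (M x)
  even : ∀ᵐ x ∂(volume.restrict Ω), ∀ ξ, M x ξ = M x (-ξ)
  bounds : ∃ m₁ m₂ : ℝ → ℝ,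
    ConvexOn ℝ (Ici 0) m₁ ∧ ConvexOn ℝ (Ici 0) m₂ ∧
    (∀ s, 0 ≤ s → 0 ≤ m₁ s ∧ 0 ≤ m₂ s) ∧
    m₁ 0 = 0 ∧ (∀ s, 0 < s → 0 < m₁ s) ∧
    ∀ᵐ x ∂(volume.restrict Ω), ∀ ξ, m₁ ‖ξ‖ ≤ M x ξ ∧ M x ξ ≤ m₂ ‖ξ‖

/-- Weak N-functions `m : Ω × [0, ∞) → [0, ∞)` of a nonnegative real variable: those whose even
extension in the second variable is a weak N-function on `Ω × ℝ`. -/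
def IsWeakNFunctionHalfLine {n : ℕ} (Ω : Set (Rn n)) (m : Rn n → ℝ → ℝ) : Prop :=
  IsWeakNFunction Ω (fun x (s : ℝ) => m x |s|)

/-- `m⁺_B(t)`, the essential supremum over `y ∈ B ∩ Ω` of `m(y, t)`. -/
def upperEnv {n : ℕ} (Ω : Set (Rn n)) (m : Rn n → ℝ → ℝ) (B : Set (Rn n)) (t : ℝ) : ℝ≥0∞ :=
  essSup (fun y => ENNReal.ofReal (m y t)) (volume.restrict (B ∩ Ω))

/-- `m⁻_B(t)`, the essential infimum over `y ∈ B ∩ Ω` of `m(y, t)`. -/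
def lowerEnv {n : ℕ} (Ω : Set (Rn n)) (m : Rn n → ℝ → ℝ) (B : Set (Rn n)) (t : ℝ) : ℝ≥0∞ :=
  essInf (fun y => ENNReal.ofReal (m y t)) (volume.restrict (B ∩ Ω))

/-- The isotropic balance condition with parameter `γ`. -/
def IsotropicCondition {n : ℕ} (Ω : Set (Rn n)) (M : Rn n → Rn n → ℝ) (γ : ℝ) : Prop :=
  ∃ m : Rn n → ℝ → ℝ, IsWeakNFunctionHalfLine Ω m ∧
    (∀ x ∈ Ω, ∀ ξ, M x ξ = m x ‖ξ‖) ∧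
    ∃ c C : ℝ, 1 ≤ c ∧ 1 ≤ C ∧
      ∀ (a : Rn n) (r : ℝ), 0 < r → r ≤ 1 → ∀ ξ : Rn n, ‖ξ‖ ≤ c * r ^ (γ - 1) →
        upperEnv Ω m (Metric.ball a r) ‖ξ‖ ≤ lowerEnv Ω m (Metric.ball a r) (C * ‖ξ‖) + 1

/-- The orthotropic balance condition with parameter `γ`. -/
def OrthotropicCondition {n : ℕ} (Ω : Set (Rn n)) (M : Rn n → Rn n → ℝ) (γ : ℝ) : Prop :=
  ∃ m : Fin n → Rn n → ℝ → ℝ, (∀ i, IsWeakNFunctionHalfLine Ω (m i)) ∧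
    (∀ x ∈ Ω, ∀ ξ : Rn n, M x ξ = ∑ i, m i x |ξ i|) ∧
    ∃ c C : ℝ, 1 ≤ c ∧ 1 ≤ C ∧
      ∀ (a : Rn n) (r : ℝ), 0 < r → r ≤ 1 → ∀ (i : Fin n) (s : ℝ), |s| ≤ c * r ^ (γ - 1) →
        upperEnv Ω (m i) (Metric.ball a r) |s| ≤
          lowerEnv Ω (m i) (Metric.ball a r) (C * |s|) + 1

/-- `C_c^∞(Ω)`: smooth functions with compact support contained in `Ω`. -/
def CcInfty {n : ℕ} (Ω : Set (Rn n)) : Set (Rn n → ℝ) :=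
  {ψ | ContDiff ℝ ∞ ψ ∧ HasCompactSupport ψ ∧ tsupport ψ ⊆ Ω}

/-- `G` is the distributional gradient of `φ` in `Ω`. -/
def HasWeakGradient {n : ℕ} (Ω : Set (Rn n)) (φ : Rn n → ℝ) (G : Rn n → Rn n) : Prop :=
  LocallyIntegrableOn φ Ω ∧ LocallyIntegrableOn G Ω ∧
    ∀ ψ ∈ CcInfty Ω, ∫ x in Ω, φ x • ∇ ψ x = - ∫ x in Ω, ψ x • G x

/-- `W₀^{1,1}(Ω)`: the closure of `C_c^∞(Ω)` in the norm of `W^{1,1}(Ω)`. -/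
def W110 {n : ℕ} (Ω : Set (Rn n)) : Set (Rn n → ℝ) :=
  {φ | IntegrableOn φ Ω ∧ ∃ G : Rn n → Rn n, HasWeakGradient Ω φ G ∧ IntegrableOn G Ω ∧
    ∃ ψ : ℕ → Rn n → ℝ, (∀ k, ψ k ∈ CcInfty Ω) ∧
      Tendsto (fun k => eLpNorm (fun x => ψ k x - φ x) 1 (volume.restrict Ω) +
        eLpNorm (fun x => ∇ (ψ k) x - G x) 1 (volume.restrict Ω)) atTop (𝓝 0)}

/-- The modular `∫_Ω M(x, ξ(x)) dx`. -/
def modular {n : ℕ} (Ω : Set (Rn n)) (M : Rn n → Rn n → ℝ) (ξ : Rn n → Rn n) : ℝ≥0∞ :=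
  ∫⁻ x in Ω, ENNReal.ofReal (M x (ξ x))

/-- The Musielak–Orlicz class: measurable vector fields on `Ω` with finite modular. -/
def orliczClass {n : ℕ} (Ω : Set (Rn n)) (M : Rn n → Rn n → ℝ) : Set (Rn n → Rn n) :=
  {ξ | AEMeasurable ξ (volume.restrict Ω) ∧ modular Ω M ξ < ⊤}

/-- The Musielak–Orlicz space `L_M(Ω; ℝⁿ)`: the smallest linear space containing the
Musielak–Orlicz class. -/
def LM {n : ℕ} (Ω : Set (Rn n)) (M : Rn n → Rn n → ℝ) : Submodule ℝ (Rn n → Rn n) :=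
  Submodule.span ℝ (orliczClass Ω M)

/-- `V₀¹L_M(Ω)`: the functions in `W₀^{1,1}(Ω)` with distributional gradient in `L_M(Ω; ℝⁿ)`. -/
def V10LM {n : ℕ} (Ω : Set (Rn n)) (M : Rn n → Rn n → ℝ) : Set (Rn n → ℝ) :=
  {φ | φ ∈ W110 Ω ∧ ∃ G, HasWeakGradient Ω φ G ∧ G ∈ LM Ω M}

/-- The Hölder space `C^{0,γ}(Ω)`: functions with finite Hölder seminorm on `Ω`. -/
def HolderSpace {n : ℕ} (Ω : Set (Rn n)) (γ : ℝ≥0) : Set (Rn n → ℝ) :=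
  {φ | ∃ K : ℝ≥0, HolderOnWith K γ φ Ω}

/-- Modular convergence `ξ_i → ξ` in `L_M(Ω; ℝⁿ)` along a filter. -/
def TendstoModular {n : ℕ} {ι : Type*} (Ω : Set (Rn n)) (M : Rn n → Rn n → ℝ)
    (ξ : ι → Rn n → Rn n) (l : Filter ι) (ξ₀ : Rn n → Rn n) : Prop :=
  ∃ lam : ℝ, 0 < lam ∧
    Tendsto (fun i => modular Ω M (fun x => lam⁻¹ • (ξ i x - ξ₀ x))) l (𝓝 0)

end MusielakOrlicz

end

open MusielakOrlicz

/-!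
A function `φ` in `W₀^{1,1}(Ω)`, extended by zero, has a gradient on the whole space in the strong
sense `StrongGrad`: the pair of `φ` and its gradient is a limit in `L¹` of pairs `(ψ, ∇ψ)` with
`ψ ∈ C_c^∞`. The statement thus concerns the interplay of mollification with the modular.

*Localization.* By `IsBoundedLipschitzDomain.exists_partition`, the closure of `Ω` carries a finite
partition of unity `θᵢ` such that the part of the closure met by the support of `θᵢ` is translated
into `Ω` by small vectors from a cone, in the direction of which the boundary is a Lipschitz graph.
Mollifying with a kernel supported in this cone, hence displaced from the origin, takes `θᵢ φ` to
`C_c^∞(Ω)`. No dilation of the domain is needed.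

*The modular of a mollified gradient.* Since `M` is continuous, the balance conditions hold
pointwise. For `ξ` of size at most `δ^{γ-1} / 2` they imply that a tangent to `M x` at `ξ` lies
below `2 M y (C η) + A (1 + ‖η‖)` for all `η` and all `y` within distance `δ` of `x` (`Balanced`).
There is no restriction on `η`, because a tangent grows only linearly. In the orthotropic case the
tangent is taken in each coordinate. Integrating this affine minorant against the kernel, as in
Jensen's inequality, bounds `M` at the mollified gradient by the mollification of an integrable
function (`Balanced.le_mollify_majorant`), which converges in `L¹`; dominated convergence with
varying majorants (`eventually_lintegral_lt`) then gives modular convergence.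

*Size of the mollified gradients.* Moving the derivative to the kernel, the gradient of the
mollification is at most a constant times `δ^{-1}` times the oscillation of `φ` at distance `δ`,
that is `K δ^{γ-1}` for bounded functions (`γ = 0`) and Hölder functions (`γ > 0`). The range
`δ^{γ-1} / 2` is reached only if `K` is small relative to the scale of the modular. Therefore a
function is cut into `m` equal parts, `m` large, each of which is approximated at a scale
independent of `K`. Adding approximations would in general deteriorate the scale with the number of
summands, but `Approximable.add` adds any number of them at a fixed scale: an approximation already
chosen is smooth, so its gradient is bounded and has finite modular at every scale, and passing to
the limit in the next summand costs nothing. This gives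
`IsBoundedLipschitzDomain.exists_approximable`, with a bound for the approximations by the number of
patches times the bound for `φ`.

*Reduction to bounded functions.* For `γ > 0` a Hölder function is bounded, and its extension by
zero is again Hölder (`StrongGrad.holder_of_holderOn`), because a function with zero boundary values
in the weak sense comes arbitrarily close to zero near every boundary point. For `γ = 0` an
unbounded function is a limit of its truncations `arctan (t φ) / t`, whose gradients are dominated
by that of `φ`, so that dominated convergence applies in the modular.
-/

namespace MusielakOrlicz

variable {n : ℕ} {F : Type*} [NormedAddCommGroup F] [NormedSpace ℝ F]

/-! ### Mollification -/

/-- The mean `x ↦ ∫ k(t) f(x - t) dt` of `f` with respect to the kernel `k`. -/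
noncomputable def mollify (k : Rn n → ℝ) (f : Rn n → F) (x : Rn n) : F := ∫ t, k t • f (x - t)

/-- Smooth probability densities supported in the ball of radius `r` about the origin. They are not
required to be even: kernels whose support is displaced from the origin push supports into `Ω`. -/
structure IsMollifier (k : Rn n → ℝ) (r : ℝ) : Prop where
  contDiff : ContDiff ℝ ∞ k
  nonneg : ∀ t, 0 ≤ k t
  integral_eq_one : ∫ t, k t = 1
  support_subset : Function.support k ⊆ Metric.ball 0 r

/-- The rescaled kernel `δ⁻ⁿ ρ(t / δ)`. -/
noncomputable def dilate (ρ : Rn n → ℝ) (δ : ℝ) (t : Rn n) : ℝ := (δ ^ n)⁻¹ * ρ (δ⁻¹ • t)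

theorem gradient_eq_of_forall_inner {f : Rn n → ℝ} {L : Rn n →L[ℝ] ℝ} {g x : Rn n}
    (h : HasFDerivAt f L x) (hg : ∀ w, L w = inner ℝ g w) : ∇ f x = g := by
  apply HasGradientAt.gradient
  rw [hasGradientAt_iff_hasFDerivAt]
  have : InnerProductSpace.toDual ℝ (Rn n) g = L := by
    ext w
    simp [hg]
  rwa [this]

theorem norm_gradient (f : Rn n → ℝ) (x : Rn n) : ‖∇ f x‖ = ‖fderiv ℝ f x‖ := by
  simp [gradient]

theorem continuous_gradient {f : Rn n → ℝ} (hf : ContDiff ℝ ∞ f) : Continuous (∇ f) := by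
  have := hf.continuous_fderiv (by simp)
  unfold gradient
  fun_prop

theorem hasCompactSupport_gradient {f : Rn n → ℝ} (hf : HasCompactSupport f) :
    HasCompactSupport (∇ f) :=
  (hf.fderiv (𝕜 := ℝ)).comp_left (g := (InnerProductSpace.toDual ℝ (Rn n)).symm) (by simp)

theorem gradient_mul' {f g : Rn n → ℝ} (hf : ContDiff ℝ ∞ f) (hg : ContDiff ℝ ∞ g) (x : Rn n) :
    ∇ (fun y => f y * g y) x = f x • ∇ g x + g x • ∇ f x := by
  refine gradient_eq_of_forall_inner
    ((hf.differentiable (by simp) x).hasFDerivAt.mul (hg.differentiable (by simp) x).hasFDerivAt)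
    fun w => ?_
  simp [inner_add_left, inner_smul_left, inner_gradient_left]

theorem gradient_comp' {h : ℝ → ℝ} {f : Rn n → ℝ} (hh : ContDiff ℝ ∞ h) (hf : ContDiff ℝ ∞ f)
    (x : Rn n) : ∇ (fun y => h (f y)) x = deriv h (f x) • ∇ f x := by
  refine gradient_eq_of_forall_inner
    (((hh.differentiable (by simp)) (f x)).hasDerivAt.comp_hasFDerivAt x
      ((hf.differentiable (by simp)) x).hasFDerivAt) fun w => ?_
  simp [inner_smul_left, inner_gradient_left]

theorem gradient_add' {f g : Rn n → ℝ} (hf : ContDiff ℝ ∞ f) (hg : ContDiff ℝ ∞ g) (x : Rn n) :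
    ∇ (fun y => f y + g y) x = ∇ f x + ∇ g x := by
  refine gradient_eq_of_forall_inner
    ((hf.differentiable (by simp) x).hasFDerivAt.add (hg.differentiable (by simp) x).hasFDerivAt)
    fun w => ?_
  simp [inner_add_left, inner_gradient_left]

theorem integrable_smul_comp_sub {E' : Type*} [NormedAddCommGroup E'] [NormedSpace ℝ E']
    {k : Rn n → ℝ} (hk : Continuous k) (hkc : HasCompactSupport k) {f : Rn n → E'}
    (hf : LocallyIntegrable f) (x : Rn n) : Integrable fun t => k t • f (x - t) :=
  hkc.convolutionExists_left (ContinuousLinearMap.lsmul ℝ ℝ) hk hf x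

theorem integrable_comp_sub_smul {E' : Type*} [NormedAddCommGroup E'] [NormedSpace ℝ E']
    {k : Rn n → E'} (hk : Continuous k) (hkc : HasCompactSupport k) {f : Rn n → ℝ}
    (hf : LocallyIntegrable f) (x : Rn n) : Integrable fun t => f (x - t) • k t :=
  hkc.convolutionExists_left (ContinuousLinearMap.lsmul ℝ ℝ).flip hk hf x

theorem gradient_mollify {k : Rn n → ℝ} (hk : ContDiff ℝ ∞ k) (hkc : HasCompactSupport k)
    {u : Rn n → ℝ} (hu : LocallyIntegrable u) (x : Rn n) :
    ∇ (mollify k u) x = ∫ t, u (x - t) • ∇ k t := by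
  refine gradient_eq_of_forall_inner (hkc.hasFDerivAt_convolution_left
    (ContinuousLinearMap.lsmul ℝ ℝ) (hk.of_le (by simp)) hu x) fun w => ?_
  have h1 := integrable_comp_sub_smul (continuous_gradient hk) (hasCompactSupport_gradient hkc) hu x
  rw [real_inner_comm, ← integral_inner h1, convolution_def, ContinuousLinearMap.integral_apply]
  · refine integral_congr_ae (Eventually.of_forall fun t => ?_)
    simp [inner_smul_right, ContinuousLinearMap.precompL_apply, mul_comm, inner_gradient_right]
  · exact (hkc.fderiv (𝕜 := ℝ)).convolutionExists_left _ (hk.continuous_fderiv (by simp)) hu x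

theorem gradient_mollify_of_contDiff {k : Rn n → ℝ} (hk : Continuous k) (hkc : HasCompactSupport k)
    {ψ : Rn n → ℝ} (hψ : ContDiff ℝ ∞ ψ) (hψc : HasCompactSupport ψ) (x : Rn n) :
    ∇ (mollify k ψ) x = mollify k (∇ ψ) x := by
  refine gradient_eq_of_forall_inner (hψc.hasFDerivAt_convolution_right
    (ContinuousLinearMap.lsmul ℝ ℝ) hk.locallyIntegrable (hψ.of_le (by simp)) x) fun w => ?_
  have h1 := integrable_smul_comp_sub hk hkc (continuous_gradient hψ).locallyIntegrable x
  rw [real_inner_comm, mollify, ← integral_inner h1, convolution_def,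
    ContinuousLinearMap.integral_apply]
  · refine integral_congr_ae (Eventually.of_forall fun t => ?_)
    simp [inner_smul_right, ContinuousLinearMap.precompR_apply, inner_gradient_right]
  · exact (hψc.fderiv (𝕜 := ℝ)).convolutionExists_right _ hk.locallyIntegrable
      (hψ.continuous_fderiv (by simp)) x

theorem contDiff_mollify {k : Rn n → ℝ} (hk : ContDiff ℝ ∞ k) (hkc : HasCompactSupport k)
    {u : Rn n → ℝ} (hu : LocallyIntegrable u) : ContDiff ℝ ∞ (mollify k u) :=
  hkc.contDiff_convolution_left (ContinuousLinearMap.lsmul ℝ ℝ) hk hu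

namespace IsMollifier

variable {k : Rn n → ℝ} {r : ℝ}

theorem hasCompactSupport (h : IsMollifier k r) : HasCompactSupport k :=
  HasCompactSupport.of_support_subset_isCompact (isCompact_closedBall 0 r)
    (h.support_subset.trans Metric.ball_subset_closedBall)

theorem integrable (h : IsMollifier k r) : Integrable k :=
  h.contDiff.continuous.integrable_of_hasCompactSupport h.hasCompactSupport

theorem eq_zero_of_le_norm (h : IsMollifier k r) {t : Rn n} (ht : r ≤ ‖t‖) : k t = 0 := by
  by_contra hne
  have := h.support_subset hne
  simp at this
  linarith

theorem lintegral_ofReal_eq_one (h : IsMollifier k r) : ∫⁻ t, ENNReal.ofReal (k t) = 1 := by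
  rw [← ofReal_integral_eq_lintegral_ofReal h.integrable (Eventually.of_forall h.nonneg),
    h.integral_eq_one, ENNReal.ofReal_one]

theorem mollify_const (h : IsMollifier k r) [CompleteSpace F] (c : F) (x : Rn n) :
    mollify k (fun _ => c) x = c := by
  simp [mollify, integral_smul_const, h.integral_eq_one]

theorem integral_gradient (h : IsMollifier k r) : ∫ t, ∇ k t = 0 := by
  have h1 := gradient_mollify h.contDiff h.hasCompactSupport
    (u := fun _ => (1 : ℝ)) (continuous_const.locallyIntegrable) 0
  have h2 : mollify k (fun _ => (1 : ℝ)) = fun _ => 1 := funext fun x => h.mollify_const 1 x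
  rw [h2] at h1
  simpa [gradient] using h1.symm

theorem dilate {ρ : Rn n → ℝ} (h : IsMollifier ρ r) {δ : ℝ} (hδ : 0 < δ) :
    IsMollifier (dilate ρ δ) (δ * r) where
  contDiff := by
    have := h.contDiff
    unfold MusielakOrlicz.dilate
    exact contDiff_const.mul (this.comp (contDiff_const_smul δ⁻¹))
  nonneg t := mul_nonneg (by positivity) (h.nonneg _)
  integral_eq_one := by
    unfold MusielakOrlicz.dilate
    rw [integral_const_mul, Measure.integral_comp_inv_smul]
    have : |δ ^ n| = δ ^ n := abs_of_pos (by positivity)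
    simp [h.integral_eq_one, this]
    field_simp
  support_subset t ht := by
    have : ρ (δ⁻¹ • t) ≠ 0 := fun h0 => ht (by simp [MusielakOrlicz.dilate, h0])
    have := h.support_subset this
    simp only [mem_ball_zero_iff, norm_smul, norm_inv, Real.norm_eq_abs, abs_of_pos hδ] at this ⊢
    rwa [inv_mul_lt_iff₀ hδ] at this

end IsMollifier

theorem gradient_dilate {ρ : Rn n → ℝ} (h : ContDiff ℝ ∞ ρ) (δ : ℝ) (t : Rn n) :
    ∇ (dilate ρ δ) t = ((δ ^ n)⁻¹ * δ⁻¹) • ∇ ρ (δ⁻¹ • t) := by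
  refine gradient_eq_of_forall_inner ((((h.differentiable (by simp)) (δ⁻¹ • t)).hasFDerivAt.comp t
    ((hasFDerivAt_id t).const_smul δ⁻¹)).const_mul _) fun w => ?_
  simp [inner_smul_left, inner_gradient_left]
  ring

theorem integral_norm_gradient_dilate {ρ : Rn n → ℝ} (h : ContDiff ℝ ∞ ρ) {δ : ℝ} (hδ : 0 < δ) :
    ∫ t, ‖∇ (dilate ρ δ) t‖ = δ⁻¹ * ∫ t, ‖∇ ρ t‖ := by
  simp_rw [gradient_dilate h, norm_smul]
  rw [integral_const_mul, Measure.integral_comp_inv_smul volume (fun t => ‖∇ ρ t‖) δ]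
  have : |δ ^ n| = δ ^ n := abs_of_pos (by positivity)
  simp [this, abs_of_pos hδ]
  field_simp

/-- A mollified function of small oscillation has small gradient, because `∇ k` has mean zero. -/
theorem norm_gradient_mollify_le {k : Rn n → ℝ} {r : ℝ} (hk : IsMollifier k r) {u : Rn n → ℝ}
    (hu : LocallyIntegrable u) {x : Rn n} {s : ℝ} (hs' : ∀ t, ‖t‖ < r → |u (x - t) - u x| ≤ s) :
    ‖∇ (mollify k u) x‖ ≤ s * ∫ t, ‖∇ k t‖ := by
  have hc := continuous_gradient hk.contDiff
  have hs := hasCompactSupport_gradient hk.hasCompactSupport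
  have hi : Integrable (∇ k) := hc.integrable_of_hasCompactSupport hs
  have h1 : ∇ (mollify k u) x = ∫ t, (u (x - t) - u x) • ∇ k t := by
    simp_rw [sub_smul]
    have hi' : Integrable fun t => u x • ∇ k t := hi.smul (u x)
    rw [gradient_mollify hk.contDiff hk.hasCompactSupport hu x, integral_sub
      (integrable_comp_sub_smul hc hs hu x) hi', integral_smul, hk.integral_gradient]
    simp
  rw [h1, ← integral_const_mul]
  refine norm_integral_le_of_norm_le (hi.norm.const_mul s) (Eventually.of_forall fun t => ?_)
  rw [norm_smul]
  by_cases ht : ‖t‖ < r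
  · exact mul_le_mul_of_nonneg_right (hs' t ht) (norm_nonneg _)
  · have : ∇ k t = 0 := by
      -- `t` is a minimum of the nonnegative function `k`
      have : IsLocalMin k t := Eventually.of_forall fun s => by
        rw [hk.eq_zero_of_le_norm (not_lt.1 ht)]; exact hk.nonneg _
      simp [gradient, this.fderiv_eq_zero]
    simp [this]

/-- Translation is continuous in `L¹`. -/
theorem tendsto_eLpNorm_comp_sub {F : Type*} [NormedAddCommGroup F] {f : Rn n → F}
    (hf : Integrable f) :
    Tendsto (fun t : Rn n => eLpNorm (fun x => f (x - t) - f x) 1 volume) (𝓝 0) (𝓝 0) := by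
  have hf' : MemLp f 1 := memLp_one_iff_integrable.2 hf
  have hmp : ∀ t : Rn n, MeasurePreserving (fun x : Rn n => x - t) volume volume :=
    fun t => measurePreserving_sub_right volume t
  let g : Rn n → C(Rn n, Rn n) := fun t => ⟨fun x => x - t, by fun_prop⟩
  have hg : Continuous g := ContinuousMap.continuous_of_continuous_uncurry _
    (by simp only [g, Function.uncurry_def, ContinuousMap.coe_mk]; fun_prop)
  have h1 := (continuous_const (y := hf'.toLp f)).compMeasurePreservingLp hg hmp (by simp)
  have h2 := (h1.tendsto 0)
  rw [tendsto_iff_edist_tendsto_0] at h2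
  refine h2.congr fun t => ?_
  rw [Lp.edist_def]
  refine eLpNorm_congr_ae ?_
  have e1 := Lp.coeFn_compMeasurePreserving (hf'.toLp f) (hmp t)
  have e2 := Lp.coeFn_compMeasurePreserving (hf'.toLp f) (hmp 0)
  have e3 := (hmp t).quasiMeasurePreserving.ae_eq_comp hf'.coeFn_toLp
  have e4 := (hmp 0).quasiMeasurePreserving.ae_eq_comp hf'.coeFn_toLp
  filter_upwards [e1, e2, e3, e4] with x h1 h2 h3 h4
  simp only [g, Pi.sub_apply, Function.comp_apply, ContinuousMap.coe_mk] at *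
  rw [h1, h2, h3, h4, sub_zero]

/-- The distance of a function to its mollification in `L¹` is at most the largest distance to its
translates, by Fubini's theorem. -/
theorem eLpNorm_mollify_sub_le {k : Rn n → ℝ} {r : ℝ} (hk : IsMollifier k r) [CompleteSpace F]
    {f : Rn n → F} (hf : Integrable f) {ε : ℝ≥0∞}
    (hε : ∀ t : Rn n, ‖t‖ < r → eLpNorm (fun x => f (x - t) - f x) 1 volume ≤ ε) :
    eLpNorm (fun x => mollify k f x - f x) 1 volume ≤ ε := by
  have hm : AEStronglyMeasurable (fun p : Rn n × Rn n => f (p.1 - p.2) - f p.1)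
      (volume.prod volume) := by
    refine AEStronglyMeasurable.sub ?_ hf.1.comp_fst
    exact hf.1.comp_quasiMeasurePreserving (quasiMeasurePreserving_sub volume volume)
  calc eLpNorm (fun x => mollify k f x - f x) 1 volume
      ≤ ∫⁻ x, ∫⁻ t, ENNReal.ofReal (k t) * ‖f (x - t) - f x‖ₑ := by
        rw [eLpNorm_one_eq_lintegral_enorm]
        refine lintegral_mono fun x => ?_
        have h1 : mollify k f x - f x = ∫ t, k t • (f (x - t) - f x) := by
          simp_rw [smul_sub]
          rw [integral_sub (integrable_smul_comp_sub hk.contDiff.continuous hk.hasCompactSupport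
            hf.locallyIntegrable x) (hk.integrable.smul_const _), integral_smul_const,
            hk.integral_eq_one, one_smul, mollify]
        simp only [h1]
        refine (enorm_integral_le_lintegral_enorm _).trans_eq (lintegral_congr fun t => ?_)
        rw [enorm_smul, Real.enorm_eq_ofReal (hk.nonneg t)]
    _ = ∫⁻ t, ∫⁻ x, ENNReal.ofReal (k t) * ‖f (x - t) - f x‖ₑ := by
        rw [lintegral_lintegral_swap]
        refine AEMeasurable.mul ?_ hm.enorm
        exact (hk.contDiff.continuous.measurable.ennreal_ofReal.comp measurable_snd).aemeasurable
    _ ≤ ∫⁻ t, ENNReal.ofReal (k t) * ε := by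
        refine lintegral_mono fun t => ?_
        dsimp only
        by_cases ht : ‖t‖ < r
        · rw [lintegral_const_mul' _ _ ENNReal.ofReal_ne_top]
          gcongr
          simpa [eLpNorm_one_eq_lintegral_enorm] using hε t ht
        · simp [hk.eq_zero_of_le_norm (not_lt.1 ht)]
    _ = ε := by
        rw [lintegral_mul_const _ hk.contDiff.continuous.measurable.ennreal_ofReal,
          hk.lintegral_ofReal_eq_one, one_mul]

theorem tendsto_mollify {ρ : Rn n → ℝ} (hρ : IsMollifier ρ 1) [CompleteSpace F]
    {f : Rn n → F} (hf : Integrable f) :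
    Tendsto (fun δ : ℝ => eLpNorm (fun x => mollify (dilate ρ δ) f x - f x) 1 volume)
      (𝓝[>] 0) (𝓝 0) := by
  rw [ENNReal.tendsto_nhds_zero]
  intro ε hε
  have h := (ENNReal.tendsto_nhds_zero.1 (tendsto_eLpNorm_comp_sub hf)) ε hε
  obtain ⟨η, hη, hη'⟩ := Metric.eventually_nhds_iff.1 h
  filter_upwards [Ioo_mem_nhdsGT hη] with δ hδ
  refine eLpNorm_mollify_sub_le (hρ.dilate hδ.1) hf fun t ht => hη' ?_
  rw [mul_one] at ht
  simpa using ht.trans hδ.2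

theorem abs_mollify_le {k : Rn n → ℝ} {r : ℝ} (hk : IsMollifier k r) {u : Rn n → ℝ} {B : ℝ}
    (hu : ∀ x, |u x| ≤ B) (x : Rn n) : |mollify k u x| ≤ B := by
  have h := norm_integral_le_of_norm_le (f := fun t => k t • u (x - t)) (hk.integrable.mul_const B)
    (Eventually.of_forall fun t => by
      rw [norm_smul, Real.norm_of_nonneg (hk.nonneg t)]
      exact mul_le_mul_of_nonneg_left (hu _) (hk.nonneg t))
  rwa [integral_mul_const, hk.integral_eq_one, one_mul] at h

end MusielakOrlicz

namespace MusielakOrlicz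

variable {n : ℕ}

/-! ### Strong gradients -/

/-- `v` is the gradient of `u` on the whole space in the strong sense: `(u, v)` is the limit in `L¹`
of pairs `(ψ, ∇ψ)` with `ψ` smooth and compactly supported. -/
structure StrongGrad (u : Rn n → ℝ) (v : Rn n → Rn n) : Prop where
  integrable : Integrable u
  integrable_grad : Integrable v
  approx : ∃ ψ : ℕ → Rn n → ℝ, (∀ k, ContDiff ℝ ∞ (ψ k) ∧ HasCompactSupport (ψ k)) ∧
    Tendsto (fun k => eLpNorm (fun x => ψ k x - u x) 1 volume) atTop (𝓝 0) ∧
    Tendsto (fun k => eLpNorm (fun x => ∇ (ψ k) x - v x) 1 volume) atTop (𝓝 0)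

theorem tendsto_zero_of_le {ι : Type*} {l : Filter ι} {f g : ι → ℝ≥0∞}
    (hg : Tendsto g l (𝓝 0)) (h : ∀ i, f i ≤ g i) : Tendsto f l (𝓝 0) :=
  tendsto_of_tendsto_of_tendsto_of_le_of_le tendsto_const_nhds hg (fun _ => zero_le) h

theorem tendsto_const_mul_zero {ι : Type*} {l : Filter ι} {g : ι → ℝ≥0∞}
    (hg : Tendsto g l (𝓝 0)) {c : ℝ≥0∞} (hc : c ≠ ⊤) : Tendsto (fun i => c * g i) l (𝓝 0) := by
  simpa using ENNReal.Tendsto.const_mul hg (Or.inr hc)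

theorem tendsto_add_zero {ι : Type*} {l : Filter ι} {f g : ι → ℝ≥0∞}
    (hf : Tendsto f l (𝓝 0)) (hg : Tendsto g l (𝓝 0)) : Tendsto (fun i => f i + g i) l (𝓝 0) := by
  simpa using hf.add hg

theorem eLpNorm_comp_sub_left {F : Type*} [NormedAddCommGroup F] {f : Rn n → F}
    (hf : AEStronglyMeasurable f) (x : Rn n) :
    eLpNorm (fun t => f (x - t)) 1 volume = eLpNorm f 1 volume :=
  eLpNorm_comp_measurePreserving hf (Measure.measurePreserving_sub_left volume x)

theorem eLpNorm_smul_le_of_bound {α : Type*} [MeasurableSpace α] {μ : Measure α} {F : Type*}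
    [NormedAddCommGroup F] [NormedSpace ℝ F] {F' : Type*} [NormedAddCommGroup F']
    {w : α → F} {f : α → F'} {A : ℝ} (h : ∀ x, ‖w x‖ ≤ A * ‖f x‖) :
    eLpNorm w 1 μ ≤ ENNReal.ofReal A * eLpNorm f 1 μ :=
  eLpNorm_le_mul_eLpNorm_of_ae_le_mul (Eventually.of_forall h) 1

namespace StrongGrad

variable {u : Rn n → ℝ} {v : Rn n → Rn n}

theorem gradient_mollify (h : StrongGrad u v) {k : Rn n → ℝ} {r : ℝ} (hk : IsMollifier k r)
    (x : Rn n) : ∇ (mollify k u) x = mollify k v x := by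
  obtain ⟨ψ, hψ, h1, h2⟩ := h.approx
  have hcg := continuous_gradient hk.contDiff
  have hsg := hasCompactSupport_gradient hk.hasCompactSupport
  obtain ⟨A, hA⟩ := hsg.exists_bound_of_continuous hcg
  obtain ⟨A', hA'⟩ := hk.hasCompactSupport.exists_bound_of_continuous hk.contDiff.continuous
  have hiψ : ∀ j, Integrable (ψ j) := fun j =>
    (hψ j).1.continuous.integrable_of_hasCompactSupport (hψ j).2
  have hiψ' : ∀ j, Integrable (∇ (ψ j)) := fun j =>
    (continuous_gradient (hψ j).1).integrable_of_hasCompactSupport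
      (hasCompactSupport_gradient (hψ j).2)
  have t1 : Tendsto (fun j => ∫ t, ψ j (x - t) • ∇ k t) atTop (𝓝 (∫ t, u (x - t) • ∇ k t)) := by
    refine tendsto_integral_of_L1' _
      (integrable_comp_sub_smul hcg hsg h.integrable.locallyIntegrable x).1
      (Eventually.of_forall fun j =>
        integrable_comp_sub_smul hcg hsg (hiψ j).locallyIntegrable x) ?_
    refine tendsto_zero_of_le (tendsto_const_mul_zero h1 (c := ENNReal.ofReal A) (by simp))
      fun j => ?_
    rw [← eLpNorm_comp_sub_left (f := fun x => ψ j x - u x) ((hiψ j).sub h.integrable).1 x]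
    refine eLpNorm_smul_le_of_bound fun t => ?_
    simp only [Pi.sub_apply, ← sub_smul, norm_smul, mul_comm A]
    exact mul_le_mul_of_nonneg_left (hA t) (norm_nonneg _)
  have t2 : Tendsto (fun j => mollify k (∇ (ψ j)) x) atTop (𝓝 (mollify k v x)) := by
    refine tendsto_integral_of_L1' _
      (integrable_smul_comp_sub hk.contDiff.continuous hk.hasCompactSupport
        h.integrable_grad.locallyIntegrable x).1
      (Eventually.of_forall fun j => integrable_smul_comp_sub hk.contDiff.continuous
        hk.hasCompactSupport (hiψ' j).locallyIntegrable x) ?_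
    refine tendsto_zero_of_le (tendsto_const_mul_zero h2 (c := ENNReal.ofReal A') (by simp))
      fun j => ?_
    rw [← eLpNorm_comp_sub_left (f := fun x => ∇ (ψ j) x - v x)
      ((hiψ' j).sub h.integrable_grad).1 x]
    refine eLpNorm_smul_le_of_bound fun t => ?_
    simp only [Pi.sub_apply, ← smul_sub, norm_smul]
    exact mul_le_mul_of_nonneg_right (hA' t) (norm_nonneg _)
  rw [MusielakOrlicz.gradient_mollify hk.contDiff hk.hasCompactSupport
    h.integrable.locallyIntegrable]
  refine tendsto_nhds_unique t1 (t2.congr fun j => ?_)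
  rw [← gradient_mollify_of_contDiff hk.contDiff.continuous hk.hasCompactSupport (hψ j).1 (hψ j).2,
    MusielakOrlicz.gradient_mollify hk.contDiff hk.hasCompactSupport (hiψ j).locallyIntegrable]

theorem mul (h : StrongGrad u v) {θ : Rn n → ℝ} (hθ : ContDiff ℝ ∞ θ) {A : ℝ}
    (hA : ∀ x, |θ x| ≤ A) (hA' : ∀ x, ‖∇ θ x‖ ≤ A) :
    StrongGrad (fun x => θ x * u x) (fun x => θ x • v x + u x • ∇ θ x) := by
  obtain ⟨ψ, hψ, h1, h2⟩ := h.approx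
  have hcθ := continuous_gradient hθ
  have hA0 : 0 ≤ A := (abs_nonneg _).trans (hA 0)
  have hi1 : Integrable fun x => θ x • v x :=
    h.integrable_grad.bdd_smul A hθ.continuous.aestronglyMeasurable (Eventually.of_forall hA)
  have hi2 : Integrable fun x => u x • ∇ θ x :=
    h.integrable.smul_bdd A hcθ.aestronglyMeasurable (Eventually.of_forall hA')
  have hiψ : ∀ j, Integrable (ψ j) := fun j =>
    (hψ j).1.continuous.integrable_of_hasCompactSupport (hψ j).2
  have hiψ' : ∀ j, Integrable (∇ (ψ j)) := fun j =>
    (continuous_gradient (hψ j).1).integrable_of_hasCompactSupport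
      (hasCompactSupport_gradient (hψ j).2)
  refine ⟨h.integrable.bdd_mul (c := A) hθ.continuous.aestronglyMeasurable
    (Eventually.of_forall hA), hi1.add hi2, fun k x => θ x * ψ k x,
    fun k => ⟨hθ.mul (hψ k).1, (hψ k).2.mul_left⟩, ?_, ?_⟩
  · refine tendsto_zero_of_le (tendsto_const_mul_zero h1 (c := ENNReal.ofReal A) (by simp))
      fun j => eLpNorm_smul_le_of_bound fun x => ?_
    rw [← mul_sub, norm_mul]
    exact mul_le_mul_of_nonneg_right (hA x) (norm_nonneg _)
  · refine tendsto_zero_of_le (tendsto_add_zero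
      (tendsto_const_mul_zero h2 (c := ENNReal.ofReal A) (by simp))
      (tendsto_const_mul_zero h1 (c := ENNReal.ofReal A) (by simp))) fun j => ?_
    have e : (fun x => ∇ (fun y => θ y * ψ j y) x - (θ x • v x + u x • ∇ θ x)) =
        (fun x => θ x • (∇ (ψ j) x - v x)) + fun x => (ψ j x - u x) • ∇ θ x := by
      ext1 x
      rw [gradient_mul' hθ (hψ j).1, Pi.add_apply, smul_sub, sub_smul]
      abel
    rw [e]
    refine (eLpNorm_add_le ?_ ?_ le_rfl).trans (add_le_add
      (eLpNorm_smul_le_of_bound fun x => ?_) (eLpNorm_smul_le_of_bound fun x => ?_))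
    · exact hθ.continuous.aestronglyMeasurable.smul ((hiψ' j).sub h.integrable_grad).1
    · exact ((hiψ j).sub h.integrable).1.smul hcθ.aestronglyMeasurable
    · rw [norm_smul]
      exact mul_le_mul_of_nonneg_right (hA x) (norm_nonneg _)
    · rw [norm_smul, mul_comm]
      exact mul_le_mul_of_nonneg_right (hA' x) (norm_nonneg _)

theorem const_mul (h : StrongGrad u v) (a : ℝ) :
    StrongGrad (fun x => a * u x) (fun x => a • v x) := by
  have := h.mul (θ := fun _ => a) contDiff_const (A := |a|) (fun _ => le_rfl)
    (by simp [gradient])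
  simpa [gradient] using this

/-- Passing to a subsequence, the approximating functions converge almost everywhere. -/
theorem exists_ae_approx (h : StrongGrad u v) :
    ∃ ψ : ℕ → Rn n → ℝ, (∀ k, ContDiff ℝ ∞ (ψ k) ∧ HasCompactSupport (ψ k)) ∧
    Tendsto (fun k => eLpNorm (fun x => ψ k x - u x) 1 volume) atTop (𝓝 0) ∧
    Tendsto (fun k => eLpNorm (fun x => ∇ (ψ k) x - v x) 1 volume) atTop (𝓝 0) ∧
    ∀ᵐ x, Tendsto (fun k => ψ k x) atTop (𝓝 (u x)) := by
  obtain ⟨ψ, hψ, h1, h2⟩ := h.approx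
  obtain ⟨ns, hns, hns'⟩ := (tendstoInMeasure_of_tendsto_eLpNorm one_ne_zero
    (fun j => (hψ j).1.continuous.aestronglyMeasurable) h.integrable.1 h1).exists_seq_tendsto_ae
  exact ⟨fun k => ψ (ns k), fun k => hψ _, h1.comp hns.tendsto_atTop, h2.comp hns.tendsto_atTop,
    hns'⟩

theorem comp (hg : StrongGrad u v) {h : ℝ → ℝ} (hh : ContDiff ℝ ∞ h) (h0 : h 0 = 0) {A : ℝ}
    (hA : ∀ s, |deriv h s| ≤ A) :
    StrongGrad (fun x => h (u x)) (fun x => deriv h (u x) • v x) := by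
  obtain ⟨ψ, hψ, h1, h2, h3⟩ := hg.exists_ae_approx
  have hA0 : 0 ≤ A := (abs_nonneg _).trans (hA 0)
  have hcd : Continuous (deriv h) := hh.continuous_deriv (by simp)
  have hlip : ∀ s t, |h s - h t| ≤ A * |s - t| := fun s t =>
    Convex.norm_image_sub_le_of_norm_deriv_le (s := univ) (f := h)
      (fun x _ => (hh.differentiable (by simp)) x) (fun x _ => hA x) convex_univ trivial trivial
  have hmu : AEStronglyMeasurable (fun x => deriv h (u x)) :=
    hcd.comp_aestronglyMeasurable hg.integrable.1
  have hiu : Integrable fun x => h (u x) := by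
    refine (hg.integrable.norm.const_mul A).mono'
      (hh.continuous.comp_aestronglyMeasurable hg.integrable.1) (Eventually.of_forall fun x => ?_)
    simpa [h0] using hlip (u x) 0
  have hiψ' : ∀ j, Integrable (∇ (ψ j)) := fun j =>
    (continuous_gradient (hψ j).1).integrable_of_hasCompactSupport
      (hasCompactSupport_gradient (hψ j).2)
  have hmψ : ∀ j, Continuous fun x => deriv h (ψ j x) := fun j => hcd.comp (hψ j).1.continuous
  refine ⟨hiu, hg.integrable_grad.bdd_smul A hmu (Eventually.of_forall fun x => hA _),
    fun k x => h (ψ k x), fun k => ⟨hh.comp (hψ k).1, (hψ k).2.comp_left h0⟩, ?_, ?_⟩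
  · exact tendsto_zero_of_le (tendsto_const_mul_zero h1 (c := ENNReal.ofReal A) (by simp))
      fun j => eLpNorm_smul_le_of_bound fun x => hlip _ _
  · -- the factor `h' (ψ k)` converges to `h' u` only almost everywhere
    have hdom : Tendsto (fun k => eLpNorm (fun x => (deriv h (ψ k x) - deriv h (u x)) • v x) 1
        volume) atTop (𝓝 0) := by
      simp_rw [eLpNorm_one_eq_lintegral_enorm]
      have := tendsto_lintegral_of_dominated_convergence'
        (F := fun k x => ‖(deriv h (ψ k x) - deriv h (u x)) • v x‖ₑ) (f := fun _ => 0)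
        (μ := (volume : Measure (Rn n)))
        (fun x => ENNReal.ofReal (2 * A) * ‖v x‖ₑ) (fun k => ?_) (fun k => ?_) ?_ ?_
      · simpa using this
      · exact (((hmψ k).aestronglyMeasurable.sub hmu).smul hg.integrable_grad.1).enorm
      · refine Eventually.of_forall fun x => ?_
        dsimp only
        rw [enorm_smul]
        gcongr
        rw [Real.enorm_eq_ofReal_abs]
        refine ENNReal.ofReal_le_ofReal ?_
        have := abs_sub (deriv h (ψ k x)) (deriv h (u x))
        linarith [hA (ψ k x), hA (u x)]
      · rw [lintegral_const_mul' _ _ ENNReal.ofReal_ne_top]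
        exact ENNReal.mul_ne_top ENNReal.ofReal_ne_top hg.integrable_grad.2.ne
      · filter_upwards [h3] with x hx
        have : Tendsto (fun k => (deriv h (ψ k x) - deriv h (u x)) • v x) atTop
            (𝓝 ((deriv h (u x) - deriv h (u x)) • v x)) :=
          (((hcd.tendsto _).comp hx).sub_const _).smul_const _
        simpa using this.enorm
    refine tendsto_zero_of_le (tendsto_add_zero
      (tendsto_const_mul_zero h2 (c := ENNReal.ofReal A) (by simp)) hdom) fun j => ?_
    have e : (fun x => ∇ (fun y => h (ψ j y)) x - deriv h (u x) • v x) =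
        (fun x => deriv h (ψ j x) • (∇ (ψ j) x - v x)) +
          fun x => (deriv h (ψ j x) - deriv h (u x)) • v x := by
      ext1 x
      rw [gradient_comp' hh (hψ j).1, Pi.add_apply, smul_sub, sub_smul]
      abel
    rw [e]
    refine (eLpNorm_add_le ?_ ?_ le_rfl).trans (add_le_add
      (eLpNorm_smul_le_of_bound fun x => ?_) le_rfl)
    · exact (hmψ j).aestronglyMeasurable.smul ((hiψ' j).sub hg.integrable_grad).1
    · exact ((hmψ j).aestronglyMeasurable.sub hmu).smul hg.integrable_grad.1
    · rw [norm_smul]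
      exact mul_le_mul_of_nonneg_right (hA _) (norm_nonneg _)

end StrongGrad

variable {Ω : Set (Rn n)}

theorem gradient_eq_zero_of_notMem_tsupport {ψ : Rn n → ℝ} {x : Rn n} (hx : x ∉ tsupport ψ) :
    ∇ ψ x = 0 := by
  have : x ∉ Function.support (fderiv ℝ ψ) := fun h => hx (support_fderiv_subset ℝ h)
  simp only [Function.mem_support, not_not] at this
  simp [gradient, this]

/-- A weak gradient on an open set is unique almost everywhere. -/
theorem HasWeakGradient.ae_eq (hΩ : IsOpen Ω) {φ : Rn n → ℝ} {G G' : Rn n → Rn n}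
    (h : HasWeakGradient Ω φ G) (h' : HasWeakGradient Ω φ G') : G =ᵐ[volume.restrict Ω] G' := by
  have key := hΩ.ae_eq_zero_of_integral_contDiff_smul_eq_zero (μ := volume)
    (h.2.1.sub h'.2.1) fun ψ hψ hc hs => by
      have hz : ∀ g : Rn n → Rn n, ∫ x, ψ x • g x = ∫ x in Ω, ψ x • g x := fun g => by
        refine (setIntegral_eq_integral_of_forall_compl_eq_zero fun x hx => ?_).symm
        rw [image_eq_zero_of_notMem_tsupport fun hx' => hx (hs hx'), zero_smul]
      have hi : ∀ g : Rn n → Rn n, LocallyIntegrableOn g Ω →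
          Integrable fun x => ψ x • g x := fun g hg => by
        have h1 : IntegrableOn g (tsupport ψ) := hg.integrableOn_compact_subset hs hc
        obtain ⟨A, hA⟩ := hc.exists_bound_of_continuous hψ.continuous
        have h2 : IntegrableOn (fun x => ψ x • g x) (tsupport ψ) :=
          h1.bdd_smul A hψ.continuous.aestronglyMeasurable (Eventually.of_forall hA)
        refine (integrableOn_iff_integrable_of_support_subset fun x hx => ?_).1 h2
        by_contra hx'
        exact hx (by simp [image_eq_zero_of_notMem_tsupport hx'])
      have e : (fun x => ψ x • (G - G') x) = fun x => ψ x • G x - ψ x • G' x := by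
        ext1 x; simp [smul_sub]
      rw [e, integral_sub (hi _ h.2.1) (hi _ h'.2.1), hz, hz, sub_eq_zero, ← neg_inj,
        ← h.2.2 ψ ⟨hψ, hc, hs⟩, ← h'.2.2 ψ ⟨hψ, hc, hs⟩]
  rw [EventuallyEq, ae_restrict_iff' hΩ.measurableSet]
  filter_upwards [key] with x hx hxΩ using sub_eq_zero.1 (hx hxΩ)

/-- The extension by zero of a function in `W₀^{1,1}(Ω)` has a strong gradient on the whole space,
the extension by zero of its weak gradient. -/
theorem strongGrad_indicator (hΩ : IsOpen Ω) {φ : Rn n → ℝ} (hφ : φ ∈ W110 Ω) {G : Rn n → Rn n}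
    (hG : HasWeakGradient Ω φ G) : StrongGrad (Ω.indicator φ) (Ω.indicator G) := by
  obtain ⟨hi, G', hG', hi', ψ, hψ, hlim⟩ := hφ
  have hae := hG.ae_eq hΩ hG'
  have hiG : IntegrableOn G Ω := Integrable.congr hi' hae.symm
  refine ⟨(integrable_indicator_iff hΩ.measurableSet).2 hi,
    (integrable_indicator_iff hΩ.measurableSet).2 hiG, ψ, fun k => ⟨(hψ k).1, (hψ k).2.1⟩, ?_, ?_⟩
  · refine tendsto_zero_of_le hlim fun k => le_add_right (le_of_eq ?_)
    rw [← eLpNorm_indicator_eq_eLpNorm_restrict hΩ.measurableSet]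
    congr 1
    ext1 x
    by_cases hx : x ∈ Ω
    · simp [hx]
    · simp [hx, image_eq_zero_of_notMem_tsupport fun h => hx ((hψ k).2.2 h)]
  · refine tendsto_zero_of_le hlim fun k => le_add_left (le_of_eq ?_)
    have : eLpNorm (fun x => ∇ (ψ k) x - G' x) 1 (volume.restrict Ω) =
        eLpNorm (fun x => ∇ (ψ k) x - G x) 1 (volume.restrict Ω) :=
      eLpNorm_congr_ae (by filter_upwards [hae] with x hx; rw [hx])
    rw [this, ← eLpNorm_indicator_eq_eLpNorm_restrict hΩ.measurableSet]
    congr 1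
    ext1 x
    by_cases hx : x ∈ Ω
    · simp [hx]
    · simp [hx, gradient_eq_zero_of_notMem_tsupport fun h => hx ((hψ k).2.2 h)]

end MusielakOrlicz

namespace MusielakOrlicz

variable {n : ℕ}

/-! ### Continuous integrands and the pointwise form of the balance conditions -/

/-- The properties of a continuous weak N-function, valid at every point of `Ω`. -/
structure RegularIntegrand (Ω : Set (Rn n)) (M : Rn n → Rn n → ℝ) : Prop where
  continuousOn : ContinuousOn (Function.uncurry M) (Ω ×ˢ (univ : Set (Rn n)))
  nonneg : ∀ x ∈ Ω, ∀ ξ, 0 ≤ M x ξ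
  map_zero : ∀ x ∈ Ω, M x 0 = 0
  convex : ∀ x ∈ Ω, ConvexOn ℝ univ (M x)
  even : ∀ x ∈ Ω, ∀ ξ, M x (-ξ) = M x ξ
  bounded : ∀ R : ℝ, ∃ A : ℝ, ∀ x ∈ Ω, ∀ ξ, ‖ξ‖ ≤ R → M x ξ ≤ A

theorem frequently_of_ae_restrict {Ω : Set (Rn n)} (hΩ : IsOpen Ω) {P : Rn n → Prop}
    (h : ∀ᵐ x ∂(volume.restrict Ω), P x) {x : Rn n} (hx : x ∈ Ω) :
    ∃ᶠ y in 𝓝 x, y ∈ Ω ∧ P y := by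
  intro hcon
  rw [ae_restrict_iff' hΩ.measurableSet, ae_iff] at h
  refine (Measure.measure_pos_of_mem_nhds volume (x := x) ?_).ne' h
  filter_upwards [hcon, hΩ.mem_nhds hx] with y hy hyΩ hP
  exact hy ⟨hyΩ, hP hyΩ⟩

theorem le_of_ae_restrict_le {Ω : Set (Rn n)} (hΩ : IsOpen Ω) {β : Type*} [LinearOrder β]
    [TopologicalSpace β] [OrderClosedTopology β] {f g : Rn n → β}
    (hf : ContinuousOn f Ω) (hg : ContinuousOn g Ω) (h : ∀ᵐ x ∂(volume.restrict Ω), f x ≤ g x)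
    {x : Rn n} (hx : x ∈ Ω) : f x ≤ g x := by
  by_contra! hlt
  have := (hg.continuousAt (hΩ.mem_nhds hx)).eventually_lt (hf.continuousAt (hΩ.mem_nhds hx)) hlt
  obtain ⟨y, ⟨-, hy⟩, hy'⟩ := ((frequently_of_ae_restrict hΩ h hx).and_eventually this).exists
  exact absurd hy hy'.not_ge

theorem RegularIntegrand.continuousOn_left {Ω : Set (Rn n)} {M : Rn n → Rn n → ℝ}
    (hc : ContinuousOn (Function.uncurry M) (Ω ×ˢ (univ : Set (Rn n)))) (ξ : Rn n) :
    ContinuousOn (fun x => M x ξ) Ω :=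
  hc.comp (f := fun x => (x, ξ)) (by fun_prop) fun x hx => ⟨hx, trivial⟩

theorem RegularIntegrand.continuous_right {Ω : Set (Rn n)} {M : Rn n → Rn n → ℝ}
    (h : RegularIntegrand Ω M) {x : Rn n} (hx : x ∈ Ω) : Continuous (M x) := by
  rw [← continuousOn_univ]
  exact h.continuousOn.comp (f := fun ξ => (x, ξ)) (by fun_prop) fun ξ _ => ⟨hx, trivial⟩

theorem IsWeakNFunction.regularIntegrand {Ω : Set (Rn n)} (hΩ : IsOpen Ω) {M : Rn n → Rn n → ℝ}
    (h : IsWeakNFunction Ω M)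
    (hc : ContinuousOn (Function.uncurry M) (Ω ×ˢ (univ : Set (Rn n)))) :
    RegularIntegrand Ω M where
  continuousOn := hc
  nonneg := h.nonneg
  map_zero x hx := by
    refine le_antisymm (le_of_ae_restrict_le hΩ (RegularIntegrand.continuousOn_left hc 0)
      continuousOn_const ?_ hx) (h.nonneg x hx 0)
    filter_upwards [h.map_zero] with y hy using hy.le
  convex x hx := by
    refine ⟨convex_univ, fun ξ _ η _ a b ha hb hab => ?_⟩
    refine le_of_ae_restrict_le hΩ (RegularIntegrand.continuousOn_left hc _)
      (g := fun x => a • M x ξ + b • M x η)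
      (((RegularIntegrand.continuousOn_left hc ξ).const_smul a).add
        ((RegularIntegrand.continuousOn_left hc η).const_smul b)) ?_ hx
    filter_upwards [h.convex] with y hy using hy.2 trivial trivial ha hb hab
  even x hx ξ := by
    refine le_antisymm (le_of_ae_restrict_le hΩ (RegularIntegrand.continuousOn_left hc _)
      (RegularIntegrand.continuousOn_left hc _) ?_ hx) (le_of_ae_restrict_le hΩ
      (RegularIntegrand.continuousOn_left hc _) (RegularIntegrand.continuousOn_left hc _) ?_ hx)
    · filter_upwards [h.even] with y hy using (hy ξ).ge
    · filter_upwards [h.even] with y hy using (hy ξ).le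
  bounded R := by
    obtain ⟨m₁, m₂, -, hm₂, -, -, -, hle⟩ := h.bounds
    refine ⟨max (m₂ 0) (m₂ (max R 0)), fun x hx ξ hξ => ?_⟩
    refine le_of_ae_restrict_le hΩ (RegularIntegrand.continuousOn_left hc _) continuousOn_const ?_
      hx
    filter_upwards [hle] with y hy
    exact (hy ξ).2.trans (hm₂.le_max_of_mem_Icc (x := 0) (y := max R 0) (z := ‖ξ‖)
      self_mem_Ici (le_max_right R 0) ⟨norm_nonneg _, hξ.trans (le_max_left _ _)⟩)

/-- The form in which the balance conditions are used: at each `x ∈ Ω` and each `ξ` of moderate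
size at scale `r`, some affine minorant of `M x` touching it at `ξ` is controlled by the integrands
`M y` at all points `y` within distance `r` of `x`. -/
def Balanced (Ω : Set (Rn n)) (M : Rn n → Rn n → ℝ) (γ C A : ℝ) : Prop :=
  1 ≤ C ∧ 0 ≤ A ∧ ∀ x ∈ Ω, ∀ r : ℝ, 0 < r → r ≤ 1 → ∀ ξ : Rn n,
    ‖ξ‖ ≤ r ^ (γ - 1) / 2 → ∃ q : Rn n, ∀ y ∈ Ω, dist y x < r → ∀ η : Rn n,
      M x ξ + inner ℝ q (η - ξ) ≤ 2 * M y (C • η) + A * (1 + ‖η‖)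

theorem exists_slope_of_convexOn {f : ℝ → ℝ} (hf : ConvexOn ℝ univ f) (h0 : f 0 = 0)
    (hn : ∀ t, 0 ≤ f t) {τ : ℝ} (hτ : 0 ≤ τ) :
    ∃ s, 0 ≤ s ∧ ∀ t, f τ + s * (t - τ) ≤ f t := by
  rcases hτ.eq_or_lt with rfl | hτ
  · exact ⟨0, le_rfl, fun t => by simpa [h0] using hn t⟩
  -- the right derivative is a slope of a supporting line
  have key : ∀ t, f τ + derivWithin f (Ioi τ) τ * (t - τ) ≤ f t := fun t => by
    rcases lt_trichotomy τ t with h | rfl | h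
    · have := hf.rightDeriv_le_slope_of_mem_interior (x := τ) (y := t) (by simp) trivial h
      rw [slope_def_field, le_div_iff₀ (by linarith)] at this
      linarith
    · simp
    · have h1 := hf.slope_le_leftDeriv_of_mem_interior (x := t) (y := τ) trivial (by simp) h
      have h2 := hf.leftDeriv_le_rightDeriv_of_mem_interior (x := τ) (by simp)
      have h3 := h1.trans h2
      rw [slope_def_field, div_le_iff₀ (by linarith)] at h3
      linarith
  refine ⟨_, ?_, key⟩
  have := key 0
  rw [h0] at this
  by_contra! hs
  nlinarith [hn τ]

/-- A tangent to `f` at a point of `[0, T/2]` stays below a multiple of `g (C t)`, up to terms of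
linear growth, if `f t ≤ g (C t) + 1` up to `T`. Beyond `T`, the slope of the tangent is at most
twice `f T / T`, and `g` grows at least linearly. -/
theorem tangent_le {f g : ℝ → ℝ} (hg : ConvexOn ℝ univ g) (hfn : ∀ t, 0 ≤ f t) (g0 : g 0 = 0)
    (hgn : ∀ t, 0 ≤ g t) {T C τ s : ℝ} (hT : 1 ≤ T)
    (hfg : ∀ t, 0 ≤ t → t ≤ T → f t ≤ g (C * t) + 1) (hτ' : τ ≤ T / 2)
    (hs : 0 ≤ s) (hst : ∀ t, f τ + s * (t - τ) ≤ f t) {t : ℝ} (ht : 0 ≤ t) :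
    f τ + s * (t - τ) ≤ 2 * g (C * t) + (1 + 2 * t) := by
  rcases le_total t T with h | h
  · linarith [hst t, hfg t ht h, hgn (C * t)]
  · have hT0 : 0 < T := by linarith
    -- `t = l T` with `l ≥ 1`; both the tangent and `g` are compared with their values at `T`
    set l := t / T with hl
    have hl1 : 1 ≤ l := by rw [hl, one_le_div hT0]; exact h
    have htl : t = l * T := by rw [hl]; field_simp
    have h1 : f τ + s * (t - τ) ≤ 2 * l * f T := by
      have h2 := hst T
      have h3 : t - τ ≤ 2 * l * (T - τ) := by nlinarith
      have h4 : s * (t - τ) ≤ s * (2 * l * (T - τ)) := mul_le_mul_of_nonneg_left h3 hs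
      nlinarith [hfn τ]
    have h5 : l * g (C * T) ≤ g (C * t) := by
      have := hg.2 (mem_univ (C * t)) (mem_univ (0 : ℝ)) (by positivity : 0 ≤ l⁻¹)
        (by linarith [inv_le_one_of_one_le₀ hl1] : 0 ≤ 1 - l⁻¹) (by ring)
      have e : l⁻¹ • (C * t) + (1 - l⁻¹) • (0 : ℝ) = C * T := by
        rw [htl]; simp; field_simp
      rw [e, g0] at this
      simp only [smul_eq_mul, mul_zero, add_zero] at this
      calc l * g (C * T) ≤ l * (l⁻¹ * g (C * t)) := mul_le_mul_of_nonneg_left this (by positivity)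
        _ = g (C * t) := by field_simp
    have h6 := hfg T hT0.le le_rfl
    have h7 : 2 * l * f T ≤ 2 * l * (g (C * T) + 1) := mul_le_mul_of_nonneg_left h6 (by positivity)
    have h8 : l ≤ t := by rw [htl]; nlinarith
    linarith

theorem RegularIntegrand.convexOn_line {Ω : Set (Rn n)} {M : Rn n → Rn n → ℝ}
    (h : RegularIntegrand Ω M) {x : Rn n} (hx : x ∈ Ω) (e : Rn n) :
    ConvexOn ℝ univ fun t : ℝ => M x (t • e) :=
  (h.convex x hx).comp_linearMap (LinearMap.toSpanSingleton ℝ (Rn n) e)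

/-- For integrands continuous in the space variable, the comparison of essential suprema and infima
holds at every pair of points. -/
theorem le_add_one_of_env_le {Ω B : Set (Rn n)} (hΩ : IsOpen Ω) (hB : IsOpen B)
    {m : Rn n → ℝ → ℝ} {t t' : ℝ} (ht : ContinuousOn (fun x => m x t) Ω)
    (ht' : ContinuousOn (fun x => m x t') Ω)
    (h : upperEnv Ω m B t ≤ lowerEnv Ω m B t' + 1) {x y : Rn n} (hx : x ∈ Ω) (hxB : x ∈ B)
    (hy : y ∈ Ω) (hyB : y ∈ B) (hn : 0 ≤ m y t') : m x t ≤ m y t' + 1 := by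
  have h1 : ENNReal.ofReal (m x t) ≤ upperEnv Ω m B t :=
    le_of_ae_restrict_le (hB.inter hΩ) (f := fun x => ENNReal.ofReal (m x t))
      (g := fun _ => upperEnv Ω m B t)
      (ENNReal.continuous_ofReal.comp_continuousOn (ht.mono inter_subset_right))
      continuousOn_const (ENNReal.ae_le_essSup _) ⟨hxB, hx⟩
  have h2 : lowerEnv Ω m B t' ≤ ENNReal.ofReal (m y t') :=
    le_of_ae_restrict_le (hB.inter hΩ) (g := fun x => ENNReal.ofReal (m x t'))
      (f := fun _ => lowerEnv Ω m B t') continuousOn_const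
      (ENNReal.continuous_ofReal.comp_continuousOn (ht'.mono inter_subset_right))
      ae_essInf_le ⟨hyB, hy⟩
  have h3 : ENNReal.ofReal (m x t) ≤ ENNReal.ofReal (m y t' + 1) := by
    rw [ENNReal.ofReal_add hn zero_le_one, ENNReal.ofReal_one]
    exact h1.trans (h.trans (by gcongr))
  exact (ENNReal.ofReal_le_ofReal_iff (by linarith)).1 h3

theorem IsotropicCondition.balanced {Ω : Set (Rn n)} (hn : 1 ≤ n) (hΩ : IsOpen Ω)
    {M : Rn n → Rn n → ℝ} (hM : RegularIntegrand Ω M) {γ : ℝ} (hγ : γ ≤ 1)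
    (h : IsotropicCondition Ω M γ) : ∃ C A, Balanced Ω M γ C A := by
  obtain ⟨m, -, hMm, c, C, hc, hC, hbal⟩ := h
  obtain ⟨e, he⟩ : ∃ e : Rn n, ‖e‖ = 1 := ⟨EuclideanSpace.single ⟨0, hn⟩ 1, by simp⟩
  have hnorm : ∀ t : ℝ, 0 ≤ t → ‖t • e‖ = t := fun t ht => by
    rw [norm_smul, he, mul_one, Real.norm_of_nonneg ht]
  have hline : ∀ x ∈ Ω, ∀ t : ℝ, 0 ≤ t → M x (t • e) = m x t := fun x hx t ht => by
    rw [hMm x hx, hnorm t ht]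
  have hMe : ∀ x ∈ Ω, ∀ ξ, M x ξ = M x (‖ξ‖ • e) := fun x hx ξ => by
    rw [hMm x hx, hMm x hx, hnorm _ (norm_nonneg _)]
  refine ⟨C, 2, hC, by norm_num, fun x hx r hr hr1 ξ hξ => ?_⟩
  have hT : 1 ≤ r ^ (γ - 1) :=
    Real.one_le_rpow_of_pos_of_le_one_of_nonpos hr hr1 (by linarith)
  obtain ⟨s, hs, hst⟩ := exists_slope_of_convexOn (hM.convexOn_line hx e)
    (by simp [hM.map_zero x hx]) (fun t => hM.nonneg x hx _) (norm_nonneg ξ)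
  -- the slope `s` in the direction of `ξ`; for `ξ = 0` this is the zero vector
  refine ⟨s • (‖ξ‖⁻¹ • ξ), fun y hy hyx η => ?_⟩
  have hinner : inner ℝ (s • (‖ξ‖⁻¹ • ξ)) (η - ξ) ≤ s * (‖η‖ - ‖ξ‖) := by
    rw [real_inner_smul_left]
    refine mul_le_mul_of_nonneg_left ?_ hs
    rw [real_inner_smul_left, inner_sub_right, real_inner_self_eq_norm_sq]
    rcases (norm_nonneg ξ).eq_or_lt with h0 | h0
    · simp [← h0]
    · rw [inv_mul_le_iff₀ h0]
      nlinarith [real_inner_le_norm ξ η]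
  have hcont : ∀ t : ℝ, 0 ≤ t → ContinuousOn (fun x => m x t) Ω := fun t ht =>
    (RegularIntegrand.continuousOn_left hM.continuousOn (t • e)).congr
      fun z hz => (hline z hz t ht).symm
  have hfg : ∀ t, 0 ≤ t → t ≤ r ^ (γ - 1) → M x (t • e) ≤ M y ((C * t) • e) + 1 := by
    intro t ht htr
    have hCt : 0 ≤ C * t := by positivity
    have hb := hbal x r hr hr1 (t • e) (by rw [hnorm t ht]; nlinarith)
    rw [hnorm t ht] at hb
    rw [hline x hx t ht, hline y hy _ hCt]
    exact le_add_one_of_env_le hΩ Metric.isOpen_ball (hcont t ht) (hcont _ hCt) hb hx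
      (Metric.mem_ball_self hr) hy hyx (by rw [← hline y hy _ hCt]; exact hM.nonneg y hy _)
  have hfin := tangent_le (hM.convexOn_line hy e) (fun t => hM.nonneg x hx (t • e))
    (by simp [hM.map_zero y hy]) (fun t => hM.nonneg y hy _) hT hfg hξ hs hst (norm_nonneg η)
  rw [hMe x hx ξ, hMe y hy (C • η), norm_smul, Real.norm_of_nonneg (by linarith)]
  linarith

theorem OrthotropicCondition.balanced {Ω : Set (Rn n)} (hΩ : IsOpen Ω)
    {M : Rn n → Rn n → ℝ} (hM : RegularIntegrand Ω M) {γ : ℝ} (hγ : γ ≤ 1)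
    (h : OrthotropicCondition Ω M γ) : ∃ C A, Balanced Ω M γ C A := by
  obtain ⟨m, hm, hMm, c, C, hc, hC, hbal⟩ := h
  have hnn : ∀ i, ∀ x ∈ Ω, ∀ t, 0 ≤ t → 0 ≤ m i x t := fun i x hx t ht => by
    simpa [abs_of_nonneg ht] using (hm i).nonneg x hx t
  -- each summand vanishes at the origin because their sum does
  have hzero : ∀ i, ∀ x ∈ Ω, m i x 0 = 0 := fun i x hx => by
    have h0 := hM.map_zero x hx
    rw [hMm x hx, Finset.sum_eq_zero_iff_of_nonneg fun j _ => hnn j x hx _ (abs_nonneg _)] at h0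
    simpa using h0 i (Finset.mem_univ i)
  have hline : ∀ i, ∀ x ∈ Ω, ∀ t : ℝ, M x (t • EuclideanSpace.single i (1 : ℝ)) = m i x |t| :=
    fun i x hx t => by
      rw [hMm x hx, Finset.sum_eq_single i]
      · simp
      · intro j _ hj
        simp [hj, hzero j x hx]
      · simp
  have hMe : ∀ x ∈ Ω, ∀ ξ : Rn n,
      M x ξ = ∑ i, M x (|ξ i| • EuclideanSpace.single i (1 : ℝ)) := fun x hx ξ => by
    simp_rw [hline _ x hx, abs_abs]
    exact hMm x hx ξ
  refine ⟨C, 2 * n, hC, by positivity, fun x hx r hr hr1 ξ hξ => ?_⟩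
  have hT : 1 ≤ r ^ (γ - 1) :=
    Real.one_le_rpow_of_pos_of_le_one_of_nonpos hr hr1 (by linarith)
  choose s hs hst using fun i => exists_slope_of_convexOn
    (hM.convexOn_line hx (EuclideanSpace.single i (1 : ℝ)))
    (by simp [hM.map_zero x hx]) (fun t => hM.nonneg x hx _) (abs_nonneg (ξ i))
  refine ⟨WithLp.toLp 2 fun i => s i * Real.sign (ξ i), fun y hy hyx η => ?_⟩
  have hcoord : ∀ (ζ : Rn n) i, |ζ i| ≤ ‖ζ‖ := fun ζ i => PiLp.norm_apply_le ζ i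
  have hinner : inner ℝ (WithLp.toLp 2 fun i => s i * Real.sign (ξ i) : Rn n) (η - ξ) ≤
      ∑ i, s i * (|η i| - |ξ i|) := by
    rw [PiLp.inner_apply]
    refine Finset.sum_le_sum fun i _ => ?_
    have e : inner ℝ (s i * Real.sign (ξ i)) (η i - ξ i) =
        s i * (Real.sign (ξ i) * (η i - ξ i)) := by
      simp; ring
    simp only [PiLp.sub_apply]
    rw [e]
    refine mul_le_mul_of_nonneg_left ?_ (hs i)
    rcases lt_trichotomy (ξ i) 0 with h | h | h
    · rw [Real.sign_of_neg h, abs_of_neg h]; linarith [neg_abs_le (η i)]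
    · simp [h]
    · rw [Real.sign_of_pos h, abs_of_pos h]; linarith [le_abs_self (η i)]
  have hcont : ∀ i, ∀ t : ℝ, ContinuousOn (fun x => m i x |t|) Ω := fun i t =>
    (RegularIntegrand.continuousOn_left hM.continuousOn _).congr
      fun z hz => (hline i z hz t).symm
  have hfin : ∀ i, M x (|ξ i| • EuclideanSpace.single i (1 : ℝ)) + s i * (|η i| - |ξ i|) ≤
      2 * M y ((C * |η i|) • EuclideanSpace.single i (1 : ℝ)) + (1 + 2 * |η i|) := by
    intro i
    refine tangent_le (f := fun t => M x (t • EuclideanSpace.single i (1 : ℝ)))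
      (g := fun t => M y (t • EuclideanSpace.single i (1 : ℝ))) (hM.convexOn_line hy _)
      (fun t => hM.nonneg x hx _) (by simp [hM.map_zero y hy]) (fun t => hM.nonneg y hy _) hT
      (fun t ht htr => ?_) ((hcoord ξ i).trans hξ) (hs i) (hst i) (abs_nonneg _)
    have hCt : 0 ≤ C * t := by positivity
    have hb := hbal x r hr hr1 i t (by rw [abs_of_nonneg ht]; nlinarith)
    have hct : C * |t| = |C * t| := by rw [abs_of_nonneg ht, abs_of_nonneg hCt]
    rw [hct] at hb
    rw [hline i x hx, hline i y hy]
    exact le_add_one_of_env_le hΩ Metric.isOpen_ball (hcont i t) (hcont i _) hb hx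
      (Metric.mem_ball_self hr) hy hyx (hnn i y hy _ (abs_nonneg _))
  have hsum := Finset.sum_le_sum fun i (_ : i ∈ Finset.univ) => hfin i
  have h1 : ∑ i, (1 + 2 * |η i|) ≤ ∑ _i : Fin n, (1 + 2 * ‖η‖) :=
    Finset.sum_le_sum fun i _ => by linarith [hcoord η i]
  simp only [Finset.sum_const, Finset.card_univ, Fintype.card_fin, nsmul_eq_mul] at h1
  rw [Finset.sum_add_distrib, Finset.sum_add_distrib, ← Finset.mul_sum] at hsum
  have h2 : M y (C • η) = ∑ i, M y ((C * |η i|) • EuclideanSpace.single i (1 : ℝ)) := by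
    rw [hMe y hy]
    refine Finset.sum_congr rfl fun i _ => ?_
    rw [PiLp.smul_apply, smul_eq_mul, abs_mul, abs_of_nonneg (by linarith : 0 ≤ C)]
  rw [hMe x hx ξ, h2]
  have h3 : (0 : ℝ) ≤ n := n.cast_nonneg
  nlinarith [norm_nonneg η]

end MusielakOrlicz

namespace MusielakOrlicz

variable {n : ℕ} {Ω : Set (Rn n)} {M : Rn n → Rn n → ℝ}

/-! ### Modulars and modular approximation -/

namespace RegularIntegrand

theorem smul_le (h : RegularIntegrand Ω M) {x : Rn n} (hx : x ∈ Ω) {t : ℝ} (ht : |t| ≤ 1)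
    (ξ : Rn n) : M x (t • ξ) ≤ M x ξ := by
  have key : ∀ t : ℝ, 0 ≤ t → t ≤ 1 → M x (t • ξ) ≤ M x ξ := fun t h0 h1 => by
    have := (h.convex x hx).2 (mem_univ ξ) (mem_univ 0) h0 (sub_nonneg.2 h1) (by ring)
    rw [smul_zero, add_zero, h.map_zero x hx, smul_zero, add_zero, smul_eq_mul] at this
    nlinarith [h.nonneg x hx ξ]
  rcases le_total 0 t with h0 | h0
  · exact key t h0 (by rwa [abs_of_nonneg h0] at ht)
  · have := key (-t) (by linarith) (by rwa [abs_of_nonpos h0] at ht)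
    rwa [neg_smul, h.even x hx] at this

theorem half_add_le (h : RegularIntegrand Ω M) {x : Rn n} (hx : x ∈ Ω) (a b : Rn n) :
    M x ((2⁻¹ : ℝ) • (a + b)) ≤ M x a + M x b := by
  have := (h.convex x hx).2 (mem_univ a) (mem_univ b) (by norm_num : (0 : ℝ) ≤ 2⁻¹)
    (by norm_num : (0 : ℝ) ≤ 2⁻¹) (by norm_num)
  rw [← smul_add, smul_eq_mul, smul_eq_mul] at this
  linarith [h.nonneg x hx a, h.nonneg x hx b]

theorem third_add_le (h : RegularIntegrand Ω M) {x : Rn n} (hx : x ∈ Ω) (a b c : Rn n) :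
    M x ((3⁻¹ : ℝ) • (a + b + c)) ≤ M x a + M x b + M x c := by
  have := (h.convex x hx).2 (mem_univ a) (mem_univ ((2⁻¹ : ℝ) • (b + c)))
    (by norm_num : (0 : ℝ) ≤ 3⁻¹) (by norm_num : (0 : ℝ) ≤ 2 / 3) (by norm_num)
  have e : (3⁻¹ : ℝ) • a + (2 / 3 : ℝ) • ((2⁻¹ : ℝ) • (b + c)) = (3⁻¹ : ℝ) • (a + b + c) := by
    module
  rw [e, smul_eq_mul, smul_eq_mul] at this
  linarith [h.half_add_le hx b c, h.nonneg x hx a, h.nonneg x hx b, h.nonneg x hx c]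

theorem aemeasurable_comp (h : RegularIntegrand Ω M) (hΩ : IsOpen Ω) {v : Rn n → Rn n}
    (hv : AEMeasurable v (volume.restrict Ω)) :
    AEMeasurable (fun x => ENNReal.ofReal (M x (v x))) (volume.restrict Ω) := by
  classical
  obtain ⟨w, hw, hvw⟩ := hv
  have hm : Measurable ((Ω ×ˢ (univ : Set (Rn n))).piecewise (Function.uncurry M) fun _ => 0) :=
    h.continuousOn.measurable_piecewise continuousOn_const
      (hΩ.measurableSet.prod MeasurableSet.univ)
  refine ⟨fun x => ENNReal.ofReal ((Ω ×ˢ (univ : Set (Rn n))).piecewise (Function.uncurry M)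
    (fun _ => 0) (x, w x)), (hm.comp (measurable_id.prodMk hw)).ennreal_ofReal, ?_⟩
  filter_upwards [hvw, ae_restrict_mem hΩ.measurableSet] with x hx hxΩ
  simp [piecewise, hxΩ, hx]

theorem modular_mono (h : RegularIntegrand Ω M) (hΩ : IsOpen Ω) {v w : Rn n → Rn n} {f : Rn n → ℝ}
    (hf : ∀ x, |f x| ≤ 1) (hvw : ∀ x, v x = f x • w x) : modular Ω M v ≤ modular Ω M w := by
  refine setLIntegral_mono' hΩ.measurableSet fun x hx => ENNReal.ofReal_le_ofReal ?_
  rw [hvw]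
  exact h.smul_le hx (hf x) _

theorem modular_half_add_le (h : RegularIntegrand Ω M) (hΩ : IsOpen Ω) {v w : Rn n → Rn n}
    (hv : AEMeasurable v (volume.restrict Ω)) :
    modular Ω M (fun x => (2⁻¹ : ℝ) • (v x + w x)) ≤ modular Ω M v + modular Ω M w := by
  unfold modular
  rw [← lintegral_add_left' (h.aemeasurable_comp hΩ hv)]
  refine setLIntegral_mono' hΩ.measurableSet fun x hx => ?_
  rw [← ENNReal.ofReal_add (h.nonneg x hx _) (h.nonneg x hx _)]
  exact ENNReal.ofReal_le_ofReal (h.half_add_le hx _ _)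

theorem modular_lt_top_of_bound (h : RegularIntegrand Ω M) (hΩ : IsOpen Ω)
    (hfin : volume Ω ≠ ⊤) {v : Rn n → Rn n} {A : ℝ} (hv : ∀ x, ‖v x‖ ≤ A) :
    modular Ω M v < ⊤ := by
  obtain ⟨A', hA'⟩ := h.bounded A
  calc modular Ω M v ≤ ∫⁻ _ in Ω, ENNReal.ofReal A' :=
        setLIntegral_mono' hΩ.measurableSet fun x hx =>
          ENNReal.ofReal_le_ofReal (hA' x hx _ (hv x))
    _ < ⊤ := by
        rw [setLIntegral_const]
        exact ENNReal.mul_lt_top ENNReal.ofReal_lt_top hfin.lt_top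

theorem tendsto_ofReal (h : RegularIntegrand Ω M) {x : Rn n} (hx : x ∈ Ω) {ι : Type*}
    {l : Filter ι} {ξ : ι → Rn n} {ξ₀ : Rn n} (hξ : Tendsto ξ l (𝓝 ξ₀)) :
    Tendsto (fun i => ENNReal.ofReal (M x (ξ i))) l (𝓝 (ENNReal.ofReal (M x ξ₀))) :=
  ENNReal.tendsto_ofReal (((h.continuous_right hx).tendsto ξ₀).comp hξ)

end RegularIntegrand

/-- A dominated convergence theorem in which the dominating functions `h + e k` vary, the
perturbations `e k` tending to zero in mean. -/
theorem eventually_lintegral_lt {α : Type*} [MeasurableSpace α] {μ : Measure α}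
    {f e : ℕ → α → ℝ≥0∞} {g h : α → ℝ≥0∞} (hf : ∀ k, AEMeasurable (f k) μ)
    (hh : AEMeasurable h μ) (hfin : ∫⁻ x, h x ∂μ ≠ ⊤)
    (hle : ∀ k, ∀ᵐ x ∂μ, f k x ≤ h x + e k x)
    (he : Tendsto (fun k => ∫⁻ x, e k x ∂μ) atTop (𝓝 0))
    (hlim : ∀ᵐ x ∂μ, Tendsto (fun k => f k x) atTop (𝓝 (g x))) {ε : ℝ≥0∞}
    (hε : ∫⁻ x, g x ∂μ < ε) : ∀ᶠ k in atTop, ∫⁻ x, f k x ∂μ < ε := by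
  have h1 : Tendsto (fun k => ∫⁻ x, min (f k x) (h x) ∂μ) atTop
      (𝓝 (∫⁻ x, min (g x) (h x) ∂μ)) := by
    refine tendsto_lintegral_of_dominated_convergence' h (fun k => (hf k).min hh)
      (fun k => Eventually.of_forall fun x => min_le_right _ _) hfin ?_
    filter_upwards [hlim] with x hx using hx.min tendsto_const_nhds
  have h2 := h1.add he
  rw [add_zero] at h2
  have h3 : ∫⁻ x, min (g x) (h x) ∂μ < ε :=
    (lintegral_mono fun x => min_le_left _ _).trans_lt hε
  filter_upwards [h2.eventually_lt_const h3] with k hk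
  refine lt_of_le_of_lt ?_ hk
  rw [← lintegral_add_left' ((hf k).min hh)]
  refine lintegral_mono_ae ?_
  filter_upwards [hle k] with x hx
  rcases le_total (f k x) (h x) with h' | h'
  · rw [min_eq_left h']; exact le_self_add
  · rwa [min_eq_right h']

theorem tendsto_lintegral_zero {α : Type*} [MeasurableSpace α] {μ : Measure α}
    {f e : ℕ → α → ℝ≥0∞} {h : α → ℝ≥0∞} (hf : ∀ k, AEMeasurable (f k) μ)
    (hh : AEMeasurable h μ) (hfin : ∫⁻ x, h x ∂μ ≠ ⊤)
    (hle : ∀ k, ∀ᵐ x ∂μ, f k x ≤ h x + e k x)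
    (he : Tendsto (fun k => ∫⁻ x, e k x ∂μ) atTop (𝓝 0))
    (hlim : ∀ᵐ x ∂μ, Tendsto (fun k => f k x) atTop (𝓝 0)) :
    Tendsto (fun k => ∫⁻ x, f k x ∂μ) atTop (𝓝 0) := by
  rw [ENNReal.tendsto_nhds_zero]
  intro ε hε
  filter_upwards [eventually_lintegral_lt hf hh hfin hle he hlim (by simpa using hε)] with k hk
    using hk.le

/-- `ψ` is an approximation of `(u, v)` up to `ε`: in `L¹(Ω)`, with its gradient, and in the modular
at the scale `lam`. -/
structure IsApprox (Ω : Set (Rn n)) (M : Rn n → Rn n → ℝ) (lam : ℝ) (u : Rn n → ℝ)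
    (v : Rn n → Rn n) (ε : ℝ≥0∞) (ψ : Rn n → ℝ) : Prop where
  mem : ψ ∈ CcInfty Ω
  fun_le : eLpNorm (fun x => ψ x - u x) 1 (volume.restrict Ω) ≤ ε
  grad_le : eLpNorm (fun x => ∇ ψ x - v x) 1 (volume.restrict Ω) ≤ ε
  modular_le : modular Ω M (fun x => lam⁻¹ • (∇ ψ x - v x)) ≤ ε

/-- The pair `(u, v)` is a limit, in `L¹(Ω)` and in the modular at the scale `lam`, of pairs
`(ψ, ∇ψ)` with `ψ ∈ C_c^∞(Ω)` and `|ψ| ≤ B`. The value `B = ⊤` is allowed. -/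
def Approximable (Ω : Set (Rn n)) (M : Rn n → Rn n → ℝ) (lam : ℝ) (B : ℝ≥0∞) (u : Rn n → ℝ)
    (v : Rn n → Rn n) : Prop :=
  ∀ ε : ℝ≥0∞, 0 < ε → ∃ ψ, IsApprox Ω M lam u v ε ψ ∧ ∀ x, ‖ψ x‖ₑ ≤ B

theorem Approximable.mono {lam : ℝ} {B B' : ℝ≥0∞} {u : Rn n → ℝ} {v : Rn n → Rn n}
    (h : Approximable Ω M lam B u v) (hB : B ≤ B') : Approximable Ω M lam B' u v :=
  fun ε hε => (h ε hε).imp fun _ hψ => ⟨hψ.1, fun x => (hψ.2 x).trans hB⟩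

theorem modular_congr {v v' : Rn n → Rn n} (h : v =ᵐ[volume.restrict Ω] v') :
    modular Ω M v = modular Ω M v' :=
  lintegral_congr_ae (by filter_upwards [h] with x hx; rw [hx])

theorem Approximable.congr {lam : ℝ} {B : ℝ≥0∞} {u u' : Rn n → ℝ} {v v' : Rn n → Rn n}
    (h : Approximable Ω M lam B u v) (hu : u =ᵐ[volume.restrict Ω] u')
    (hv : v =ᵐ[volume.restrict Ω] v') : Approximable Ω M lam B u' v' := by
  refine fun ε hε => (h ε hε).imp fun ψ hψ => ⟨⟨hψ.1.mem, le_trans (le_of_eq ?_) hψ.1.fun_le,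
    le_trans (le_of_eq ?_) hψ.1.grad_le, le_trans (le_of_eq ?_) hψ.1.modular_le⟩, hψ.2⟩
  · exact eLpNorm_congr_ae (by filter_upwards [hu] with x hx; rw [hx])
  · exact eLpNorm_congr_ae (by filter_upwards [hv] with x hx; rw [hx])
  · exact modular_congr (by filter_upwards [hv] with x hx; rw [hx])

theorem Approximable.exists_seq {lam : ℝ} {B : ℝ≥0∞} {u : Rn n → ℝ} {v : Rn n → Rn n}
    (h : Approximable Ω M lam B u v) : ∃ ψ : ℕ → Rn n → ℝ,
      (∀ k : ℕ, IsApprox Ω M lam u v ((k : ℝ≥0∞) + 1)⁻¹ (ψ k)) ∧ ∀ k x, ‖ψ k x‖ₑ ≤ B := by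
  choose ψ hψ using fun k : ℕ => h ((k : ℝ≥0∞) + 1)⁻¹ (by simp)
  exact ⟨ψ, fun k => (hψ k).1, fun k => (hψ k).2⟩

theorem tendsto_inv_nat_add_one :
    Tendsto (fun k : ℕ => ((k : ℝ≥0∞) + 1)⁻¹) atTop (𝓝 0) := by
  have := (tendsto_add_atTop_iff_nat 1).2 ENNReal.tendsto_inv_nat_nhds_zero
  simpa using this

theorem CcInfty.add_mem {ψ₁ ψ₂ : Rn n → ℝ} (h₁ : ψ₁ ∈ CcInfty Ω) (h₂ : ψ₂ ∈ CcInfty Ω) :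
    (fun x => ψ₁ x + ψ₂ x) ∈ CcInfty Ω :=
  ⟨h₁.1.add h₂.1, h₁.2.1.add h₂.2.1, (tsupport_add ψ₁ ψ₂).trans (union_subset h₁.2.2 h₂.2.2)⟩

/-- Approximable pairs may be added at a fixed scale. The first summand is approximated first, by
some `ψ₁` with a bounded gradient. When the second one is then approximated by a sequence, the
modular of the total error converges by domination to the modular of the error of `ψ₁`, so that the
scale `3 lam` does not deteriorate when the step is repeated. -/
theorem Approximable.add (hΩ : IsOpen Ω) (hfin : volume Ω ≠ ⊤) (hM : RegularIntegrand Ω M)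
    {lam : ℝ} {B₁ B₂ : ℝ≥0∞} {u₁ u₂ : Rn n → ℝ} {v₁ v₂ : Rn n → Rn n}
    (h₁ : Approximable Ω M (3 * lam) B₁ u₁ v₁) (h₂ : Approximable Ω M lam B₂ u₂ v₂)
    (hu₁ : AEStronglyMeasurable u₁ (volume.restrict Ω))
    (hu₂ : AEStronglyMeasurable u₂ (volume.restrict Ω))
    (hv₁ : AEStronglyMeasurable v₁ (volume.restrict Ω))
    (hv₂ : AEStronglyMeasurable v₂ (volume.restrict Ω))
    (hmod : modular Ω M (fun x => lam⁻¹ • v₁ x) ≠ ⊤) :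
    Approximable Ω M (3 * lam) (B₁ + B₂) (fun x => u₁ x + u₂ x) (fun x => v₁ x + v₂ x) := by
  intro ε₀ hε₀
  obtain ⟨ε, hε, hεε₀, hεtop⟩ : ∃ ε : ℝ≥0∞, 0 < ε ∧ ε ≤ ε₀ ∧ ε ≠ ⊤ :=
    ⟨min ε₀ 1, by simp [hε₀], min_le_left _ _, by simp⟩
  have hε2 : 0 < ε / 2 := ENNReal.half_pos hε.ne'
  have hε2' : ε / 2 < ε := ENNReal.half_lt_self hε.ne' hεtop
  obtain ⟨ψ₁, hψ₁, hb₁⟩ := h₁ (ε / 2) hε2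
  obtain ⟨ψ, hψ, hb⟩ := h₂.exists_seq
  have hgm : ∀ k, AEStronglyMeasurable (∇ (ψ k)) (volume.restrict Ω) := fun k =>
    (continuous_gradient (hψ k).mem.1).aestronglyMeasurable
  have hg₁ := continuous_gradient hψ₁.mem.1
  obtain ⟨ns, hns, hae⟩ := (tendstoInMeasure_of_tendsto_eLpNorm one_ne_zero hgm hv₂
    (tendsto_zero_of_le tendsto_inv_nat_add_one fun k => (hψ k).grad_le)).exists_seq_tendsto_ae
  have hmeas : ∀ k, AEMeasurable (fun x => (3 * lam)⁻¹ • (∇ ψ₁ x + ∇ (ψ (ns k)) x -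
      (v₁ x + v₂ x))) (volume.restrict Ω) := fun k =>
    (((hg₁.aestronglyMeasurable.add (hgm (ns k))).sub (hv₁.add hv₂)).const_smul
      (3 * lam)⁻¹).aemeasurable
  obtain ⟨A, hA⟩ := (hasCompactSupport_gradient hψ₁.mem.2.1).exists_bound_of_continuous hg₁
  have hm1 : AEMeasurable (fun x => ENNReal.ofReal (M x (lam⁻¹ • ∇ ψ₁ x))) (volume.restrict Ω) :=
    hM.aemeasurable_comp hΩ (hg₁.const_smul lam⁻¹).aemeasurable
  -- convexity splits the error into `∇ψ₁`, `v₁` and the error of the second summand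
  have key := eventually_lintegral_lt (μ := volume.restrict Ω)
    (f := fun k x => ENNReal.ofReal (M x ((3 * lam)⁻¹ • (∇ ψ₁ x + ∇ (ψ (ns k)) x -
      (v₁ x + v₂ x)))))
    (e := fun k x => ENNReal.ofReal (M x (lam⁻¹ • (∇ (ψ (ns k)) x - v₂ x))))
    (g := fun x => ENNReal.ofReal (M x ((3 * lam)⁻¹ • (∇ ψ₁ x - v₁ x))))
    (h := fun x => ENNReal.ofReal (M x (lam⁻¹ • ∇ ψ₁ x)) + ENNReal.ofReal (M x (lam⁻¹ • v₁ x)))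
    (fun k => hM.aemeasurable_comp hΩ (hmeas k))
    (hm1.add (hM.aemeasurable_comp hΩ (hv₁.const_smul lam⁻¹).aemeasurable))
    (by
      rw [lintegral_add_left' hm1]
      refine ENNReal.add_ne_top.2 ⟨(hM.modular_lt_top_of_bound hΩ hfin
        (A := ‖lam⁻¹‖ * A) fun x => ?_).ne, hmod⟩
      rw [norm_smul]
      exact mul_le_mul_of_nonneg_left (hA x) (norm_nonneg _))
    (fun k => by
      filter_upwards [ae_restrict_mem hΩ.measurableSet] with x hx
      rw [← ENNReal.ofReal_add (hM.nonneg x hx _) (hM.nonneg x hx _),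
        ← ENNReal.ofReal_add (add_nonneg (hM.nonneg x hx _) (hM.nonneg x hx _))
          (hM.nonneg x hx _)]
      refine ENNReal.ofReal_le_ofReal ?_
      have := hM.third_add_le hx (lam⁻¹ • ∇ ψ₁ x) (-(lam⁻¹ • v₁ x))
        (lam⁻¹ • (∇ (ψ (ns k)) x - v₂ x))
      rw [hM.even x hx] at this
      convert this using 2
      rw [mul_inv]
      module)
    (tendsto_zero_of_le (tendsto_inv_nat_add_one.comp hns.tendsto_atTop)
      fun k => (hψ (ns k)).modular_le)
    (by
      filter_upwards [hae, ae_restrict_mem hΩ.measurableSet] with x hx hxΩ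
      refine hM.tendsto_ofReal hxΩ ?_
      have := ((hx.const_add (∇ ψ₁ x)).sub_const (v₁ x + v₂ x)).const_smul (3 * lam)⁻¹
      simpa [add_sub_add_right_eq_sub] using this)
    (ε := ε) (hψ₁.modular_le.trans_lt hε2')
  have hev := (tendsto_inv_nat_add_one.comp hns.tendsto_atTop).eventually_lt_const hε2
  obtain ⟨k, hk, hk'⟩ := (key.and hev).exists
  have hgrad : ∀ x, ∇ (fun y => ψ₁ y + ψ (ns k) y) x = ∇ ψ₁ x + ∇ (ψ (ns k)) x :=
    gradient_add' hψ₁.mem.1 (hψ _).mem.1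
  refine ⟨fun x => ψ₁ x + ψ (ns k) x, ⟨CcInfty.add_mem hψ₁.mem (hψ _).mem, ?_, ?_, ?_⟩, fun x =>
    (enorm_add_le _ _).trans (add_le_add (hb₁ x) (hb _ x))⟩
  · have e : (fun x => ψ₁ x + ψ (ns k) x - (u₁ x + u₂ x)) =
        (fun x => ψ₁ x - u₁ x) + fun x => ψ (ns k) x - u₂ x := by
      ext1 x; simp only [Pi.add_apply]; ring
    rw [e]
    refine (eLpNorm_add_le (hψ₁.mem.1.continuous.aestronglyMeasurable.sub hu₁)
      ((hψ _).mem.1.continuous.aestronglyMeasurable.sub hu₂) le_rfl).trans ?_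
    refine (add_le_add hψ₁.fun_le ((hψ _).fun_le.trans hk'.le)).trans ?_
    rwa [ENNReal.add_halves]
  · have e : (fun x => ∇ (fun y => ψ₁ y + ψ (ns k) y) x - (v₁ x + v₂ x)) =
        (fun x => ∇ ψ₁ x - v₁ x) + fun x => ∇ (ψ (ns k)) x - v₂ x := by
      ext1 x; rw [hgrad]; simp only [Pi.add_apply]; abel
    rw [e]
    refine (eLpNorm_add_le (hg₁.aestronglyMeasurable.sub hv₁) ((hgm _).sub hv₂) le_rfl).trans ?_
    refine (add_le_add hψ₁.grad_le ((hψ _).grad_le.trans hk'.le)).trans ?_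
    rwa [ENNReal.add_halves]
  · simp_rw [hgrad]
    exact hk.le.trans hεε₀

/-- A limit of approximable pairs is approximable, at twice the scale. -/
theorem Approximable.of_approx (hΩ : IsOpen Ω) (hM : RegularIntegrand Ω M)
    {lam : ℝ} {B : ℝ≥0∞} {u : Rn n → ℝ} {v : Rn n → Rn n}
    (hu : AEStronglyMeasurable u (volume.restrict Ω))
    (hv : AEStronglyMeasurable v (volume.restrict Ω))
    (h : ∀ ε : ℝ≥0∞, 0 < ε → ∃ u' v', Approximable Ω M lam B u' v' ∧
      AEStronglyMeasurable u' (volume.restrict Ω) ∧ AEStronglyMeasurable v' (volume.restrict Ω) ∧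
      eLpNorm (fun x => u' x - u x) 1 (volume.restrict Ω) ≤ ε ∧
      eLpNorm (fun x => v' x - v x) 1 (volume.restrict Ω) ≤ ε ∧
      modular Ω M (fun x => lam⁻¹ • (v' x - v x)) ≤ ε) :
    Approximable Ω M (2 * lam) B u v := by
  intro ε hε
  obtain ⟨u', v', happ, hu', hv', h1, h2, h3⟩ := h (ε / 2) (ENNReal.half_pos hε.ne')
  obtain ⟨ψ, hψ, hb⟩ := happ (ε / 2) (ENNReal.half_pos hε.ne')
  have hg := (continuous_gradient hψ.mem.1).aestronglyMeasurable (μ := volume.restrict Ω)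
  refine ⟨ψ, ⟨hψ.mem, ?_, ?_, ?_⟩, hb⟩
  · have e : (fun x => ψ x - u x) = (fun x => ψ x - u' x) + fun x => u' x - u x := by
      ext1 x; simp
    rw [e]
    refine (eLpNorm_add_le (hψ.mem.1.continuous.aestronglyMeasurable.sub hu') (hu'.sub hu)
      le_rfl).trans ((add_le_add hψ.fun_le h1).trans_eq (ENNReal.add_halves ε))
  · have e : (fun x => ∇ ψ x - v x) = (fun x => ∇ ψ x - v' x) + fun x => v' x - v x := by
      ext1 x; simp
    rw [e]
    exact (eLpNorm_add_le (hg.sub hv') (hv'.sub hv) le_rfl).trans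
      ((add_le_add hψ.grad_le h2).trans_eq (ENNReal.add_halves ε))
  · have e : (fun x => (2 * lam)⁻¹ • (∇ ψ x - v x)) =
        fun x => (2⁻¹ : ℝ) • (lam⁻¹ • (∇ ψ x - v' x) + lam⁻¹ • (v' x - v x)) := by
      ext1 x
      rw [mul_inv]
      module
    have hm : AEMeasurable (fun x => lam⁻¹ • (∇ ψ x - v' x)) (volume.restrict Ω) :=
      ((hg.sub hv').const_smul lam⁻¹).aemeasurable
    rw [e]
    exact (hM.modular_half_add_le hΩ hm).trans
      ((add_le_add hψ.modular_le h3).trans_eq (ENNReal.add_halves ε))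

end MusielakOrlicz

namespace MusielakOrlicz

variable {n : ℕ} {Ω : Set (Rn n)} {M : Rn n → Rn n → ℝ}

/-! ### Approximation of functions whose support can be pushed into the domain -/

/-- The majorant in the Jensen-type estimate for mollified gradients. -/
noncomputable def majorant (Ω : Set (Rn n)) (M : Rn n → Rn n → ℝ) (C A : ℝ) (w : Rn n → Rn n)
    (y : Rn n) : ℝ :=
  Ω.indicator (fun y => 2 * M y (C • w y)) y + A * ‖w y‖

theorem RegularIntegrand.integrable_majorant (hM : RegularIntegrand Ω M) (hΩ : IsOpen Ω) {C A : ℝ}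
    {w : Rn n → Rn n} (hw : Integrable w) (hmod : modular Ω M (fun x => C • w x) ≠ ⊤) :
    Integrable (majorant Ω M C A w) := by
  refine Integrable.add ?_ (hw.norm.const_mul A)
  rw [integrable_indicator_iff hΩ.measurableSet]
  have hm : AEMeasurable (fun x => C • w x) (volume.restrict Ω) :=
    (hw.1.aemeasurable.const_smul C).restrict
  refine Integrable.const_mul ?_ 2
  refine (integrable_toReal_of_lintegral_ne_top (hM.aemeasurable_comp hΩ hm) hmod).congr ?_
  filter_upwards [ae_restrict_mem hΩ.measurableSet] with x hx
  exact ENNReal.toReal_ofReal (hM.nonneg x hx _)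

/-- Jensen's inequality for the mollification of `w`, with an integrand that depends on the point:
the affine minorant provided by the balance condition is integrated against the kernel. -/
theorem Balanced.le_mollify_majorant (hM : RegularIntegrand Ω M) (hΩ : IsOpen Ω) {γ C A : ℝ}
    (hB : Balanced Ω M γ C A) {k : Rn n → ℝ} {δ : ℝ} (hk : IsMollifier k δ) (hδ : 0 < δ)
    (hδ1 : δ ≤ 1) {w : Rn n → Rn n} (hw : Integrable w) (hw0 : ∀ x, x ∉ Ω → w x = 0)
    (hmod : modular Ω M (fun x => C • w x) ≠ ⊤) {x : Rn n} (hx : x ∈ Ω)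
    (hs : ‖mollify k w x‖ ≤ δ ^ (γ - 1) / 2) :
    M x (mollify k w x) ≤ A + mollify k (majorant Ω M C A w) x := by
  obtain ⟨-, hA, hB⟩ := hB
  set ξ := mollify k w x with hξ
  obtain ⟨q, hq⟩ := hB x hx δ hδ hδ1 ξ hs
  have hiw : Integrable fun t => k t • w (x - t) :=
    integrable_smul_comp_sub hk.contDiff.continuous hk.hasCompactSupport hw.locallyIntegrable x
  have hiH : Integrable fun t => k t • majorant Ω M C A w (x - t) :=
    integrable_smul_comp_sub hk.contDiff.continuous hk.hasCompactSupport
      (hM.integrable_majorant hΩ hw hmod).locallyIntegrable x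
  have hiq : Integrable fun t => inner ℝ q (k t • w (x - t)) := hiw.const_inner q
  have hl : ∫ t, (k t * (M x ξ - inner ℝ q ξ) + inner ℝ q (k t • w (x - t))) = M x ξ := by
    rw [integral_add (hk.integrable.mul_const _) hiq, integral_mul_const, hk.integral_eq_one,
      integral_inner hiw]
    have : ∫ t, k t • w (x - t) = ξ := rfl
    rw [this]; ring
  have hr : ∫ t, (k t * A + k t • majorant Ω M C A w (x - t)) =
      A + mollify k (majorant Ω M C A w) x := by
    rw [integral_add (hk.integrable.mul_const _) hiH, integral_mul_const, hk.integral_eq_one,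
      one_mul]
    rfl
  rw [← hl, ← hr]
  refine integral_mono ((hk.integrable.mul_const _).add hiq) ((hk.integrable.mul_const _).add hiH)
    fun t => ?_
  have hpt : ‖t‖ < δ → M x ξ + inner ℝ q (w (x - t) - ξ) ≤ A + majorant Ω M C A w (x - t) := by
    intro ht
    by_cases hxt : x - t ∈ Ω
    · have := hq (x - t) hxt (by simpa [dist_eq_norm] using ht) (w (x - t))
      simp only [majorant, indicator_of_mem hxt]
      linarith
    · -- outside `Ω`, where `w` vanishes, the minorant is compared with `M x` at the origin
      have := hq x hx (by simpa using hδ) 0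
      simp only [majorant, indicator_of_notMem hxt, hw0 _ hxt]
      simp only [smul_zero, hM.map_zero x hx, norm_zero] at this ⊢
      linarith
  by_cases ht : ‖t‖ < δ
  · have := mul_le_mul_of_nonneg_left (hpt ht) (hk.nonneg t)
    rw [inner_sub_right] at this
    simp only [inner_smul_right, smul_eq_mul]
    linarith
  · simp [hk.eq_zero_of_le_norm (not_lt.1 ht)]

theorem mollify_const_smul {k : Rn n → ℝ} (a : ℝ) (v : Rn n → Rn n) (x : Rn n) :
    mollify k (fun y => a • v y) x = a • mollify k v x := by
  simp_rw [mollify, smul_comm _ a]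
  exact integral_smul a _

open scoped Pointwise in
/-- Displaced mollification keeps a function inside `Ω` when its support can be pushed into `Ω`. -/
theorem mollify_mem_ccInfty {k : Rn n → ℝ} {δ : ℝ} (hk : IsMollifier k δ) {u : Rn n → ℝ}
    (hu : LocallyIntegrable u) {S Q : Set (Rn n)} (hS : IsCompact S) (hQ : IsCompact Q)
    (hkQ : Function.support k ⊆ Q) (huS : Function.support u ⊆ S)
    (hpush : ∀ x ∈ S, ∀ z ∈ Q, x + z ∈ Ω) : mollify k u ∈ CcInfty Ω := by
  have hc : IsCompact (Q + S) := hQ.add hS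
  have hsub : Function.support (mollify k u) ⊆ Q + S :=
    (support_convolution_subset (ContinuousLinearMap.lsmul ℝ ℝ)).trans (add_subset_add hkQ huS)
  refine ⟨contDiff_mollify hk.contDiff hk.hasCompactSupport hu,
    HasCompactSupport.of_support_subset_isCompact hc hsub,
    (closure_minimal hsub hc.isClosed).trans ?_⟩
  rintro _ ⟨z, hz, x, hx, rfl⟩
  simpa [add_comm] using hpush x hx z hz

/-- The main approximation step, for a function `u` with small oscillation whose support can be
pushed into `Ω` along the support of the kernel `ρ`. The smallness of the oscillation relative to
the scale `lam` brings the mollified gradients into the range in which the balance condition is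
available. -/
theorem approximable_of_push (hΩ : IsOpen Ω) (hfin : volume Ω ≠ ⊤) (hM : RegularIntegrand Ω M)
    {γ C A : ℝ} (hγ : 0 ≤ γ) (hB : Balanced Ω M γ C A) {ρ : Rn n → ℝ} (hρ : IsMollifier ρ 1)
    {S : Set (Rn n)} (hS : IsCompact S) {u : Rn n → ℝ} {v : Rn n → Rn n} (h : StrongGrad u v)
    (huS : Function.support u ⊆ S) (hv0 : ∀ x, x ∉ Ω → v x = 0)
    {t₀ : ℝ} (ht₀ : 0 < t₀)
    (hpush : ∀ δ, 0 < δ → δ < t₀ → ∀ x ∈ S, ∀ z ∈ tsupport ρ, x + δ • z ∈ Ω)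
    {b : ℝ} (hb : ∀ x, |u x| ≤ b) {K : ℝ} (hK : 0 ≤ K)
    (hosc : ∀ x y, ‖x - y‖ ≤ 1 → |u x - u y| ≤ K * ‖x - y‖ ^ γ) {lam : ℝ} (hlam : 0 < lam)
    (hKlam : K * ∫ t, ‖∇ ρ t‖ ≤ lam / 2)
    (hmod : modular Ω M (fun x => C • lam⁻¹ • v x) ≠ ⊤) :
    Approximable Ω M (2 * lam) (ENNReal.ofReal b) u v := by
  -- scales tending to zero
  obtain ⟨δ, hδ0, hδ1, hδt, hδlim⟩ : ∃ δ : ℕ → ℝ, (∀ k, 0 < δ k) ∧ (∀ k, δ k ≤ 1) ∧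
      (∀ k, δ k < t₀) ∧ Tendsto δ atTop (𝓝[>] 0) := by
    obtain ⟨δ, -, hδ, hlim⟩ := exists_seq_strictAnti_tendsto' (lt_min ht₀ one_pos)
    exact ⟨δ, fun k => (hδ k).1, fun k => ((hδ k).2.trans_le (min_le_right _ _)).le,
      fun k => (hδ k).2.trans_le (min_le_left _ _),
      tendsto_nhdsWithin_iff.2 ⟨hlim, Eventually.of_forall fun k => (hδ k).1⟩⟩
  have hk : ∀ j, IsMollifier (dilate ρ (δ j)) (δ j) := fun j => by
    simpa using hρ.dilate (hδ0 j)
  set ψ : ℕ → Rn n → ℝ := fun j => mollify (dilate ρ (δ j)) u with hψ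
  have hloc := h.integrable.locallyIntegrable
  have hgrad : ∀ j, ∇ (ψ j) = mollify (dilate ρ (δ j)) v := fun j =>
    funext fun x => h.gradient_mollify (hk j) x
  have hmem : ∀ j, ψ j ∈ CcInfty Ω := fun j => by
    refine mollify_mem_ccInfty (hk j) hloc hS
      (Q := (fun z => δ j • z) '' tsupport ρ)
      ((hρ.hasCompactSupport.isCompact).image (by fun_prop)) (fun z hz => ?_) huS ?_
    · refine ⟨(δ j)⁻¹ • z, subset_tsupport _ fun h0 => hz ?_, smul_inv_smul₀ (hδ0 j).ne' z⟩
      simp [dilate, h0]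
    · rintro x hx _ ⟨z, hz, rfl⟩
      exact hpush (δ j) (hδ0 j) (hδt j) x hx z hz
  set w : Rn n → Rn n := fun x => lam⁻¹ • v x with hw
  have hwi : Integrable w := h.integrable_grad.smul lam⁻¹
  have hw0 : ∀ x, x ∉ Ω → w x = 0 := fun x hx => by simp [hw, hv0 x hx]
  set H := majorant Ω M C A w with hH
  have hHi : Integrable H := hM.integrable_majorant hΩ hwi hmod
  -- the mollified gradients lie in the range of the balance condition
  have hsize : ∀ j x, ‖mollify (dilate ρ (δ j)) w x‖ ≤ δ j ^ (γ - 1) / 2 := fun j x => by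
    have h1 := norm_gradient_mollify_le (hk j) hloc (x := x) (s := K * δ j ^ γ) fun t ht => by
      have e : ‖x - t - x‖ = ‖t‖ := by simp
      refine (hosc _ _ (by rw [e]; exact ht.le.trans (hδ1 j))).trans ?_
      rw [e]
      gcongr
    rw [integral_norm_gradient_dilate hρ.contDiff (hδ0 j)] at h1
    rw [hw, mollify_const_smul, ← h.gradient_mollify (hk j), norm_smul, norm_inv,
      Real.norm_of_nonneg hlam.le, inv_mul_le_iff₀ hlam]
    refine h1.trans ?_
    have e : δ j ^ (γ - 1) = δ j ^ γ * (δ j)⁻¹ := by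
      rw [Real.rpow_sub_one (hδ0 j).ne', div_eq_mul_inv]
    rw [e]
    have h2 : 0 ≤ δ j ^ γ * (δ j)⁻¹ :=
      mul_nonneg (Real.rpow_nonneg (hδ0 j).le _) (inv_nonneg.2 (hδ0 j).le)
    have := mul_le_mul_of_nonneg_left hKlam h2
    linarith
  have hjensen : ∀ j, ∀ x ∈ Ω, M x (lam⁻¹ • ∇ (ψ j) x) ≤ A + mollify (dilate ρ (δ j)) H x :=
    fun j x hx => by
      rw [hgrad, ← mollify_const_smul]
      exact hB.le_mollify_majorant hM hΩ (hk j) (hδ0 j) (hδ1 j) hwi hw0 hmod hx (hsize j x)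
  have lim1 : Tendsto (fun j => eLpNorm (fun x => ψ j x - u x) 1 (volume.restrict Ω)) atTop
      (𝓝 0) :=
    tendsto_zero_of_le ((tendsto_mollify hρ h.integrable).comp hδlim)
      fun j => eLpNorm_mono_measure _ Measure.restrict_le_self
  have lim2 : Tendsto (fun j => eLpNorm (fun x => ∇ (ψ j) x - v x) 1 (volume.restrict Ω)) atTop
      (𝓝 0) := by
    refine tendsto_zero_of_le ((tendsto_mollify hρ h.integrable_grad).comp hδlim)
      fun j => (eLpNorm_mono_measure _ Measure.restrict_le_self).trans (le_of_eq ?_)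
    rw [hgrad]
    rfl
  have lim3 : Tendsto (fun j => ∫⁻ x in Ω, ‖mollify (dilate ρ (δ j)) H x - H x‖ₑ) atTop
      (𝓝 0) := by
    refine tendsto_zero_of_le ((tendsto_mollify hρ hHi).comp hδlim) fun j => ?_
    simp only [Function.comp_apply, eLpNorm_one_eq_lintegral_enorm]
    exact lintegral_mono' Measure.restrict_le_self le_rfl
  have hgm : ∀ j, AEStronglyMeasurable (∇ (ψ j)) (volume.restrict Ω) := fun j =>
    (continuous_gradient (hmem j).1).aestronglyMeasurable
  have hvm : AEStronglyMeasurable v (volume.restrict Ω) := h.integrable_grad.1.restrict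
  have hwm : AEMeasurable w (volume.restrict Ω) := hwi.1.aemeasurable.restrict
  obtain ⟨ns, hns, hae⟩ := (tendstoInMeasure_of_tendsto_eLpNorm one_ne_zero hgm hvm
    lim2).exists_seq_tendsto_ae
  have hmeas : ∀ j, AEMeasurable (fun x => (2 * lam)⁻¹ • (∇ (ψ (ns j)) x - v x))
      (volume.restrict Ω) := fun j =>
    (((hgm (ns j)).sub hvm).const_smul (2 * lam)⁻¹).aemeasurable
  have hHm : AEMeasurable (fun x => ENNReal.ofReal (H x)) (volume.restrict Ω) :=
    hHi.1.aemeasurable.restrict.ennreal_ofReal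
  have hC : 1 ≤ C := hB.1
  have lim4 : Tendsto (fun j => modular Ω M fun x => (2 * lam)⁻¹ • (∇ (ψ (ns j)) x - v x)) atTop
      (𝓝 0) := by
    refine tendsto_lintegral_zero (μ := volume.restrict Ω)
      (h := fun x => ENNReal.ofReal A + (ENNReal.ofReal (H x) + ENNReal.ofReal (M x (w x))))
      (e := fun j x => ‖mollify (dilate ρ (δ (ns j))) H x - H x‖ₑ)
      (fun j => hM.aemeasurable_comp hΩ (hmeas j))
      (aemeasurable_const.add (hHm.add (hM.aemeasurable_comp hΩ hwm))) ?_ (fun j => ?_)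
      (lim3.comp hns.tendsto_atTop) ?_
    · rw [lintegral_add_left' aemeasurable_const, lintegral_add_left' hHm, setLIntegral_const]
      refine ENNReal.add_ne_top.2 ⟨ENNReal.mul_ne_top ENNReal.ofReal_ne_top hfin,
        ENNReal.add_ne_top.2 ⟨?_, ?_⟩⟩
      · exact (hHi.restrict.lintegral_lt_top).ne
      · refine ne_top_of_le_ne_top hmod (hM.modular_mono hΩ (f := fun _ => C⁻¹) (fun _ => ?_)
          fun x => ?_)
        · rw [abs_of_nonneg (by positivity)]
          exact inv_le_one_of_one_le₀ hC
        · rw [inv_smul_smul₀ (by positivity)]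
    · filter_upwards [ae_restrict_mem hΩ.measurableSet] with x hx
      have h1 := hM.half_add_le hx (lam⁻¹ • ∇ (ψ (ns j)) x) (-w x)
      have e : (2⁻¹ : ℝ) • (lam⁻¹ • ∇ (ψ (ns j)) x + -w x) =
          (2 * lam)⁻¹ • (∇ (ψ (ns j)) x - v x) := by
        rw [hw, mul_inv]; module
      rw [e, hM.even x hx] at h1
      have h2 : M x ((2 * lam)⁻¹ • (∇ (ψ (ns j)) x - v x)) ≤
          A + (H x + M x (w x)) + |mollify (dilate ρ (δ (ns j))) H x - H x| := by
        linarith [hjensen (ns j) x hx, le_abs_self (mollify (dilate ρ (δ (ns j))) H x - H x)]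
      refine (ENNReal.ofReal_le_ofReal h2).trans (ENNReal.ofReal_add_le.trans ?_)
      rw [Real.enorm_eq_ofReal_abs]
      gcongr
      exact ENNReal.ofReal_add_le.trans (by gcongr; exact ENNReal.ofReal_add_le)
    · filter_upwards [hae, ae_restrict_mem hΩ.measurableSet] with x hx hxΩ
      have := hM.tendsto_ofReal hxΩ ((hx.sub_const (v x)).const_smul (2 * lam)⁻¹)
      simpa [hM.map_zero x hxΩ] using this
  intro ε hε
  have ev := ENNReal.tendsto_nhds_zero.1 lim4 ε hε
  have ev1 := ENNReal.tendsto_nhds_zero.1 (lim1.comp hns.tendsto_atTop) ε hε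
  have ev2 := ENNReal.tendsto_nhds_zero.1 (lim2.comp hns.tendsto_atTop) ε hε
  obtain ⟨j, h4, h1, h2⟩ := (ev.and (ev1.and ev2)).exists
  refine ⟨ψ (ns j), ⟨hmem _, h1, h2, h4⟩, fun x => ?_⟩
  rw [Real.enorm_eq_ofReal_abs]
  exact ENNReal.ofReal_le_ofReal (abs_mollify_le (hk _) hb x)

end MusielakOrlicz

namespace MusielakOrlicz

variable {n : ℕ} {Ω : Set (Rn n)}

/-! ### Localization in Lipschitz domains -/

theorem exists_isMollifier (z : Rn n) {ε : ℝ} (hε : 0 < ε) (hz : ‖z‖ + ε ≤ 1) :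
    ∃ ρ, IsMollifier ρ 1 ∧ tsupport ρ ⊆ Metric.closedBall z ε := by
  let f : ContDiffBump z := ⟨ε / 2, ε, by positivity, by linarith⟩
  refine ⟨f.normed volume, ⟨f.contDiff_normed, fun t => f.nonneg_normed t, f.integral_normed, ?_⟩,
    (f.tsupport_normed_eq).subset⟩
  rw [f.support_normed_eq]
  exact Metric.ball_subset_ball' (by simpa [add_comm] using hz)

/-- A smooth cutoff function `θ` such that the part of the closure of `Ω` met by its support is
moved into `Ω` by small multiples of the vectors in the support of some mollifying kernel. -/
structure IsPushPatch (Ω : Set (Rn n)) (θ : Rn n → ℝ) : Prop where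
  contDiff : ContDiff ℝ ∞ θ
  hasCompactSupport : HasCompactSupport θ
  nonneg : ∀ x, 0 ≤ θ x
  le_one : ∀ x, θ x ≤ 1
  push : ∃ ρ : Rn n → ℝ, IsMollifier ρ 1 ∧ ∃ t₀ : ℝ, 0 < t₀ ∧ ∀ δ, 0 < δ → δ < t₀ →
    ∀ x ∈ closure Ω ∩ tsupport θ, ∀ z ∈ tsupport ρ, x + δ • z ∈ Ω

/-- Near a point of the closure of a Lipschitz domain, points of the closure are pushed into the
domain by a cone of directions: all small directions at interior points, and at boundary points
those in a narrow cone around the vertical direction of the local graph. -/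
theorem IsBoundedLipschitzDomain.exists_push (hΩ : IsBoundedLipschitzDomain Ω) {a : Rn n}
    (ha : a ∈ closure Ω) : ∃ R : ℝ, 0 < R ∧ ∃ ρ : Rn n → ℝ, IsMollifier ρ 1 ∧ ∃ t₀ : ℝ, 0 < t₀ ∧
      ∀ δ, 0 < δ → δ < t₀ → ∀ x ∈ closure Ω ∩ Metric.ball a R, ∀ z ∈ tsupport ρ,
        x + δ • z ∈ Ω := by
  by_cases haΩ : a ∈ Ω
  · obtain ⟨r, hr, hrΩ⟩ := Metric.isOpen_iff.1 hΩ.isOpen a haΩ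
    obtain ⟨ρ, hρ, hρs⟩ := exists_isMollifier (0 : Rn n) one_pos (by simp)
    refine ⟨r / 2, by positivity, ρ, hρ, r / 2, by positivity, fun δ hδ hδr x hx z hz => hrΩ ?_⟩
    have h1 := hρs hz
    have h2 := hx.2
    simp only [mem_ball_iff_norm, mem_closedBall_iff_norm, sub_zero] at h1 h2 ⊢
    have e : x + δ • z - a = (x - a) + δ • z := by abel
    calc ‖x + δ • z - a‖ ≤ ‖x - a‖ + δ * ‖z‖ := by
          rw [e]
          refine (norm_add_le _ _).trans_eq ?_
          rw [norm_smul, Real.norm_of_nonneg hδ.le]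
      _ < r := by nlinarith [norm_nonneg z]
  · have hfr : a ∈ frontier Ω := ⟨ha, by rwa [hΩ.isOpen.interior_eq]⟩
    obtain ⟨r, hr, e, he, K, g, hg, hΩr⟩ := hΩ.lipschitz_boundary a hfr
    -- directions within `ε` of `e / 2` stay in the cone on which the graph, of slope `K`, is left
    -- behind, since `2 K ε < 1 / 2 - ε`
    set ε : ℝ := (8 * (K + 1))⁻¹ with hε
    have hK0 : (0 : ℝ) ≤ K := K.2
    have hε0 : 0 < ε := by positivity
    have hε1 : ε ≤ 1 / 8 := by
      rw [hε, one_div]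
      exact inv_anti₀ (by norm_num) (by linarith)
    have hεK : ε * (K + 1) = 1 / 8 := by rw [hε]; field_simp
    obtain ⟨ρ, hρ, hρs⟩ := exists_isMollifier ((1 / 2 : ℝ) • e) hε0 (by
      rw [norm_smul, he, Real.norm_of_nonneg (by norm_num)]; linarith)
    have hgc := hg.continuous
    refine ⟨r / 2, by positivity, ρ, hρ, r / 2, by positivity, fun δ hδ hδr x hx z hz => ?_⟩
    have hxa : ‖x - a‖ < r / 2 := by simpa [dist_eq_norm] using hx.2
    -- points of the closure lie on or above the graph
    have hxg : g (x - inner ℝ e x • e) ≤ inner ℝ e x := by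
      have hcl : IsClosed {y : Rn n | g (y - inner ℝ e y • e) ≤ inner ℝ e y} :=
        isClosed_le (by fun_prop) (by fun_prop)
      have hsub : Ω ∩ Metric.ball a r ⊆ {y : Rn n | g (y - inner ℝ e y • e) ≤ inner ℝ e y} := by
        rw [hΩr]
        exact fun y hy => le_of_lt hy.2
      refine closure_minimal hsub hcl ?_
      have hxball : x ∈ Metric.ball a r := by
        rw [mem_ball_iff_norm]; linarith
      rw [inter_comm]
      exact Metric.isOpen_ball.inter_closure ⟨hxball, hx.1⟩
    set w := z - (1 / 2 : ℝ) • e with hw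
    have hzw : z = (1 / 2 : ℝ) • e + w := by rw [hw]; abel
    have hwε : ‖w‖ ≤ ε := mem_closedBall_iff_norm.1 (hρs hz)
    have hee : inner ℝ e e = (1 : ℝ) := by rw [real_inner_self_eq_norm_sq, he]; norm_num
    have hew : |inner ℝ e w| ≤ ε := by
      have := abs_real_inner_le_norm e w
      rw [he, one_mul] at this
      exact this.trans hwε
    have hez : inner ℝ e z = 1 / 2 + inner ℝ e w := by
      rw [hzw, inner_add_right, inner_smul_right, hee, mul_one]
    have hzhor : ‖z - inner ℝ e z • e‖ ≤ 2 * ε := by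
      have e1 : z - inner ℝ e z • e = w - inner ℝ e w • e := by
        rw [hez, hzw]; module
      rw [e1]
      refine (norm_sub_le _ _).trans ?_
      rw [norm_smul, he, mul_one, Real.norm_eq_abs]
      linarith
    have hz1 : ‖z‖ ≤ 1 := by
      rw [hzw]
      refine (norm_add_le _ _).trans ?_
      rw [norm_smul, he, Real.norm_of_nonneg (by norm_num)]
      linarith
    have hmem : x + δ • z ∈ Ω ∩ Metric.ball a r := by
      rw [hΩr]
      refine ⟨?_, ?_⟩
      · rw [mem_ball_iff_norm]
        have e1 : x + δ • z - a = (x - a) + δ • z := by abel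
        rw [e1]
        refine (norm_add_le _ _).trans_lt ?_
        rw [norm_smul, Real.norm_of_nonneg hδ.le]
        nlinarith [norm_nonneg z]
      · have e1 : x + δ • z - inner ℝ e (x + δ • z) • e =
            (x - inner ℝ e x • e) + δ • (z - inner ℝ e z • e) := by
          rw [inner_add_right, inner_smul_right]; module
        have h1 : g (x + δ • z - inner ℝ e (x + δ • z) • e) ≤
            g (x - inner ℝ e x • e) + K * (δ * (2 * ε)) := by
          have := hg.dist_le_mul (x + δ • z - inner ℝ e (x + δ • z) • e) (x - inner ℝ e x • e)
          rw [Real.dist_eq, dist_eq_norm, e1, add_sub_cancel_left, norm_smul,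
            Real.norm_of_nonneg hδ.le] at this
          rw [e1]
          have h2 : (K : ℝ) * (δ * ‖z - inner ℝ e z • e‖) ≤ K * (δ * (2 * ε)) := by gcongr
          linarith [le_abs_self (g (x - inner ℝ e x • e + δ • (z - inner ℝ e z • e)) -
            g (x - inner ℝ e x • e))]
        change g (x + δ • z - inner ℝ e (x + δ • z) • e) < inner ℝ e (x + δ • z)
        rw [inner_add_right, inner_smul_right, hez]
        rw [inner_add_right, inner_smul_right, hez] at h1
        have h3 : (K : ℝ) * (2 * ε) < 1 / 2 + inner ℝ e w := by
          linarith [neg_abs_le (inner ℝ e w : ℝ)]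
        have h4 : (K : ℝ) * (δ * (2 * ε)) < δ * (1 / 2 + inner ℝ e w) := by
          have := mul_lt_mul_of_pos_left h3 hδ
          linarith
        linarith
    exact hmem.1

open scoped Manifold in
/-- The closure of a bounded Lipschitz domain carries a finite partition of unity by cutoff
functions on whose supports the domain can be pushed into itself. -/
theorem IsBoundedLipschitzDomain.exists_partition (hΩ : IsBoundedLipschitzDomain Ω) :
    ∃ (ι : Type) (_ : Fintype ι) (θ : ι → Rn n → ℝ), (∀ i, IsPushPatch Ω (θ i)) ∧
      (∀ x, ∑ i, θ i x ≤ 1) ∧ ∀ x ∈ closure Ω, ∑ i, θ i x = 1 := by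
  have hc : IsCompact (closure Ω) := hΩ.isBounded.isCompact_closure
  choose R hR ρ hρ t₀ ht₀ hpush using fun a : closure Ω => hΩ.exists_push a.2
  obtain ⟨t, ht⟩ := hc.elim_nhds_subcover' (fun a ha => Metric.ball a (R ⟨a, ha⟩))
    fun a ha => Metric.ball_mem_nhds _ (hR ⟨a, ha⟩)
  obtain ⟨f, hf⟩ := SmoothPartitionOfUnity.exists_isSubordinate 𝓘(ℝ, Rn n)
    (isClosed_closure (s := Ω)) (fun a : t => Metric.ball (a : closure Ω).1 (R a))
    (fun a => Metric.isOpen_ball) (by simpa [iUnion_subtype] using ht)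
  refine ⟨t, inferInstance, fun a => f a, fun a => ⟨(f a).contMDiff.contDiff, ?_,
    fun x => f.nonneg a x, fun x => f.le_one a x,
    ρ a, hρ a, t₀ a, ht₀ a, fun δ h0 h1 x hx => hpush a δ h0 h1 x ⟨hx.1, hf a hx.2⟩⟩, ?_, ?_⟩
  · exact HasCompactSupport.of_support_subset_isCompact
      (isCompact_closedBall (a : closure Ω).1 (R a))
      ((subset_tsupport _).trans ((hf a).trans Metric.ball_subset_closedBall))
  · intro x
    have := f.sum_le_one x
    rwa [finsum_eq_sum_of_fintype] at this
  · intro x hx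
    have := f.sum_eq_one hx
    rwa [finsum_eq_sum_of_fintype] at this

end MusielakOrlicz

namespace MusielakOrlicz

variable {n : ℕ} {Ω : Set (Rn n)} {M : Rn n → Rn n → ℝ}

/-! ### Approximation of bounded functions -/

theorem Approximable.zero (hM : RegularIntegrand Ω M) (hΩ : IsOpen Ω) (lam : ℝ) :
    Approximable Ω M lam 0 (fun _ => 0) (fun _ => 0) := by
  intro ε _
  have hg : ∇ (fun _ : Rn n => (0 : ℝ)) = fun _ => 0 := by ext1 x; simp [gradient]
  refine ⟨fun _ => 0, ⟨⟨contDiff_const, HasCompactSupport.zero, by simp [tsupport]⟩, by simp,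
    by simp [hg], ?_⟩, by simp⟩
  have : modular Ω M (fun x => lam⁻¹ • (∇ (fun _ : Rn n => (0 : ℝ)) x - 0)) = 0 := by
    rw [hg, modular, setLIntegral_congr_fun (g := fun _ => 0) hΩ.measurableSet fun x hx => by
      simp [hM.map_zero x hx]]
    simp
  rw [this]
  exact zero_le

/-- A finite sum of approximable pairs is approximable at three times the scale, provided that the
partial sums of the gradients have finite modular. -/
theorem Approximable.sum (hΩ : IsOpen Ω) (hfin : volume Ω ≠ ⊤) (hM : RegularIntegrand Ω M)
    {ι : Type*} {lam : ℝ} {B : ι → ℝ≥0∞} {u : ι → Rn n → ℝ} {v : ι → Rn n → Rn n} (s : Finset ι)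
    (h : ∀ i, Approximable Ω M lam (B i) (u i) (v i))
    (hu : ∀ i, AEStronglyMeasurable (u i) (volume.restrict Ω))
    (hv : ∀ i, AEStronglyMeasurable (v i) (volume.restrict Ω))
    (hmod : ∀ t : Finset ι, modular Ω M (fun x => lam⁻¹ • ∑ i ∈ t, v i x) ≠ ⊤) :
    Approximable Ω M (3 * lam) (∑ i ∈ s, B i) (fun x => ∑ i ∈ s, u i x)
      (fun x => ∑ i ∈ s, v i x) := by
  classical
  induction s using Finset.induction_on with
  | empty => simpa using Approximable.zero hM hΩ (3 * lam)
  | insert i s hi ih =>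
    simp only [Finset.sum_insert hi, add_comm (B i), add_comm (u i _), add_comm (v i _)]
    exact ih.add hΩ hfin hM (h i) (Finset.aestronglyMeasurable_fun_sum s fun j _ => hu j) (hu i)
      (Finset.aestronglyMeasurable_fun_sum s fun j _ => hv j) (hv i) (hmod s)

/-- The gradient `f v + g` of a function multiplied by a cutoff has finite modular at twice the
scale of `v`, because the term `g`, free of derivatives of that function, is bounded. -/
theorem RegularIntegrand.modular_smul_add_ne_top (hM : RegularIntegrand Ω M) (hΩ : IsOpen Ω)
    (hfin : volume Ω ≠ ⊤) {lam : ℝ} {v g : Rn n → Rn n} {f : Rn n → ℝ} {A : ℝ}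
    (hg : ∀ x, ‖g x‖ ≤ A) (hgm : AEMeasurable g (volume.restrict Ω))
    (hf : ∀ x, |f x| ≤ 1) (hmod : modular Ω M (fun x => lam⁻¹ • v x) ≠ ⊤) :
    modular Ω M (fun x => (2 * lam)⁻¹ • (f x • v x + g x)) ≠ ⊤ := by
  have e : (fun x => (2 * lam)⁻¹ • (f x • v x + g x)) =
      fun x => (2⁻¹ : ℝ) • (lam⁻¹ • g x + f x • lam⁻¹ • v x) := by
    ext1 x
    rw [mul_inv]
    module
  have hgm2 : AEMeasurable (fun x => lam⁻¹ • g x) (volume.restrict Ω) := hgm.const_smul lam⁻¹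
  rw [e]
  refine ne_top_of_le_ne_top ?_ (hM.modular_half_add_le hΩ hgm2)
  refine ENNReal.add_ne_top.2 ⟨(hM.modular_lt_top_of_bound hΩ hfin (A := ‖lam⁻¹‖ * A)
    fun x => ?_).ne, ne_top_of_le_ne_top hmod (hM.modular_mono hΩ hf fun x => rfl)⟩
  rw [norm_smul]
  exact mul_le_mul_of_nonneg_left (hg x) (norm_nonneg _)

/-- The oscillation of `a * θ * u`, for a Lipschitz cutoff `θ`. At distances up to `1` and for
`γ ≤ 1`, the Lipschitz bound for `θ` is stronger than a Hölder bound. -/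
theorem abs_cutoff_mul_sub_le {θ u : Rn n → ℝ} {a b K L γ : ℝ} (ha : 0 ≤ a) (hγ : γ ≤ 1)
    (hθ0 : ∀ x, 0 ≤ θ x) (hθ1 : ∀ x, θ x ≤ 1) (hθL : ∀ x y, |θ x - θ y| ≤ L * ‖x - y‖)
    (hb : ∀ x, |u x| ≤ b) (hosc : ∀ x y, ‖x - y‖ ≤ 1 → |u x - u y| ≤ K * ‖x - y‖ ^ γ)
    (hL : 0 ≤ L) (x y : Rn n) (hxy : ‖x - y‖ ≤ 1) :
    |a * θ x * u x - a * θ y * u y| ≤ a * (K + b * L) * ‖x - y‖ ^ γ := by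
  have hb0 : 0 ≤ b := (abs_nonneg _).trans (hb 0)
  have hpow : ‖x - y‖ ≤ ‖x - y‖ ^ γ := by
    rcases (norm_nonneg (x - y)).eq_or_lt with h | h
    · rw [← h]; exact Real.rpow_nonneg le_rfl _
    · simpa using Real.rpow_le_rpow_of_exponent_ge h hxy hγ
  have e : a * θ x * u x - a * θ y * u y = a * (θ x * (u x - u y) + (θ x - θ y) * u y) := by ring
  rw [e, abs_mul, abs_of_nonneg ha, mul_assoc]
  refine mul_le_mul_of_nonneg_left ?_ ha
  refine (abs_add_le _ _).trans ?_
  rw [abs_mul, abs_mul, abs_of_nonneg (hθ0 x)]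
  have h1 : θ x * |u x - u y| ≤ 1 * (K * ‖x - y‖ ^ γ) :=
    mul_le_mul (hθ1 x) (hosc x y hxy) (abs_nonneg _) zero_le_one
  have h2 : |θ x - θ y| * |u y| ≤ (L * ‖x - y‖ ^ γ) * b :=
    mul_le_mul ((hθL x y).trans (mul_le_mul_of_nonneg_left hpow hL)) (hb y) (abs_nonneg _)
      (by positivity)
  linarith

/-- Bounded functions with controlled oscillation are approximable, at a scale which depends only
on the balance constant and on a scale at which the gradient has finite modular. The function is
cut by the partition of unity and each piece is divided into `m` equal parts, with `m` so large that
the oscillation of every part is small enough for `approximable_of_push`. -/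
theorem IsBoundedLipschitzDomain.exists_approximable (hΩ : IsBoundedLipschitzDomain Ω) :
    ∃ N : ℕ, ∀ M : Rn n → Rn n → ℝ, RegularIntegrand Ω M → ∀ γ C A : ℝ, 0 ≤ γ → γ ≤ 1 →
      Balanced Ω M γ C A → ∀ (u : Rn n → ℝ) (v : Rn n → Rn n), StrongGrad u v →
      (∀ x, x ∉ Ω → u x = 0) → (∀ x, x ∉ Ω → v x = 0) → ∀ b : ℝ, (∀ x, |u x| ≤ b) →
      ∀ K : ℝ, 0 ≤ K → (∀ x y, ‖x - y‖ ≤ 1 → |u x - u y| ≤ K * ‖x - y‖ ^ γ) →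
      ∀ lam : ℝ, 0 < lam → modular Ω M (fun x => lam⁻¹ • v x) ≠ ⊤ →
      Approximable Ω M (12 * C * lam) (N * ENNReal.ofReal b) u v := by
  obtain ⟨ι, hι, θ, hθ, hsum, hsum1⟩ := hΩ.exists_partition
  refine ⟨Fintype.card ι, fun M hM γ C A hγ0 hγ1 hB u v huv hu0 hv0 b hb K hK hosc lam hlam hmod =>
    ?_⟩
  have hfin : volume Ω ≠ ⊤ := hΩ.isBounded.measure_lt_top.ne
  have hopen := hΩ.isOpen
  have hC : 1 ≤ C := hB.1
  have hb0 : 0 ≤ b := (abs_nonneg _).trans (hb 0)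
  choose ρ hρ t₀ ht₀ hpush using fun i => (hθ i).push
  -- Lipschitz bounds for the cutoff functions
  have hLex : ∀ i, ∃ L : ℝ, 1 ≤ L ∧ ∀ x, ‖∇ (θ i) x‖ ≤ L := fun i => by
    obtain ⟨L, hL⟩ := (hasCompactSupport_gradient
      (hθ i).hasCompactSupport).exists_bound_of_continuous (continuous_gradient (hθ i).contDiff)
    exact ⟨max L 1, le_max_right _ _, fun x => (hL x).trans (le_max_left _ _)⟩
  choose L hL1 hL using hLex
  have hLip : ∀ i x y, |θ i x - θ i y| ≤ L i * ‖x - y‖ := fun i x y =>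
    Convex.norm_image_sub_le_of_norm_fderiv_le (s := univ) (f := θ i) (𝕜 := ℝ)
      (fun z _ => ((hθ i).contDiff.differentiable (by simp)) z)
      (fun z _ => by rw [← norm_gradient]; exact hL i z) convex_univ trivial trivial
  have habs : ∀ i x, |θ i x| ≤ 1 := fun i x => by
    rw [abs_of_nonneg ((hθ i).nonneg x)]; exact (hθ i).le_one x
  have hgrad_bound : ∀ i x, ‖u x • ∇ (θ i) x‖ ≤ b * L i := fun i x => by
    rw [norm_smul]
    exact mul_le_mul (hb x) (hL i x) (norm_nonneg _) hb0
  have hgm : ∀ i, AEStronglyMeasurable (fun x => u x • ∇ (θ i) x) (volume.restrict Ω) := fun i =>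
    huv.integrable.1.restrict.smul (continuous_gradient (hθ i).contDiff).aestronglyMeasurable
  -- the number of equal parts
  obtain ⟨m, hm0, hm⟩ : ∃ m : ℕ, 0 < m ∧ ∀ i, (m : ℝ)⁻¹ * (K + b * L i) * ∫ t, ‖∇ (ρ i) t‖ ≤
      (2 * C * lam) / 2 := by
    set Z := ∑ i, (K + b * L i) * ∫ t, ‖∇ (ρ i) t‖ with hZ
    have hnn : ∀ i, 0 ≤ (K + b * L i) * ∫ t, ‖∇ (ρ i) t‖ := fun i =>
      mul_nonneg (add_nonneg hK (mul_nonneg hb0 (by linarith [hL1 i])))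
        (integral_nonneg fun t => norm_nonneg _)
    obtain ⟨m, hm⟩ := exists_nat_gt (Z / (C * lam))
    have hCl : 0 < C * lam := by positivity
    have hm0 : (0 : ℝ) < m := lt_of_le_of_lt
      (div_nonneg (Finset.sum_nonneg fun i _ => hnn i) hCl.le) hm
    refine ⟨m, by exact_mod_cast hm0, fun i => ?_⟩
    rw [div_lt_iff₀ hCl] at hm
    have h1 : (K + b * L i) * ∫ t, ‖∇ (ρ i) t‖ ≤ Z :=
      Finset.single_le_sum (fun i _ => hnn i) (Finset.mem_univ i)
    rw [mul_assoc, inv_mul_le_iff₀ hm0]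
    linarith
  have hmR : (0 : ℝ) < m := by exact_mod_cast hm0
  have hm1 : (1 : ℝ) ≤ m := by exact_mod_cast hm0
  have hminv : (m : ℝ)⁻¹ ≤ 1 := inv_le_one_of_one_le₀ hm1
  have hminv0 : 0 ≤ (m : ℝ)⁻¹ := by positivity
  set U : ι × Fin m → Rn n → ℝ := fun p x => (m : ℝ)⁻¹ * θ p.1 x * u x with hU
  set V : ι × Fin m → Rn n → Rn n := fun p x =>
    ((m : ℝ)⁻¹ * θ p.1 x) • v x + (m : ℝ)⁻¹ • (u x • ∇ (θ p.1) x) with hV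
  have hgrad : ∀ p, StrongGrad (U p) (V p) := fun p => by
    have h1 := (huv.mul (hθ p.1).contDiff (A := L p.1)
      (fun x => (habs _ x).trans (hL1 _)) (hL p.1)).const_mul (m : ℝ)⁻¹
    refine cast ?_ h1
    congr 1
    · ext1 x; simp only [hU]; ring
    · ext1 x; simp only [hV, smul_add, smul_smul]
  have hpart : ∀ p, Approximable Ω M (2 * (2 * C * lam)) (ENNReal.ofReal (b / m)) (U p) (V p) := by
    intro p
    refine approximable_of_push hopen hfin hM hγ0 hB (hρ p.1)
      (hΩ.isBounded.isCompact_closure.inter_right (isClosed_tsupport (θ p.1))) (hgrad p)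
      (fun x hx => ?_) (fun x hx => ?_) (ht₀ p.1) (hpush p.1) (fun x => ?_)
      (K := (m : ℝ)⁻¹ * (K + b * L p.1)) ?_ (fun x y hxy => ?_) (by positivity) (hm p.1) ?_
    · refine ⟨subset_closure ?_, subset_tsupport _ fun h0 => hx ?_⟩
      · by_contra hxΩ
        exact hx (by simp [hU, hu0 x hxΩ])
      · simp [hU, h0]
    · simp [hV, hv0 x hx, hu0 x hx]
    · simp only [hU]
      rw [abs_mul, abs_mul, abs_of_nonneg hminv0, div_eq_inv_mul, mul_assoc]
      refine mul_le_mul_of_nonneg_left ?_ hminv0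
      nlinarith [habs p.1 x, hb x, abs_nonneg (θ p.1 x), abs_nonneg (u x)]
    · exact mul_nonneg hminv0 (add_nonneg hK (mul_nonneg hb0 (by linarith [hL1 p.1])))
    · exact abs_cutoff_mul_sub_le hminv0 hγ1 (hθ p.1).nonneg (hθ p.1).le_one (hLip p.1) hb hosc
        (by linarith [hL1 p.1]) x y hxy
    · have h1 := hM.modular_smul_add_ne_top hopen hfin (lam := lam)
        (f := fun x => (m : ℝ)⁻¹ * θ p.1 x) (g := fun x => (m : ℝ)⁻¹ • (u x • ∇ (θ p.1) x))
        (A := b * L p.1) (fun x => ?_) ((hgm p.1).const_smul (m : ℝ)⁻¹).aemeasurable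
        (fun x => ?_) hmod
      · have e : (fun x => C • (2 * C * lam)⁻¹ • V p x) = fun x => (2 * lam)⁻¹ • V p x := by
          ext1 x
          rw [smul_smul]
          congr 1
          field_simp
        rw [e]
        exact h1
      · rw [norm_smul, Real.norm_of_nonneg hminv0]
        have := hgrad_bound p.1 x
        have h2 := norm_nonneg (u x • ∇ (θ p.1) x)
        nlinarith
      · rw [abs_mul, abs_of_nonneg hminv0]
        have := habs p.1 x
        have h2 := abs_nonneg (θ p.1 x)
        nlinarith
  -- partial sums of the gradients have finite modular at a scale independent of `m`, since the
  -- coefficients of `v` add up to at most one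
  have hfinal := Approximable.sum hopen hfin hM (Finset.univ : Finset (ι × Fin m)) hpart
    (fun p => (hgrad p).integrable.1.restrict) (fun p => (hgrad p).integrable_grad.1.restrict)
    (fun t => by
      have hfle : ∀ x, |∑ p ∈ t, (m : ℝ)⁻¹ * θ p.1 x| ≤ 1 := fun x => by
        have hnn : ∀ p : ι × Fin m, 0 ≤ (m : ℝ)⁻¹ * θ p.1 x := fun p =>
          mul_nonneg hminv0 ((hθ p.1).nonneg x)
        rw [abs_of_nonneg (Finset.sum_nonneg fun p _ => hnn p)]
        refine (Finset.sum_le_sum_of_subset_of_nonneg (Finset.subset_univ t)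
          fun p _ _ => hnn p).trans ?_
        rw [Fintype.sum_prod_type]
        simp only [Finset.sum_const, Finset.card_univ, Fintype.card_fin, nsmul_eq_mul]
        refine le_trans (le_of_eq (Finset.sum_congr rfl fun i _ => ?_)) (hsum x)
        field_simp
      have h1 := hM.modular_smul_add_ne_top hopen hfin (lam := lam)
        (f := fun x => ∑ p ∈ t, (m : ℝ)⁻¹ * θ p.1 x)
        (g := fun x => ∑ p ∈ t, (m : ℝ)⁻¹ • (u x • ∇ (θ p.1) x))
        (A := ∑ p ∈ t, (m : ℝ)⁻¹ * (b * L p.1)) (fun x => (norm_sum_le _ _).trans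
          (Finset.sum_le_sum fun p _ => ?_))
        (Finset.aestronglyMeasurable_fun_sum t fun p _ =>
          (hgm p.1).const_smul (m : ℝ)⁻¹).aemeasurable hfle hmod
      · refine ne_top_of_le_ne_top h1 (hM.modular_mono hopen (f := fun _ => (2 * C)⁻¹)
          (fun _ => ?_) fun x => ?_)
        · rw [abs_of_nonneg (by positivity)]
          exact inv_le_one_of_one_le₀ (by linarith)
        · simp only [hV, Finset.sum_add_distrib, Finset.sum_smul]
          rw [smul_smul]
          congr 1
          field_simp
      · rw [norm_smul, Real.norm_of_nonneg hminv0]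
        exact mul_le_mul_of_nonneg_left (hgrad_bound p.1 x) hminv0)
  -- the parts add up to the given function
  have hsumU : (fun x => ∑ p : ι × Fin m, U p x) = u := by
    ext1 x
    rw [Fintype.sum_prod_type]
    simp only [hU, Finset.sum_const, Finset.card_univ, Fintype.card_fin, nsmul_eq_mul]
    have : ∀ i, (m : ℝ) * ((m : ℝ)⁻¹ * θ i x * u x) = θ i x * u x := fun i => by field_simp
    simp_rw [this, ← Finset.sum_mul]
    by_cases hx : x ∈ Ω
    · rw [hsum1 x (subset_closure hx), one_mul]
    · rw [hu0 x hx, mul_zero]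
  have hsumV : ∀ x ∈ Ω, ∑ p : ι × Fin m, V p x = v x := by
    intro x hx
    -- the gradients of the cutoff functions add up to zero in `Ω`
    have hz : ∑ i, ∇ (θ i) x = 0 := by
      have h1 : HasFDerivAt (fun y => ∑ i, θ i y) (∑ i, fderiv ℝ (θ i) x) x :=
        HasFDerivAt.fun_sum fun i _ =>
          (((hθ i).contDiff.differentiable (by simp)) x).hasFDerivAt
      have h2 : (fun y => ∑ i, θ i y) =ᶠ[𝓝 x] fun _ => (1 : ℝ) := by
        filter_upwards [hopen.mem_nhds hx] with y hy using hsum1 y (subset_closure hy)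
      have h3 := (h1.congr_of_eventuallyEq h2.symm).unique (hasFDerivAt_const (1 : ℝ) x)
      simp only [gradient, ← map_sum, h3, map_zero]
    rw [Fintype.sum_prod_type]
    simp only [hV, Finset.sum_const, Finset.card_univ, Fintype.card_fin]
    simp only [← Nat.cast_smul_eq_nsmul ℝ, smul_add, smul_smul]
    have e1 : ∀ i, (m : ℝ) * ((m : ℝ)⁻¹ * θ i x) = θ i x := fun i => by field_simp
    have e2 : (m : ℝ) * ((m : ℝ)⁻¹ * u x) = u x := by field_simp
    simp_rw [e1, e2]
    rw [Finset.sum_add_distrib, ← Finset.sum_smul, ← Finset.smul_sum, hz,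
      hsum1 x (subset_closure hx), one_smul, smul_zero, add_zero]
  have hB' : ∑ _p : ι × Fin m, ENNReal.ofReal (b / m) =
      (Fintype.card ι : ℝ≥0∞) * ENNReal.ofReal b := by
    rw [Finset.sum_const, Finset.card_univ, Fintype.card_prod, Fintype.card_fin, nsmul_eq_mul,
      Nat.cast_mul, mul_assoc, ← ENNReal.ofReal_natCast m, ← ENNReal.ofReal_mul hmR.le,
      mul_div_cancel₀ _ hmR.ne']
  rw [hsumU, hB'] at hfinal
  have hscale : 3 * (2 * (2 * C * lam)) = 12 * C * lam := by ring
  rw [hscale] at hfinal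
  refine hfinal.congr (ae_eq_refl _) ?_
  filter_upwards [ae_restrict_mem hopen.measurableSet] with x hx using hsumV x hx

end MusielakOrlicz

namespace MusielakOrlicz

variable {n : ℕ} {Ω : Set (Rn n)}

/-! ### Zero extensions of Hölder continuous functions -/

/-- Below the graph that bounds a Lipschitz domain there are balls which do not meet the domain. -/
theorem IsBoundedLipschitzDomain.exists_exterior_ball (hΩ : IsBoundedLipschitzDomain Ω) {a : Rn n}
    (ha : a ∈ frontier Ω) {r : ℝ} (hr : 0 < r) :
    ∃ x ∈ Metric.ball a r, ∃ η, 0 < η ∧ ∀ y ∈ Metric.ball x η, y ∉ Ω := by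
  obtain ⟨R, hR, e, he, K, g, hg, hΩR⟩ := hΩ.lipschitz_boundary a ha
  have haΩ : a ∉ Ω := by
    have := ha.2
    rwa [hΩ.isOpen.interior_eq] at this
  have hag : inner ℝ e a ≤ g (a - inner ℝ e a • e) := by
    by_contra! hlt
    have : a ∈ Ω ∩ Metric.ball a R := by
      rw [hΩR]; exact ⟨Metric.mem_ball_self hR, hlt⟩
    exact haΩ this.1
  have hgc := hg.continuous
  set s := min r R / 2 with hs
  have hs0 : 0 < s := by positivity
  have hsr : s < r := by have := min_le_left r R; linarith
  have hsR : s < R := by have := min_le_right r R; linarith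
  have hee : inner ℝ e e = (1 : ℝ) := by rw [real_inner_self_eq_norm_sq, he]; norm_num
  have hdist : dist (a - s • e) a = s := by
    simp [norm_smul, he, abs_of_pos hs0]
  have hopen : IsOpen (Metric.ball a R ∩
      {y : Rn n | inner ℝ e y < g (y - inner ℝ e y • e)}) :=
    Metric.isOpen_ball.inter (isOpen_lt (by fun_prop) (by fun_prop))
  have hmem : a - s • e ∈ Metric.ball a R ∩
      {y : Rn n | inner ℝ e y < g (y - inner ℝ e y • e)} := by
    refine ⟨by rw [Metric.mem_ball, hdist]; exact hsR, ?_⟩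
    have e1 : inner ℝ e (a - s • e) = inner ℝ e a - s := by
      rw [inner_sub_right, inner_smul_right, hee, mul_one]
    have e2 : a - s • e - (inner ℝ e a - s) • e = a - inner ℝ e a • e := by module
    change inner ℝ e (a - s • e) < g (a - s • e - inner ℝ e (a - s • e) • e)
    rw [e1, e2]
    linarith
  obtain ⟨η, hη, hηsub⟩ := Metric.isOpen_iff.1 hopen _ hmem
  refine ⟨a - s • e, by rw [Metric.mem_ball, hdist]; exact hsr, η, hη, fun y hy hyΩ => ?_⟩
  obtain ⟨hyR, hyg⟩ := hηsub hy
  have : y ∈ Ω ∩ Metric.ball a R := ⟨hyΩ, hyR⟩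
  rw [hΩR] at this
  exact lt_asymm this.2 hyg

/-- A function with a strong gradient which vanishes outside `Ω` cannot stay away from zero in the
part of `Ω` near a boundary point: composed with a cutoff it would become the indicator function of
that part, with vanishing gradient, although it takes two values. -/
theorem StrongGrad.exists_abs_le_near_frontier (hΩ : IsBoundedLipschitzDomain Ω) {u : Rn n → ℝ}
    {v : Rn n → Rn n} (h : StrongGrad u v) (hu0 : ∀ x, x ∉ Ω → u x = 0) {a : Rn n}
    (ha : a ∈ frontier Ω) {s r : ℝ} (hs : 0 < s) (hr : 0 < r) :
    ∃ y ∈ Ω ∩ Metric.ball a r, |u y| ≤ s := by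
  by_contra! hcon
  -- the cutoff `c` vanishes near `0` and equals one where `|t| ≥ s / 2`
  let f : ContDiffBump (0 : ℝ) := ⟨s / 4, s / 2, by positivity, by linarith⟩
  set c : ℝ → ℝ := fun t => 1 - f t with hc
  have hcs : ContDiff ℝ ∞ c := contDiff_const.sub f.contDiff
  have hc_near : ∀ t, |t| < s / 4 → c t = 0 := fun t ht => by
    simp only [hc]
    rw [f.one_of_mem_closedBall (by simpa using ht.le), sub_self]
  have hc_far : ∀ t, s / 2 ≤ |t| → c t = 1 := fun t ht => by
    simp only [hc]
    rw [f.zero_of_le_dist (by simpa using ht), sub_zero]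
  have hd : ∀ t, deriv c t = -deriv f t := fun t => by
    simp only [hc]
    rw [deriv_const_sub]
  have hfd : Continuous (deriv f) := (f.contDiff (n := 1)).continuous_deriv le_rfl
  obtain ⟨A, hA⟩ := (f.hasCompactSupport.deriv).exists_bound_of_continuous hfd
  have hcomp := h.comp hcs (hc_near 0 (by simpa using by positivity)) (A := A) fun t => by
    rw [hd, abs_neg]; exact hA t
  -- the gradient of the composition vanishes near `a`
  have hgrad0 : ∀ y ∈ Metric.ball a r, deriv c (u y) = 0 := fun y hy => by
    by_cases hyΩ : y ∈ Ω
    · have h1 : c =ᶠ[𝓝 (u y)] fun _ => 1 := by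
        have := (continuous_abs.tendsto (u y)).eventually_const_lt (hcon y ⟨hyΩ, hy⟩)
        filter_upwards [this] with t ht using hc_far t (by linarith)
      rw [h1.deriv_eq, deriv_const]
    · have h1 : c =ᶠ[𝓝 (u y)] fun _ => 0 := by
        rw [hu0 y hyΩ]
        have := (continuous_abs.tendsto (0 : ℝ)).eventually_lt_const
          (show |(0 : ℝ)| < s / 4 by simpa using by positivity)
        filter_upwards [this] with t ht using hc_near t ht
      rw [h1.deriv_eq, deriv_const]
  have hr2 : 0 < r / 2 := by positivity
  obtain ⟨x₂, hx₂, η₂, hη₂, hout⟩ := hΩ.exists_exterior_ball ha hr2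
  obtain ⟨x₁, hx₁, hx₁Ω⟩ := mem_closure_iff.1 ha.1 _ Metric.isOpen_ball (Metric.mem_ball_self hr2)
  obtain ⟨η₁, hη₁, hin⟩ := Metric.isOpen_iff.1 hΩ.isOpen _ hx₁Ω
  obtain ⟨ρ, hρ, -⟩ := exists_isMollifier (0 : Rn n) one_pos (by simp)
  set δ := min (r / 2) (min η₁ η₂) with hδ
  have hδ0 : 0 < δ := by positivity
  have hk : IsMollifier (dilate ρ δ) δ := by simpa using hρ.dilate hδ0
  set k := dilate ρ δ
  -- mollified, the composition is constant near `a`, but it equals one at the interior point `x₁`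
  -- and zero at the exterior point `x₂`
  have hconst : mollify k (fun x => c (u x)) x₁ = mollify k (fun x => c (u x)) x₂ := by
    have hsm : ContDiff ℝ ∞ (mollify k fun x => c (u x)) :=
      contDiff_mollify hk.contDiff hk.hasCompactSupport hcomp.integrable.locallyIntegrable
    have := Convex.norm_image_sub_le_of_norm_fderiv_le (s := Metric.ball a (r / 2)) (𝕜 := ℝ)
      (C := 0) (f := mollify k fun x => c (u x))
      (fun z _ => (hsm.differentiable (by simp)) z) (fun z hz => ?_) (convex_ball a (r / 2)) hx₂ hx₁
    · simpa [sub_eq_zero] using this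
    · rw [← norm_gradient, hcomp.gradient_mollify hk, mollify]
      refine le_of_eq ?_
      rw [norm_eq_zero]
      refine integral_eq_zero_of_ae (Eventually.of_forall fun t => ?_)
      by_cases ht : ‖t‖ < δ
      · have : z - t ∈ Metric.ball a r := by
          rw [mem_ball_iff_norm] at hz ⊢
          have e1 : z - t - a = (z - a) - t := by abel
          rw [e1]
          refine (norm_sub_le _ _).trans_lt ?_
          have := min_le_left (r / 2) (min η₁ η₂)
          linarith
        simp [hgrad0 _ this]
      · simp [hk.eq_zero_of_le_norm (not_lt.1 ht)]
  have h1 : mollify k (fun x => c (u x)) x₁ = 1 := by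
    rw [← hk.integral_eq_one, mollify]
    refine integral_congr_ae (Eventually.of_forall fun t => ?_)
    by_cases ht : ‖t‖ < δ
    · have htΩ : x₁ - t ∈ Ω := hin (by
        rw [mem_ball_iff_norm, sub_sub_cancel_left, norm_neg]
        exact ht.trans_le ((min_le_right _ _).trans (min_le_left _ _)))
      have htb : x₁ - t ∈ Metric.ball a r := by
        rw [mem_ball_iff_norm] at hx₁ ⊢
        have e1 : x₁ - t - a = (x₁ - a) - t := by abel
        rw [e1]
        refine (norm_sub_le _ _).trans_lt ?_
        have := min_le_left (r / 2) (min η₁ η₂)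
        linarith
      have := hcon _ ⟨htΩ, htb⟩
      simp [hc_far (u (x₁ - t)) (by linarith)]
    · simp [hk.eq_zero_of_le_norm (not_lt.1 ht)]
  have h2 : mollify k (fun x => c (u x)) x₂ = 0 := by
    refine integral_eq_zero_of_ae (Eventually.of_forall fun t => ?_)
    by_cases ht : ‖t‖ < δ
    · have htΩ : x₂ - t ∉ Ω := hout _ (by
        rw [mem_ball_iff_norm, sub_sub_cancel_left, norm_neg]
        exact ht.trans_le ((min_le_right _ _).trans (min_le_right _ _)))
      simp [hu0 _ htΩ, hc_near 0 (by simpa using by positivity)]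
    · simp [hk.eq_zero_of_le_norm (not_lt.1 ht)]
  rw [h1, h2] at hconst
  exact one_ne_zero hconst

theorem exists_frontier_between (hΩ : IsOpen Ω) {x y : Rn n} (hx : x ∈ Ω) (hy : y ∉ Ω) :
    ∃ z ∈ frontier Ω, ‖x - z‖ ≤ ‖x - y‖ := by
  by_contra! hcon
  have hno : ∀ z ∈ segment ℝ x y, z ∉ frontier Ω := fun z hz hzf => by
    obtain ⟨a, b, ha, hb, hab, rfl⟩ := hz
    refine (hcon _ hzf).not_ge ?_
    have e : x - (a • x + b • y) = b • (x - y) := by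
      have : a = 1 - b := by linarith
      rw [this]; module
    rw [e, norm_smul, Real.norm_of_nonneg hb]
    nlinarith [norm_nonneg (x - y)]
  have hsub : segment ℝ x y ⊆ Ω ∪ (closure Ω)ᶜ := fun z hz => by
    by_contra hz'
    simp only [mem_union, mem_compl_iff, not_or, not_not] at hz'
    exact hno z hz ⟨hz'.2, by rw [hΩ.interior_eq]; exact hz'.1⟩
  have hycl : y ∈ (closure Ω)ᶜ :=
    (hsub (right_mem_segment ℝ x y)).resolve_left hy
  obtain ⟨z, -, hz1, hz2⟩ := (convex_segment x y).isPreconnected Ω (closure Ω)ᶜ hΩ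
    isClosed_closure.isOpen_compl hsub ⟨x, left_mem_segment ℝ x y, hx⟩
    ⟨y, right_mem_segment ℝ x y, hycl⟩
  exact hz2 (subset_closure hz1)

/-- The extension by zero of a Hölder continuous function with a strong gradient is Hölder
continuous, with the same constant. -/
theorem StrongGrad.holder_of_holderOn (hΩ : IsBoundedLipschitzDomain Ω) {u : Rn n → ℝ}
    {v : Rn n → Rn n} (h : StrongGrad u v) (hu0 : ∀ x, x ∉ Ω → u x = 0) {K γ : ℝ} (hK : 0 ≤ K)
    (hγ : 0 < γ) (hosc : ∀ x ∈ Ω, ∀ y ∈ Ω, |u x - u y| ≤ K * ‖x - y‖ ^ γ) (x y : Rn n) :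
    |u x - u y| ≤ K * ‖x - y‖ ^ γ := by
  have hfr : ∀ x ∈ Ω, ∀ a ∈ frontier Ω, |u x| ≤ K * ‖x - a‖ ^ γ := by
    intro x hx a ha
    by_contra! hlt
    obtain ⟨s, hs1, hs2⟩ := exists_between hlt
    have hcont : Continuous fun y => K * ‖x - y‖ ^ γ :=
      continuous_const.mul ((continuous_const.sub continuous_id).norm.rpow_const
        fun _ => Or.inr hγ.le)
    obtain ⟨r, hr, hr'⟩ := Metric.eventually_nhds_iff.1
      ((hcont.tendsto a).eventually_lt_const hs1)
    obtain ⟨y, ⟨hyΩ, hyr⟩, hy⟩ := h.exists_abs_le_near_frontier hΩ hu0 ha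
      (s := (|u x| - s) / 2) (by linarith) hr
    have h1 := hosc x hx y hyΩ
    have h2 := hr' hyr
    have h3 := abs_sub_abs_le_abs_sub (u x) (u y)
    linarith
  have hmix : ∀ x ∈ Ω, ∀ y, y ∉ Ω → |u x - u y| ≤ K * ‖x - y‖ ^ γ := by
    intro x hx y hy
    obtain ⟨z, hz, hzle⟩ := exists_frontier_between hΩ.isOpen hx hy
    rw [hu0 y hy, sub_zero]
    refine (hfr x hx z hz).trans ?_
    gcongr
  by_cases hx : x ∈ Ω <;> by_cases hy : y ∈ Ω
  · exact hosc x hx y hy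
  · exact hmix x hx y hy
  · rw [abs_sub_comm, norm_sub_rev]
    exact hmix y hy x hx
  · rw [hu0 x hx, hu0 y hy, sub_self, abs_zero]
    positivity

end MusielakOrlicz

namespace MusielakOrlicz

variable {n : ℕ} {Ω : Set (Rn n)} {M : Rn n → Rn n → ℝ}

/-! ### Membership in the Musielak–Orlicz space -/

theorem RegularIntegrand.modular_ne_top_of_le (hM : RegularIntegrand Ω M) (hΩ : IsOpen Ω)
    {v : Rn n → Rn n} {l l' : ℝ} (hl : 0 < l) (hll' : l ≤ l')
    (h : modular Ω M (fun x => l⁻¹ • v x) ≠ ⊤) : modular Ω M (fun x => l'⁻¹ • v x) ≠ ⊤ := by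
  have hl' : 0 < l' := hl.trans_le hll'
  refine ne_top_of_le_ne_top h (hM.modular_mono hΩ (f := fun _ => l'⁻¹ * l) (fun _ => ?_)
    fun x => ?_)
  · rw [abs_of_nonneg (by positivity), inv_mul_le_iff₀ hl', mul_one]
    exact hll'
  · rw [smul_smul, mul_assoc, mul_inv_cancel₀ hl.ne', mul_one]

/-- Every element of the linear span of the Orlicz class has finite modular at some scale, because
the functions with this property form a linear space. -/
theorem exists_modular_ne_top_of_mem_LM (hM : RegularIntegrand Ω M) (hΩ : IsOpen Ω)
    {G : Rn n → Rn n} (hG : G ∈ LM Ω M) :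
    ∃ lam : ℝ, 0 < lam ∧ modular Ω M (fun x => lam⁻¹ • G x) ≠ ⊤ := by
  suffices h : AEMeasurable G (volume.restrict Ω) ∧
      ∃ lam : ℝ, 0 < lam ∧ modular Ω M (fun x => lam⁻¹ • G x) ≠ ⊤ from h.2
  induction hG using Submodule.span_induction with
  | mem ξ hξ => exact ⟨hξ.1, 1, one_pos, by simpa using hξ.2.ne⟩
  | zero =>
    refine ⟨aemeasurable_const, 1, one_pos, ?_⟩
    rw [modular, setLIntegral_congr_fun (g := fun _ => 0) hΩ.measurableSet fun x hx => by
      simp [hM.map_zero x hx]]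
    simp
  | add ξ η _ _ h₁ h₂ =>
    obtain ⟨hm₁, l₁, hl₁, hf₁⟩ := h₁
    obtain ⟨hm₂, l₂, hl₂, hf₂⟩ := h₂
    refine ⟨hm₁.add hm₂, 2 * max l₁ l₂, by positivity, ?_⟩
    have e : (fun x => (2 * max l₁ l₂)⁻¹ • (ξ + η) x) =
        fun x => (2⁻¹ : ℝ) • ((max l₁ l₂)⁻¹ • ξ x + (max l₁ l₂)⁻¹ • η x) := by
      ext1 x
      rw [Pi.add_apply, mul_inv]
      module
    have hm : AEMeasurable (fun x => (max l₁ l₂)⁻¹ • ξ x) (volume.restrict Ω) :=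
      hm₁.const_smul (max l₁ l₂)⁻¹
    rw [e]
    exact ne_top_of_le_ne_top (ENNReal.add_ne_top.2
      ⟨hM.modular_ne_top_of_le hΩ hl₁ (le_max_left _ _) hf₁,
        hM.modular_ne_top_of_le hΩ hl₂ (le_max_right _ _) hf₂⟩)
      (hM.modular_half_add_le hΩ hm)
  | smul a ξ _ h =>
    obtain ⟨hm, l, hl, hf⟩ := h
    refine ⟨hm.const_smul a, (|a| + 1) * l, by positivity, ?_⟩
    refine ne_top_of_le_ne_top hf (hM.modular_mono hΩ (f := fun _ => (|a| + 1)⁻¹ * a) (fun _ => ?_)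
      fun x => ?_)
    · rw [abs_mul, abs_of_nonneg (by positivity), inv_mul_le_iff₀ (by positivity)]
      linarith
    · rw [Pi.smul_apply, mul_inv, smul_smul, smul_smul]
      congr 1
      ring

/-! ### Truncation -/

/-- The truncation `s ↦ arctan (t s) / t`, which is bounded and converges to the identity as
`t → 0`. -/
noncomputable def arctanTrunc (t s : ℝ) : ℝ := t⁻¹ * Real.arctan (t * s)

theorem contDiff_arctanTrunc (t : ℝ) : ContDiff ℝ ∞ (arctanTrunc t) :=
  contDiff_const.mul (Real.contDiff_arctan.comp (contDiff_const.mul contDiff_id))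

theorem deriv_arctanTrunc {t : ℝ} (ht : 0 < t) (s : ℝ) :
    deriv (arctanTrunc t) s = 1 / (1 + (t * s) ^ 2) := by
  have h := ((Real.hasDerivAt_arctan (t * s)).comp s ((hasDerivAt_id s).const_mul t)).const_mul t⁻¹
  have h2 : deriv (arctanTrunc t) s = t⁻¹ * (1 / (1 + (t * s) ^ 2) * (t * 1)) := h.deriv
  rw [h2]
  field_simp

theorem abs_arctanTrunc_le {t : ℝ} (ht : 0 < t) (s : ℝ) :
    |arctanTrunc t s| ≤ t⁻¹ * (Real.pi / 2) := by
  rw [arctanTrunc, abs_mul, abs_of_pos (inv_pos.2 ht)]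
  have h := abs_lt.2 ⟨Real.neg_pi_div_two_lt_arctan (t * s), Real.arctan_lt_pi_div_two (t * s)⟩
  exact mul_le_mul_of_nonneg_left h.le (inv_pos.2 ht).le

theorem deriv_arctanTrunc_mem {t : ℝ} (ht : 0 < t) (s : ℝ) :
    deriv (arctanTrunc t) s ∈ Icc (0 : ℝ) 1 := by
  rw [deriv_arctanTrunc ht]
  refine ⟨by positivity, ?_⟩
  rw [div_le_one (by positivity)]
  nlinarith [sq_nonneg (t * s)]

theorem abs_arctanTrunc_le_abs {t : ℝ} (ht : 0 < t) (s : ℝ) : |arctanTrunc t s| ≤ |s| := by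
  have := Convex.norm_image_sub_le_of_norm_deriv_le (s := univ) (f := arctanTrunc t) (C := 1)
    (x := 0) (y := s) (fun x _ => ((contDiff_arctanTrunc t).differentiable (by simp)) x)
    (fun x _ => by
      have := deriv_arctanTrunc_mem ht x
      rw [Real.norm_of_nonneg this.1]; exact this.2) convex_univ trivial trivial
  simpa [arctanTrunc] using this

theorem tendsto_arctanTrunc (s : ℝ) :
    Tendsto (fun j : ℕ => arctanTrunc ((j : ℝ) + 1)⁻¹ s) atTop (𝓝 s) := by
  have h : HasDerivAt (fun t : ℝ => Real.arctan (t * s)) s 0 := by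
    have := (Real.hasDerivAt_arctan (0 * s)).comp 0 ((hasDerivAt_id (0 : ℝ)).mul_const s)
    simpa [Function.comp_def] using this
  have h2 := h.tendsto_slope_zero
  have h3 : Tendsto (fun j : ℕ => ((j : ℝ) + 1)⁻¹) atTop (𝓝[≠] 0) := by
    refine tendsto_nhdsWithin_iff.2 ⟨?_, Eventually.of_forall fun j => ?_⟩
    · simpa using tendsto_one_div_add_atTop_nhds_zero_nat (𝕜 := ℝ)
    · exact (inv_pos.2 (by positivity : (0 : ℝ) < (j : ℝ) + 1)).ne'
  refine (h2.comp h3).congr fun j => ?_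
  simp [arctanTrunc]

theorem tendsto_deriv_arctanTrunc (s : ℝ) :
    Tendsto (fun j : ℕ => deriv (arctanTrunc ((j : ℝ) + 1)⁻¹) s) atTop (𝓝 1) := by
  have h3 : Tendsto (fun j : ℕ => ((j : ℝ) + 1)⁻¹) atTop (𝓝 0) := by
    simpa using tendsto_one_div_add_atTop_nhds_zero_nat (𝕜 := ℝ)
  have h4 : Tendsto (fun j : ℕ => 1 / (1 + (((j : ℝ) + 1)⁻¹ * s) ^ 2)) atTop
      (𝓝 (1 / (1 + (0 * s) ^ 2))) :=
    tendsto_const_nhds.div (((h3.mul_const s).pow 2).const_add 1) (by simp)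
  refine (h4.congr fun j => ?_).trans (by simp)
  rw [deriv_arctanTrunc (by positivity)]

/-- A function whose truncations are approximable, at a common scale, is approximable. -/
theorem StrongGrad.approximable_of_arctanTrunc (hΩ : IsOpen Ω) (hM : RegularIntegrand Ω M)
    {u : Rn n → ℝ} {v : Rn n → Rn n} (h : StrongGrad u v) {lam : ℝ} {B : ℝ≥0∞}
    (hmod : modular Ω M (fun x => lam⁻¹ • v x) ≠ ⊤)
    (happ : ∀ t : ℝ, 0 < t → Approximable Ω M lam B (fun x => arctanTrunc t (u x))
      (fun x => deriv (arctanTrunc t) (u x) • v x)) :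
    Approximable Ω M (2 * lam) B u v := by
  have ht : ∀ j : ℕ, (0 : ℝ) < ((j : ℝ) + 1)⁻¹ := fun j => by positivity
  have hum : AEStronglyMeasurable u (volume.restrict Ω) := h.integrable.1.restrict
  have hvm : AEStronglyMeasurable v (volume.restrict Ω) := h.integrable_grad.1.restrict
  have hum' : ∀ t, AEStronglyMeasurable (fun x => arctanTrunc t (u x)) (volume.restrict Ω) :=
    fun t => (contDiff_arctanTrunc t).continuous.comp_aestronglyMeasurable hum
  have hvm' : ∀ t, AEStronglyMeasurable (fun x => deriv (arctanTrunc t) (u x) • v x)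
      (volume.restrict Ω) := fun t =>
    (((contDiff_arctanTrunc t).continuous_deriv (by simp)).comp_aestronglyMeasurable hum).smul hvm
  have hfac : ∀ (j : ℕ) s, |deriv (arctanTrunc ((j : ℝ) + 1)⁻¹) s - 1| ≤ 1 := fun j s => by
    obtain ⟨h0, h1⟩ := deriv_arctanTrunc_mem (ht j) s
    rw [abs_le]
    constructor <;> linarith
  have lim1 : Tendsto (fun j : ℕ => eLpNorm (fun x => arctanTrunc ((j : ℝ) + 1)⁻¹ (u x) - u x) 1
      (volume.restrict Ω)) atTop (𝓝 0) := by
    simp_rw [eLpNorm_one_eq_lintegral_enorm]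
    refine tendsto_lintegral_zero (h := fun x => 2 * ‖u x‖ₑ) (e := fun _ _ => 0)
      (fun j => ((hum' _).sub hum).enorm) (hum.enorm.const_mul 2) ?_ (fun j => ?_) (by simp) ?_
    · rw [lintegral_const_mul' _ _ (by simp)]
      exact ENNReal.mul_ne_top (by simp) h.integrable.restrict.2.ne
    · refine Eventually.of_forall fun x => ?_
      rw [add_zero, two_mul]
      refine enorm_sub_le.trans ?_
      gcongr
      simp only [Real.enorm_eq_ofReal_abs]
      exact ENNReal.ofReal_le_ofReal (abs_arctanTrunc_le_abs (ht j) _)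
    · refine Eventually.of_forall fun x => ?_
      simpa using ((tendsto_arctanTrunc (u x)).sub_const (u x)).enorm
  have hpt : ∀ x, Tendsto (fun j : ℕ => deriv (arctanTrunc ((j : ℝ) + 1)⁻¹) (u x) • v x - v x)
      atTop (𝓝 0) := fun x => by
    simpa using ((tendsto_deriv_arctanTrunc (u x)).smul_const (v x)).sub_const (v x)
  have lim2 : Tendsto (fun j : ℕ => eLpNorm (fun x =>
      deriv (arctanTrunc ((j : ℝ) + 1)⁻¹) (u x) • v x - v x) 1 (volume.restrict Ω)) atTop
      (𝓝 0) := by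
    simp_rw [eLpNorm_one_eq_lintegral_enorm]
    refine tendsto_lintegral_zero (h := fun x => ‖v x‖ₑ) (e := fun _ _ => 0)
      (fun j => ((hvm' _).sub hvm).enorm) hvm.enorm h.integrable_grad.restrict.2.ne (fun j => ?_)
      (by simp) ?_
    · refine Eventually.of_forall fun x => ?_
      rw [add_zero, enorm_le_iff_norm_le]
      have e : deriv (arctanTrunc ((j : ℝ) + 1)⁻¹) (u x) • v x - v x =
          (deriv (arctanTrunc ((j : ℝ) + 1)⁻¹) (u x) - 1) • v x := by rw [sub_smul, one_smul]
      rw [e, norm_smul]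
      exact mul_le_of_le_one_left (norm_nonneg _) (hfac j _)
    · refine Eventually.of_forall fun x => ?_
      simpa using (hpt x).enorm
  have hmeas : ∀ j : ℕ, AEMeasurable (fun x => lam⁻¹ •
      (deriv (arctanTrunc ((j : ℝ) + 1)⁻¹) (u x) • v x - v x)) (volume.restrict Ω) := fun j =>
    (((hvm' _).sub hvm).const_smul lam⁻¹).aemeasurable
  have hmeas' : AEMeasurable (fun x => lam⁻¹ • v x) (volume.restrict Ω) :=
    (hvm.const_smul lam⁻¹).aemeasurable
  have lim3 : Tendsto (fun j : ℕ => modular Ω M fun x => lam⁻¹ •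
      (deriv (arctanTrunc ((j : ℝ) + 1)⁻¹) (u x) • v x - v x)) atTop (𝓝 0) := by
    refine tendsto_lintegral_zero (h := fun x => ENNReal.ofReal (M x (lam⁻¹ • v x)))
      (e := fun _ _ => 0) (fun j => hM.aemeasurable_comp hΩ (hmeas j))
      (hM.aemeasurable_comp hΩ hmeas') hmod (fun j => ?_) (by simp) ?_
    · filter_upwards [ae_restrict_mem hΩ.measurableSet] with x hx
      rw [add_zero]
      refine ENNReal.ofReal_le_ofReal ?_
      have e : lam⁻¹ • (deriv (arctanTrunc ((j : ℝ) + 1)⁻¹) (u x) • v x - v x) =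
          (deriv (arctanTrunc ((j : ℝ) + 1)⁻¹) (u x) - 1) • lam⁻¹ • v x := by module
      rw [e]
      exact hM.smul_le hx (hfac j _) _
    · filter_upwards [ae_restrict_mem hΩ.measurableSet] with x hx
      have := hM.tendsto_ofReal hx ((hpt x).const_smul lam⁻¹)
      simpa [hM.map_zero x hx] using this
  refine Approximable.of_approx hΩ hM hum hvm fun ε hε => ?_
  have e1 := ENNReal.tendsto_nhds_zero.1 lim1 ε hε
  have e2 := ENNReal.tendsto_nhds_zero.1 lim2 ε hε
  have e3 := ENNReal.tendsto_nhds_zero.1 lim3 ε hε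
  obtain ⟨j, h1, h2, h3⟩ := (e1.and (e2.and e3)).exists
  exact ⟨_, _, happ _ (ht j), hum' _, hvm' _, h1, h2, h3⟩

/-! ### The density theorem -/

/-- A sequence of approximations is turned into a family indexed by `δ > 0`, using its member of
index `⌊1 / δ⌋`. -/
theorem Approximable.exists_family {lam : ℝ} (hlam : 0 < lam) {B : ℝ≥0∞} {φ : Rn n → ℝ}
    {G : Rn n → Rn n} (h : Approximable Ω M lam B φ G)
    (hφ : AEStronglyMeasurable φ (volume.restrict Ω)) :
    ∃ φδ : ℝ → Rn n → ℝ, (∀ δ, 0 < δ → φδ δ ∈ CcInfty Ω) ∧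
      Tendsto (fun δ => eLpNorm (fun x => φδ δ x - φ x) 1 (volume.restrict Ω)) (𝓝[>] 0) (𝓝 0) ∧
      TendstoInMeasure (volume.restrict Ω) φδ (𝓝[>] 0) φ ∧
      TendstoModular Ω M (fun δ => ∇ (φδ δ)) (𝓝[>] 0) G ∧
      ∀ δ, eLpNorm (φδ δ) ⊤ (volume.restrict Ω) ≤ B := by
  obtain ⟨ψ, hψ, hb⟩ := h.exists_seq
  have hfl : Tendsto (fun δ : ℝ => ⌊δ⁻¹⌋₊) (𝓝[>] 0) atTop :=
    tendsto_nat_floor_atTop.comp tendsto_inv_nhdsGT_zero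
  have hlim := tendsto_inv_nat_add_one.comp hfl
  have h1 : Tendsto (fun δ : ℝ => eLpNorm (fun x => ψ ⌊δ⁻¹⌋₊ x - φ x) 1 (volume.restrict Ω))
      (𝓝[>] 0) (𝓝 0) := tendsto_zero_of_le hlim fun δ => (hψ _).fun_le
  refine ⟨fun δ => ψ ⌊δ⁻¹⌋₊, fun δ _ => (hψ _).mem, h1, ?_, ?_, fun δ => ?_⟩
  · exact tendstoInMeasure_of_tendsto_eLpNorm one_ne_zero
      (fun δ => (hψ _).mem.1.continuous.aestronglyMeasurable) hφ h1
  · exact ⟨lam, hlam, tendsto_zero_of_le hlim fun δ => (hψ _).modular_le⟩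
  · rw [eLpNorm_exponent_top]
    exact eLpNormEssSup_le_of_ae_enorm_bound (Eventually.of_forall (hb _))

theorem StrongGrad.congr_fun {u u' : Rn n → ℝ} {v : Rn n → Rn n} (h : StrongGrad u v)
    (hu : u =ᵐ[volume] u') : StrongGrad u' v := by
  obtain ⟨ψ, hψ, h1, h2⟩ := h.approx
  refine ⟨h.integrable.congr hu, h.integrable_grad, ψ, hψ, h1.congr fun k => ?_, h2⟩
  exact eLpNorm_congr_ae (by filter_upwards [hu] with x hx; rw [hx])

theorem abs_clip_le {b : ℝ} (hb : 0 ≤ b) (s : ℝ) : |max (-b) (min s b)| ≤ b :=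
  abs_le.2 ⟨le_max_left _ _, max_le (by linarith) (min_le_right _ _)⟩

theorem abs_clip_sub_clip_le (b s t : ℝ) :
    |max (-b) (min s b) - max (-b) (min t b)| ≤ |s - t| := by
  rw [max_comm (-b), max_comm (-b)]
  refine (abs_max_sub_max_le_abs _ _ _).trans ?_
  simpa using abs_min_sub_min_le_max s b t b

theorem clip_eq_self {b s : ℝ} (h : |s| ≤ b) : max (-b) (min s b) = s := by
  rw [abs_le] at h
  rw [min_eq_left h.2, max_eq_right h.1]

/-- An essentially bounded function may be clipped at its essential supremum, which changes it only
on a null set. -/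
theorem indicator_ae_eq_clip (hΩ : IsOpen Ω) {φ : Rn n → ℝ}
    (hφ : MemLp φ ⊤ (volume.restrict Ω)) :
    Ω.indicator φ =ᵐ[volume] fun x =>
      max (-(eLpNorm φ ⊤ (volume.restrict Ω)).toReal)
        (min (Ω.indicator φ x) (eLpNorm φ ⊤ (volume.restrict Ω)).toReal) := by
  have h1 := ae_le_eLpNormEssSup (f := φ) (μ := volume.restrict Ω)
  rw [ae_restrict_iff' hΩ.measurableSet] at h1
  filter_upwards [h1] with x hx
  rw [clip_eq_self]
  by_cases hxΩ : x ∈ Ω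
  · rw [indicator_of_mem hxΩ]
    have h2 := hx hxΩ
    rw [← eLpNorm_exponent_top] at h2
    have h3 := (ENNReal.toReal_le_toReal (by simp) hφ.2.ne).2 h2
    simpa using h3
  · simp [hxΩ]

end MusielakOrlicz

open MusielakOrlicz

theorem mainTheorem2 (n : ℕ) (hn : 1 ≤ n) (Ω : Set (Rn n)) (hΩ : IsBoundedLipschitzDomain Ω) :
    ∃ c : ℝ, 0 < c ∧
      ∀ M : Rn n → Rn n → ℝ, IsWeakNFunction Ω M →
        ContinuousOn (Function.uncurry M) (Ω ×ˢ (univ : Set (Rn n))) →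
        -- (i) the case `γ = 0`
        ((IsotropicCondition Ω M 0 ∨ OrthotropicCondition Ω M 0) →
          ∀ φ ∈ V10LM Ω M, ∀ G : Rn n → Rn n, HasWeakGradient Ω φ G →
            ∃ φδ : ℝ → Rn n → ℝ,
              (∀ δ, 0 < δ → φδ δ ∈ CcInfty Ω) ∧
              Tendsto (fun δ => eLpNorm (fun x => φδ δ x - φ x) 1 (volume.restrict Ω))
                (𝓝[>] 0) (𝓝 0) ∧
              TendstoInMeasure (volume.restrict Ω) φδ (𝓝[>] 0) φ ∧
              TendstoModular Ω M (fun δ => ∇ (φδ δ)) (𝓝[>] 0) G ∧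
              (MemLp φ ⊤ (volume.restrict Ω) → ∀ δ, 0 < δ →
                eLpNorm (φδ δ) ⊤ (volume.restrict Ω) ≤
                  ENNReal.ofReal c * eLpNorm φ ⊤ (volume.restrict Ω))) ∧
        -- (ii) the case `γ ∈ (0, 1]`
        (∀ γ : ℝ≥0, 0 < γ → γ ≤ 1 →
          (IsotropicCondition Ω M γ ∨ OrthotropicCondition Ω M γ) →
          ∀ φ ∈ V10LM Ω M ∩ HolderSpace Ω γ, ∀ G : Rn n → Rn n, HasWeakGradient Ω φ G →
            ∃ φδ : ℝ → Rn n → ℝ,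
              (∀ δ, 0 < δ → φδ δ ∈ CcInfty Ω) ∧
              Tendsto (fun δ => eLpNorm (fun x => φδ δ x - φ x) 1 (volume.restrict Ω))
                (𝓝[>] 0) (𝓝 0) ∧
              TendstoInMeasure (volume.restrict Ω) φδ (𝓝[>] 0) φ ∧
              TendstoModular Ω M (fun δ => ∇ (φδ δ)) (𝓝[>] 0) G ∧
              (MemLp φ ⊤ (volume.restrict Ω) → ∀ δ, 0 < δ →
                eLpNorm (φδ δ) ⊤ (volume.restrict Ω) ≤
                  ENNReal.ofReal c * eLpNorm φ ⊤ (volume.restrict Ω))) := by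
  obtain ⟨N, hN⟩ := hΩ.exists_approximable
  have hopen := hΩ.isOpen
  refine ⟨N + 1, by positivity, fun M hMw hMc => ?_⟩
  have hM := hMw.regularIntegrand hopen hMc
  have hbal : ∀ γ : ℝ, γ ≤ 1 → IsotropicCondition Ω M γ ∨ OrthotropicCondition Ω M γ →
      ∃ C A, Balanced Ω M γ C A := fun γ hγ h =>
    h.elim (fun h => h.balanced hn hopen hM hγ) (fun h => h.balanced hopen hM hγ)
  -- a scale at which the gradient, extended by zero, has finite modular
  have hscale : ∀ φ ∈ V10LM Ω M, ∀ G, HasWeakGradient Ω φ G →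
      ∃ lam : ℝ, 0 < lam ∧ modular Ω M (fun x => lam⁻¹ • Ω.indicator G x) ≠ ⊤ := by
    rintro φ ⟨-, G', hG', hLM⟩ G hG
    obtain ⟨lam, hlam, hfin⟩ := exists_modular_ne_top_of_mem_LM hM hopen hLM
    refine ⟨lam, hlam, ?_⟩
    rw [modular_congr (v' := fun x => lam⁻¹ • G' x)]
    · exact hfin
    · filter_upwards [hG.ae_eq hopen hG', ae_restrict_mem hopen.measurableSet] with x hx hxΩ
      rw [indicator_of_mem hxΩ, hx]
  have hu_ae : ∀ f : Rn n → ℝ, Ω.indicator f =ᵐ[volume.restrict Ω] f := fun f =>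
    indicator_ae_eq_restrict hopen.measurableSet
  have hv_ae : ∀ f : Rn n → Rn n, Ω.indicator f =ᵐ[volume.restrict Ω] f := fun f =>
    indicator_ae_eq_restrict hopen.measurableSet
  -- essentially bounded functions, clipped at their essential supremum
  have hbdd : ∀ γ C A : ℝ, 0 ≤ γ → γ ≤ 1 → Balanced Ω M γ C A → ∀ φ ∈ V10LM Ω M,
      ∀ G, HasWeakGradient Ω φ G → MemLp φ ⊤ (volume.restrict Ω) → ∀ K, 0 ≤ K →
      (∀ x y, ‖x - y‖ ≤ 1 → |max (-(eLpNorm φ ⊤ (volume.restrict Ω)).toReal)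
        (min (Ω.indicator φ x) (eLpNorm φ ⊤ (volume.restrict Ω)).toReal) -
        max (-(eLpNorm φ ⊤ (volume.restrict Ω)).toReal)
        (min (Ω.indicator φ y) (eLpNorm φ ⊤ (volume.restrict Ω)).toReal)| ≤ K * ‖x - y‖ ^ γ) →
      ∃ lam, 0 < lam ∧
        Approximable Ω M lam (ENNReal.ofReal (N + 1) * eLpNorm φ ⊤ (volume.restrict Ω)) φ G := by
    intro γ C A hγ0 hγ1 hB φ hφ G hG hLinf K hK hosc
    obtain ⟨lam, hlam, hmod⟩ := hscale φ hφ G hG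
    have hC : 1 ≤ C := hB.1
    refine ⟨12 * C * lam, by positivity, ?_⟩
    -- `exists_approximable` needs bounds at every point, not only almost everywhere
    have hclip := indicator_ae_eq_clip hopen hLinf
    have happ := hN M hM γ C A hγ0 hγ1 hB _ _
      ((strongGrad_indicator hopen hφ.1 hG).congr_fun hclip) (fun x hx => by simp [hx])
      (fun x hx => by simp [hx]) _ (fun x => abs_clip_le ENNReal.toReal_nonneg _) K hK hosc lam hlam
      hmod
    refine (happ.congr (EventuallyEq.trans (ae_restrict_of_ae hclip.symm) (hu_ae φ))
      (hv_ae G)).mono ?_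
    rw [ENNReal.ofReal_toReal hLinf.2.ne, ENNReal.ofReal_add (by positivity) zero_le_one,
      ENNReal.ofReal_natCast]
    gcongr
    exact le_self_add
  refine ⟨fun hcond φ hφ G hG => ?_, fun γ hγ0 hγ1 hcond φ hφ G hG => ?_⟩
  · obtain ⟨C, A, hB⟩ := hbal 0 zero_le_one hcond
    have hφm : AEStronglyMeasurable φ (volume.restrict Ω) := hφ.1.1.1
    by_cases hLinf : MemLp φ ⊤ (volume.restrict Ω)
    · obtain ⟨lam, hlam, happ⟩ := hbdd 0 C A le_rfl zero_le_one hB φ hφ G hG hLinf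
        (2 * (eLpNorm φ ⊤ (volume.restrict Ω)).toReal) (by positivity) fun x y _ => by
          rw [Real.rpow_zero, mul_one, two_mul]
          exact (abs_sub _ _).trans (add_le_add (abs_clip_le ENNReal.toReal_nonneg _)
            (abs_clip_le ENNReal.toReal_nonneg _))
      obtain ⟨φδ, h1, h2, h3, h4, h5⟩ := happ.exists_family hlam hφm
      exact ⟨φδ, h1, h2, h3, h4, fun _ δ _ => h5 δ⟩
    · obtain ⟨lam, hlam, hmod⟩ := hscale φ hφ G hG
      have hC : 1 ≤ C := hB.1
      have hsg := strongGrad_indicator hopen hφ.1 hG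
      have hpos : 0 < 12 * C * lam := by positivity
      have happ := hsg.approximable_of_arctanTrunc hopen hM (lam := 12 * C * lam) (B := ⊤)
        (hM.modular_ne_top_of_le hopen hlam (by nlinarith) hmod) fun t ht => by
          have hderiv := deriv_arctanTrunc_mem ht
          refine (hN M hM 0 C A le_rfl zero_le_one hB _ _ (hsg.comp (contDiff_arctanTrunc t)
            (by simp [arctanTrunc]) (A := 1) fun s => by
              rw [abs_of_nonneg (hderiv s).1]; exact (hderiv s).2)
            (fun x hx => by simp [hx, arctanTrunc]) (fun x hx => by simp [hx]) _
            (fun x => abs_arctanTrunc_le ht _) (2 * (t⁻¹ * (Real.pi / 2))) (by positivity)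
            (fun x y _ => ?_) lam hlam ?_).mono le_top
          · rw [Real.rpow_zero, mul_one, two_mul]
            exact (abs_sub _ _).trans (add_le_add (abs_arctanTrunc_le ht _)
              (abs_arctanTrunc_le ht _))
          · refine ne_top_of_le_ne_top hmod (hM.modular_mono hopen
              (f := fun x => deriv (arctanTrunc t) (Ω.indicator φ x)) (fun x => ?_)
              fun x => smul_comm _ _ _)
            rw [abs_of_nonneg (hderiv _).1]
            exact (hderiv _).2
      obtain ⟨φδ, h1, h2, h3, h4, -⟩ := (happ.congr (hu_ae φ) (hv_ae G)).exists_family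
        (by positivity) hφm
      exact ⟨φδ, h1, h2, h3, h4, fun h => absurd h hLinf⟩
  · obtain ⟨C, A, hB⟩ := hbal γ (by exact_mod_cast hγ1) hcond
    obtain ⟨hφ, K, hK⟩ := hφ
    have hφm : AEStronglyMeasurable φ (volume.restrict Ω) := hφ.1.1.1
    have hosc : ∀ x ∈ Ω, ∀ y ∈ Ω, |φ x - φ y| ≤ K * ‖x - y‖ ^ (γ : ℝ) := fun x hx y hy => by
      have h1 := hK x hx y hy
      rw [edist_dist, edist_dist x,
        ENNReal.ofReal_rpow_of_nonneg dist_nonneg γ.coe_nonneg,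
        ← ENNReal.ofReal_coe_nnreal, ← ENNReal.ofReal_mul K.coe_nonneg,
        ENNReal.ofReal_le_ofReal_iff (by positivity), Real.dist_eq, dist_eq_norm] at h1
      exact h1
    have hγ0' : (0 : ℝ) < γ := hγ0
    have hLinf : MemLp φ ⊤ (volume.restrict Ω) := by
      obtain ⟨x₀, hx₀⟩ := hΩ.isConnected.nonempty
      obtain ⟨D, hD⟩ := hΩ.isBounded.subset_closedBall x₀
      refine memLp_top_of_bound hφm (|φ x₀| + K * D ^ (γ : ℝ)) ?_
      filter_upwards [ae_restrict_mem hopen.measurableSet] with x hx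
      have h1 := hosc x hx x₀ hx₀
      have h2 : ‖x - x₀‖ ≤ D := by simpa [dist_eq_norm] using hD hx
      have h3 : (K : ℝ) * ‖x - x₀‖ ^ (γ : ℝ) ≤ K * D ^ (γ : ℝ) := by gcongr
      have h4 := abs_sub_abs_le_abs_sub (φ x) (φ x₀)
      rw [Real.norm_eq_abs]
      linarith
    have hglob := (strongGrad_indicator hopen hφ.1 hG).holder_of_holderOn hΩ
      (fun x hx => indicator_of_notMem hx φ) K.2 hγ0' fun x hx y hy => by
        rw [indicator_of_mem hx, indicator_of_mem hy]; exact hosc x hx y hy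
    obtain ⟨lam, hlam, happ⟩ := hbdd γ C A hγ0'.le (by exact_mod_cast hγ1) hB φ hφ G hG hLinf
      K K.2 fun x y _ => (abs_clip_sub_clip_le _ _ _).trans (hglob x y)
    obtain ⟨φδ, h1, h2, h3, h4, h5⟩ := happ.exists_family hlam hφm
    exact ⟨φδ, h1, h2, h3, h4, fun _ δ _ => h5 δ⟩
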